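/- Fix a finite alphabet $\Sigma$ and a binary predicate $A\subseteq\Sigma^*\times\Sigma^*$; write $A(x)=\{y : A(x,y)\}$ and $|x|$ for the length of $x$. The model of computation is the random access machine (RAM): registers hold unbounded natural numbers, arithmetic and comparison take time logarithmic in the sum of their arguments, every other instruction takes constant time, one instruction flips a fair coin, and one instruction outputs the content of a block of consecutive registers. The space used is the sum of the lengths of the integers in the registers up to the last one accessed. Assume that the enumeration problem of $A$ is in $\mathrm{EnumP}$: there is a polynomial $p_0$ such that $|y|\le p_0(|x|)$ for all $x$ and all $y\in A(x)$, and it can be decided in deterministic polynomial time, given $x$ and $y$, whether $y\in A(x)$. Assume moreover that it has a polynomial-time uniform generator: a randomized RAM that on every input $x$ always halts in time polynomial in $|x|$ and that, whenever $A(x)\neq\emptyset$, outputs either one element of $A(x)$ or nothing (failure), fails with probability at most $1/2$, and outputs every element of $A(x)$ with the same probability. Then the enumeration problem of $A$ can be solved with high probability in incremental linear time and polynomial space, with repetitions allowed. That is, there are a randomized RAM $M$, polynomials $p,q$ and constants $C,b$ such that for every input $x$ and every $m\in\mathbb N$ given to $M$ together with $x$, with $N=|x|+m$: - in every run, $M$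 uses at every moment space at most $q(N)$; - with probability at least $1-2^{-m}$, $M$ halts, the set of the words it has output is exactly $A(x)$ (the same word may be output several times), and, writing $T(k)$ for the time at which the $k$-th distinct solution is output, $T(1)\le p(N)$ if $A(x)\ne\emptyset$, $T(k)-T(1)\le C\,k\,(N+1)^b$ for all $1\le k\le |A(x)|$, and the total time until $M$ halts is at most $p(N)+C\,|A(x)|\,(N+1)^b$. -/

import Mathlib

namespace EnumRAM

/-! ## The random access machine

Registers `R 0, R 1, …` hold unbounded natural numbers.  Subtraction is truncated at zero. -/

/-- The instructions of the machine. -/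
inductive Instr where
  /-- `R i := c` -/
  | const (i c : ℕ)
  /-- `R i := R j` -/
  | copy (i j : ℕ)
  /-- `R i := R j + R k` -/
  | add (i j k : ℕ)
  /-- `R i := R j - R k` -/
  | sub (i j k : ℕ)
  /-- `R i := R j * R k` -/
  | mul (i j k : ℕ)
  /-- `R i := R (R j)` -/
  | load (i j : ℕ)
  /-- `R (R i) := R j` -/
  | store (i j : ℕ)
  /-- unconditional jump to instruction number `l` -/
  | jump (l : ℕ)
  /-- jump to instruction number `l` if `R i < R j` -/
  | jumpLT (i j l : ℕ)
  /-- `R i := ` a fresh fair coin flip, `0` or `1` -/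
  | flip (i : ℕ)
  /-- output the word `R a, R (a+1), …, R b`, where `a = R i` and `b = R j`;
  it is the empty word if `b < a` -/
  | output (i j : ℕ)
  deriving DecidableEq

/-- A program is a list of instructions; the machine halts when the program counter leaves it. -/
abbrev Program := List Instr

/-- Configurations of the machine. -/
structure Cfg where
  /-- program counter -/
  pc : ℕ
  /-- contents of the registers -/
  reg : ℕ → ℕ
  /-- all the registers accessed so far have an index `< top` -/
  top : ℕ
  /-- number of coins flipped so far -/
  flips : ℕ
  /-- time used so far -/
  time : ℕ
  /-- the words output so far, in order, each with the time at which it was output -/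
  out : List (ℕ × List ℕ)

/-- The length of the binary representation of an integer. -/
def bitLength (v : ℕ) : ℕ := max 1 (Nat.size v)

/-- The time taken by an instruction: constant, except for arithmetic and comparison, which take
time logarithmic in the sum of their arguments. -/
def Instr.cost (r : ℕ → ℕ) : Instr → ℕ
  | .add _ j k => bitLength (r j + r k)
  | .sub _ j k => bitLength (r j + r k)
  | .mul _ j k => bitLength (r j + r k)
  | .jumpLT i j _ => bitLength (r i + r j)
  | _ => 1

/-- The registers accessed by an instruction. -/
def Instr.accessed (r : ℕ → ℕ) : Instr → List ℕ
  | .const i _ => [i]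
  | .copy i j => [i, j]
  | .add i j k => [i, j, k]
  | .sub i j k => [i, j, k]
  | .mul i j k => [i, j, k]
  | .load i j => [i, j, r j]
  | .store i j => [i, j, r i]
  | .jump _ => []
  | .jumpLT i j _ => [i, j]
  | .flip i => [i]
  | .output i j => i :: j :: List.range' (r i) (r j + 1 - r i)

/-- The contents of the registers after an instruction; `b` is the next coin. -/
def Instr.newReg (r : ℕ → ℕ) (b : Bool) : Instr → ℕ → ℕ
  | .const i c => Function.update r i c
  | .copy i j => Function.update r i (r j)
  | .add i j k => Function.update r i (r j + r k)
  | .sub i j k => Function.update r i (r j - r k)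
  | .mul i j k => Function.update r i (r j * r k)
  | .load i j => Function.update r i (r (r j))
  | .store i j => Function.update r (r i) (r j)
  | .jump _ => r
  | .jumpLT _ _ _ => r
  | .flip i => Function.update r i b.toNat
  | .output _ _ => r

/-- The program counter after an instruction. -/
def Instr.newPC (r : ℕ → ℕ) (pc : ℕ) : Instr → ℕ
  | .jump l => l
  | .jumpLT i j l => if r i < r j then l else pc + 1
  | _ => pc + 1

/-- The number of coins used by an instruction. -/
def Instr.usedCoins : Instr → ℕ
  | .flip _ => 1
  | _ => 0

/-- The words output by an instruction (at most one). -/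
def Instr.emits (r : ℕ → ℕ) : Instr → List (List ℕ)
  | .output i j => [(List.range' (r i) (r j + 1 - r i)).map r]
  | _ => []

/-- A sequence of coins, and its law: independent fair coins. -/
abbrev Coins := ℕ → Bool

/-- The law of a sequence of independent fair coins. -/
noncomputable def coinLaw : MeasureTheory.Measure Coins :=
  MeasureTheory.Measure.infinitePi fun _ : ℕ => (PMF.uniformOfFintype Bool).toMeasure

/-- Effect of one instruction. -/
def Instr.exec (ω : Coins) (c : Cfg) (I : Instr) : Cfg where
  pc := I.newPC c.reg c.pc
  reg := I.newReg c.reg (ω c.flips)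
  top := (I.accessed c.reg).foldr (fun a b => max (a + 1) b) c.top
  flips := c.flips + I.usedCoins
  time := c.time + I.cost c.reg
  out := c.out ++ (I.emits c.reg).map fun w => (c.time + I.cost c.reg, w)

/-- One step of the program `P` with coins `ω`; nothing happens once the machine has halted. -/
def step (P : Program) (ω : Coins) (c : Cfg) : Cfg :=
  match P[c.pc]? with
  | some I => I.exec ω c
  | none => c

/-- The initial configuration: the list `inp` in the first registers, all the others zero. -/
def init (inp : List ℕ) : Cfg where
  pc := 0
  reg := fun i => inp.getD i 0
  top := inp.length
  flips := 0
  time := 0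
  out := []

/-- The configuration after `t` steps. -/
def run (P : Program) (ω : Coins) (inp : List ℕ) (t : ℕ) : Cfg := (step P ω)^[t] (init inp)

/-- `P` halts on the input `inp` with coins `ω`, in the configuration `c`. -/
def HaltsAt (P : Program) (ω : Coins) (inp : List ℕ) (c : Cfg) : Prop :=
  (∃ t, run P ω inp t = c) ∧ P.length ≤ c.pc

/-- The space used in a configuration: the sum of the lengths of the integers in the registers,
up to the last register accessed. -/
def Cfg.space (c : Cfg) : ℕ := ∑ i ∈ Finset.range c.top, bitLength (c.reg i)

/-- The words output so far. -/
def Cfg.words (c : Cfg) : List (List ℕ) := c.out.map Prod.snd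

/-- The number of distinct words output up to time `t`. -/
def Cfg.distinctBy (c : Cfg) (t : ℕ) : ℕ :=
  ((c.out.filter fun o => o.1 ≤ t).map Prod.snd).toFinset.card

/-- The time at which the `k`-th new word is output, a repetition of a word not being counted. -/
noncomputable def Cfg.incTime (c : Cfg) (k : ℕ) : ℕ := sInf {t | k ≤ c.distinctBy t}

/-! ## Enumeration problems

Words are over the alphabet `Fin s`, `s` arbitrary.  The enumeration problem of a binary predicate
is given by the map `A` that sends an instance `x` to the set `A x` of its solutions. -/

/-- A word as a list of register contents, one letter in each register. -/
def letters {s : ℕ} (x : List (Fin s)) : List ℕ := x.map Fin.val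

/-- The solutions of all instances have polynomially bounded length. -/
def PolynomiallyBalanced {s : ℕ} (A : List (Fin s) → Set (List (Fin s))) : Prop :=
  ∃ p : Polynomial ℕ, ∀ x, ∀ y ∈ A x, y.length ≤ p.eval x.length

/-- It can be decided in (deterministic) polynomial time, given `x` and `y`, whether `y ∈ A x`. -/
def TestInP {s : ℕ} (A : List (Fin s) → Set (List (Fin s))) : Prop :=
  ∃ (P : Program) (p : Polynomial ℕ), (∀ i, Instr.flip i ∉ P) ∧
    ∀ (x y : List (Fin s)) (ω : Coins), ∃ c,
      HaltsAt P ω (x.length :: y.length :: (letters x ++ letters y)) c ∧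
      c.time ≤ p.eval (x.length + y.length) ∧
      (c.reg 0 = 1 ↔ y ∈ A x)

/-- The class `EnumP`. -/
def EnumP {s : ℕ} (A : List (Fin s) → Set (List (Fin s))) : Prop :=
  PolynomiallyBalanced A ∧ TestInP A

/-- Polynomial time uniform generator: a randomized program which always halts within polynomial
time and which, if `A x` is not empty, either outputs exactly one word, a solution of `x`, or fails
by outputting nothing; it fails with probability at most `1/2`, and all the solutions of `x` are
output with the same probability.  (With fair coins and a worst-case time bound, a program that
never fails could be exactly uniform only on sets whose cardinality is a power of two.) -/
def HasPolyTimeUniformGenerator {s : ℕ} (A : List (Fin s) → Set (List (Fin s))) : Prop :=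
  ∃ (P : Program) (p : Polynomial ℕ), ∀ x : List (Fin s),
    (∀ ω : Coins, ∃ c, HaltsAt P ω (x.length :: letters x) c ∧ c.time ≤ p.eval x.length) ∧
    ((A x).Nonempty →
      (∀ ω c, HaltsAt P ω (x.length :: letters x) c →
        c.words = [] ∨ ∃ y ∈ A x, c.words = [letters y]) ∧
      (∀ y ∈ A x, ∀ y' ∈ A x,
        coinLaw {ω | ∃ c, HaltsAt P ω (x.length :: letters x) c ∧ c.words = [letters y]} =
        coinLaw {ω | ∃ c, HaltsAt P ω (x.length :: letters x) c ∧ c.words = [letters y']}) ∧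
      coinLaw {ω | ∃ c, HaltsAt P ω (x.length :: letters x) c ∧ c.words = []} ≤ 1 / 2)

/-- On the instance `x` with confidence parameter `m` and with the coins `ω`, the program `P` halts
and outputs exactly the elements of `A x`, with repetitions allowed, with
* preprocessing time `T(1) ≤ p(|x| + m)`,
* incremental linear time `T(k) ≤ T(1) + C * k * (|x| + m + 1) ^ b` for all `1 ≤ k ≤ |A(x)|`,
* total time (up to halting) at most `p(|x| + m) + C * |A(x)| * (|x| + m + 1) ^ b`,

where `T(k)` is the time at which the `k`-th distinct solution is output. -/
def SolvesInIncLinearTime {s : ℕ} (A : List (Fin s) → Set (List (Fin s))) (P : Program)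
    (p : Polynomial ℕ) (C b : ℕ) (x : List (Fin s)) (m : ℕ) (ω : Coins) : Prop :=
  ∃ c, HaltsAt P ω (x.length :: m :: letters x) c ∧
    {w | w ∈ c.words} = letters '' A x ∧
    ((A x).Nonempty → c.incTime 1 ≤ p.eval (x.length + m)) ∧
    (∀ k, 1 ≤ k → k ≤ (A x).ncard →
      c.incTime k ≤ c.incTime 1 + C * k * (x.length + m + 1) ^ b) ∧
    c.time ≤ p.eval (x.length + m) + C * (A x).ncard * (x.length + m + 1) ^ b

/-- The enumeration problem of `A` can be solved with high probability in incremental linear time,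
with repetitions, and in polynomial space.  The program gets, besides the instance `x`, a number
`m`, and may err, or exceed the time bounds, with probability at most `2 ^ (-m)` only; the space
bound holds at every step of every run. -/
def SolvableWHPIncLinearPolySpaceWithRepetitions {s : ℕ}
    (A : List (Fin s) → Set (List (Fin s))) : Prop :=
  ∃ (P : Program) (p q : Polynomial ℕ) (C b : ℕ), ∀ (x : List (Fin s)) (m : ℕ),
    (∀ (ω : Coins) (t : ℕ),
      (run P ω (x.length :: m :: letters x) t).space ≤ q.eval (x.length + m)) ∧
    1 - (1 / 2) ^ m ≤ coinLaw {ω | SolvesInIncLinearTime A P p C b x m ω}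

end EnumRAM

namespace EnumRAM

/-! ## A structured language and its compilation -/

/-! The machine draws solutions with the generator, outputs each one at once, and stops by a rule
that keeps no record of the solutions found, since such a record could take exponential space. The
first solution drawn becomes the reference; the run ends when the reference has been drawn `K` more
times, or when the first `K` draws all give nothing. Here `K = κ * (N + 1) ^ d`, which also bounds
the time of the generator and the length of the solutions.

Probability. Let n be the number of solutions and ρ the probability of each in one draw, so that nρ
≥ 1/2. The first `K` draws all fail with probability at most 2^(-K). For solutions z ≠ y, the draws
that hit {z, y} behave like fair coin tosses, so z occurs `K` times before y with probability at
most 2^(-K) (`UniformDraw.prob_race`). Asking this for all ordered pairs covers the random choice of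
the reference, hence nothing is missing at the stop. Except with probability 2^(-K), a given
solution occurs more than `K` times in 8nK draws (`UniformDraw.prob_count`), which forces the stop
by then. While fewer than k ≤ n/2 solutions are known, a draw is new with probability at least 1/4,
so 12kK draws give k solutions except with probability 2^(-K) (`UniformDraw.prob_distinct`); for k >
n/2, 16kK draws already exceed the 8nK draws of the whole run. At most 4n² bad events occur in the
union bound, and `K` satisfies 4n²2^m ≤ 2^K, which a polynomial allows because n is at most
exponential. All tails come from one potential argument, `UniformDraw.prob_foldl_le`;
`UniformDraw.outcome` is the deterministic part.

Space. A polynomial-time program can reach, by indirect addressing, a register of exponentially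
large index, and the space then counts all the registers up to it. The generator and the test are
therefore interpreted on a memory kept as a log of pairs (address, value), which gains at most one
pair per simulated step. The values have polynomially many bits because the logarithmic cost pays
for their growth (`reg_run_lt`). The test is needed because the generator promises nothing when
there is no solution.

Coins. The generator may use a varying number of coins, so each draw is padded with dummy flips to
exactly `K` coins. The draws then read consecutive disjoint blocks and are independent
(`coinLaw_inter_shift`).

Verification. The predicate `WP` follows, for fixed coins, the result, the number of steps, and
bounds on addresses and contents at every intermediate moment. These bounds hold for every sequence
of coins, including those for which the machine never halts (`good_run`). -/

/-- Structured programs: straight-line blocks, sequences, conditionals and loops. -/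
inductive Cmd where
  | blk (l : List Instr)
  | seq (c d : Cmd)
  /-- `if R i < R j then c else d` -/
  | ite (i j : ℕ) (c d : Cmd)
  /-- `while R i < R j do c` -/
  | loop (i j : ℕ) (c : Cmd)

infixr:65 " ;; " => Cmd.seq

namespace Cmd

/-- The length of the compiled code. -/
def len : Cmd → ℕ
  | blk l => l.length
  | seq c d => c.len + d.len
  | ite _ _ c d => d.len + c.len + 2
  | loop _ _ c => c.len + 3

/-- The code of a command, to be placed at the address `a`. -/
def code : Cmd → ℕ → List Instr
  | blk l, _ => l
  | seq c d, a => c.code a ++ d.code (a + c.len)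
  | ite i j c d, a =>
      .jumpLT i j (a + d.len + 2) :: (d.code (a + 1) ++
        (.jump (a + d.len + c.len + 2) :: c.code (a + d.len + 2)))
  | loop i j c, a =>
      .jumpLT i j (a + 2) :: .jump (a + c.len + 3) :: (c.code (a + 2) ++ [.jump a])

@[simp] theorem length_code (c : Cmd) (a : ℕ) : (c.code a).length = c.len := by
  induction c generalizing a <;> (simp [code, len, *]; try omega)

end Cmd

/-- The code `l` stands in the program `P` at the address `a`. -/
def CodeAt (P : Program) (a : ℕ) (l : List Instr) : Prop :=
  ∀ i, i < l.length → P[a + i]? = l[i]?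

theorem codeAt_append {P : Program} {a : ℕ} {l l' : List Instr} :
    CodeAt P a (l ++ l') ↔ CodeAt P a l ∧ CodeAt P (a + l.length) l' := by
  constructor
  · intro h
    refine ⟨fun i hi => ?_, fun i hi => ?_⟩
    · rw [h i (by simp; omega), List.getElem?_append_left hi]
    · rw [Nat.add_assoc, h (l.length + i) (by simp; omega), List.getElem?_append_right (by omega)]
      simp
  · rintro ⟨h, h'⟩ i hi
    by_cases hl : i < l.length
    · rw [h i hl, List.getElem?_append_left hl]
    · have := h' (i - l.length) (by simp at hi; omega)
      rw [List.getElem?_append_right (by omega), ← this]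
      congr 1; omega

theorem codeAt_cons {P : Program} {a : ℕ} {I : Instr} {l : List Instr} :
    CodeAt P a (I :: l) ↔ P[a]? = some I ∧ CodeAt P (a + 1) l := by
  rw [← List.singleton_append, codeAt_append]
  simp [CodeAt]

theorem codeAt_self (P : Program) : CodeAt P 0 P := by
  intro i _; simp

/-! ## States of the structured language -/

/-- A state: the low registers `v`, the high registers `m`, the number of coins flipped, and the
words output. -/
structure St where
  v : ℕ → ℕ
  m : ℕ → ℕ
  fl : ℕ
  out : List (List ℕ)

/-- The configuration `c` is described by `σ`, the registers below `D` being the low ones. -/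
structure Rep (D : ℕ) (c : Cfg) (σ : St) : Prop where
  low : ∀ i, i < D → c.reg i = σ.v i
  high : ∀ i, D ≤ i → c.reg i = σ.m i
  fl : c.flips = σ.fl
  out : c.words = σ.out

/-- A bound on the registers accessed and on their contents. -/
structure Good (T W : ℕ) (c : Cfg) : Prop where
  top : c.top ≤ T
  reg : ∀ r, c.reg r < W

/-- The instruction can be executed in the state `σ` within the bounds. -/
def Instr.ok (D T W : ℕ) (σ : St) : Instr → Prop
  | .const i c => i < D ∧ c < W
  | .copy i j => i < D ∧ j < D
  | .add i j k => i < D ∧ j < D ∧ k < D ∧ σ.v j + σ.v k < W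
  | .sub i j k => i < D ∧ j < D ∧ k < D
  | .mul i j k => i < D ∧ j < D ∧ k < D ∧ σ.v j * σ.v k < W
  | .load i j => i < D ∧ j < D ∧ D ≤ σ.v j ∧ σ.v j < T
  | .store i j => i < D ∧ j < D ∧ D ≤ σ.v i ∧ σ.v i < T
  | .flip i => i < D
  | .output i j => i < D ∧ j < D ∧ D ≤ σ.v i ∧ σ.v j < T
  | .jump _ => False
  | .jumpLT _ _ _ => False

/-- The effect of an instruction on a state. -/
def Instr.ev (ω : Coins) (σ : St) : Instr → St
  | .const i c => { σ with v := Function.update σ.v i c }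
  | .copy i j => { σ with v := Function.update σ.v i (σ.v j) }
  | .add i j k => { σ with v := Function.update σ.v i (σ.v j + σ.v k) }
  | .sub i j k => { σ with v := Function.update σ.v i (σ.v j - σ.v k) }
  | .mul i j k => { σ with v := Function.update σ.v i (σ.v j * σ.v k) }
  | .load i j => { σ with v := Function.update σ.v i (σ.m (σ.v j)) }
  | .store i j => { σ with m := Function.update σ.m (σ.v i) (σ.v j) }
  | .flip i => { σ with v := Function.update σ.v i (ω σ.fl).toNat, fl := σ.fl + 1 }
  | .output i j =>
      { σ with out := σ.out ++ [(List.range' (σ.v i) (σ.v j + 1 - σ.v i)).map σ.m] }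
  | .jump _ => σ
  | .jumpLT _ _ _ => σ

theorem foldr_max_le {l : List ℕ} {b T : ℕ} (hb : b ≤ T) (hl : ∀ a ∈ l, a < T) :
    l.foldr (fun a b => max (a + 1) b) b ≤ T := by
  induction l with
  | nil => simpa
  | cons x l ih =>
    simp only [List.foldr_cons, max_le_iff]
    exact ⟨hl x (by simp), ih fun a ha => hl a (by simp [ha])⟩

theorem Rep.update_low {D : ℕ} {c : Cfg} {σ : St} (h : Rep D c σ) {i : ℕ} (hi : i < D) (x : ℕ)
    (c' : Cfg) (σ' : St) (hc : c'.reg = Function.update c.reg i x)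
    (hv : σ'.v = Function.update σ.v i x) (hm : σ'.m = σ.m) (hf : c'.flips = σ'.fl)
    (ho : c'.words = σ'.out) : Rep D c' σ' := by
  refine ⟨fun k hk => ?_, fun k hk => ?_, hf, ho⟩
  · rw [hc, hv]; by_cases hki : k = i
    · subst hki; simp
    · simp [hki, h.low k hk]
  · rw [hc, hm, Function.update_of_ne (by omega), h.high k hk]

/-- `Instr.ok` bounds constants, sums and products; every other instruction copies or decreases a
value already below `W`, or writes a coin, for which `2 ≤ W` suffices. -/
theorem Instr.exec_good {D T W : ℕ} (hD : D ≤ T) (hW : 2 ≤ W) {ω : Coins} {c : Cfg} {σ : St}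
    {I : Instr} (h : Rep D c σ) (hg : Good T W c) (hok : I.ok D T W σ) :
    Good T W (I.exec ω c) := by
  have key : ∀ i x, x < W → ∀ r, Function.update c.reg i x r < W := by
    intro i x hx r
    by_cases hr : r = i
    · subst hr; simpa
    · simpa [hr] using hg.reg r
  have hl := h.low
  constructor
  · refine foldr_max_le hg.top fun a ha => ?_
    cases I <;> simp only [Instr.accessed, Instr.ok, List.mem_cons, List.mem_range'_1,
      List.not_mem_nil, or_false] at ha hok
    case load i j => rw [hl j hok.2.1] at ha; omega
    case store i j => rw [hl i hok.1] at ha; omega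
    case output i j => rw [hl j hok.2.1, hl i hok.1] at ha; omega
    all_goals omega
  · cases I <;> simp only [Instr.exec, Instr.newReg, Instr.ok] at hok ⊢
    case const i c' => exact key _ _ hok.2
    case copy i j => exact key _ _ (hg.reg _)
    case add i j k => rw [← hl j hok.2.1, ← hl k hok.2.2.1] at hok; exact key _ _ hok.2.2.2
    case sub i j k => exact key _ _ (lt_of_le_of_lt (Nat.sub_le _ _) (hg.reg j))
    case mul i j k => rw [← hl j hok.2.1, ← hl k hok.2.2.1] at hok; exact key _ _ hok.2.2.2
    case load i j => exact key _ _ (hg.reg _)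
    case store i j => exact key _ _ (hg.reg _)
    case flip i =>
      refine key _ _ ?_
      cases ω c.flips <;> simp <;> omega
    case output i j => exact hg.reg

/-- Indirect accesses are confined to addresses `≥ D`, so the low registers and the high memory
never alias and can be described by two independent functions. -/
theorem Instr.exec_rep {D T W : ℕ} {ω : Coins} {c : Cfg} {σ : St}
    {I : Instr} (h : Rep D c σ) (hok : I.ok D T W σ) :
    Rep D (I.exec ω c) (I.ev ω σ) ∧ (I.exec ω c).pc = c.pc + 1 := by
  have hl := h.low
  have hh := h.high
  have hw := h.out
  have hf := h.fl
  simp only [Cfg.words] at hw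
  refine ⟨?_, by cases I <;> simp [Instr.ok] at hok <;> rfl⟩
  cases I <;> simp only [Instr.ok] at hok
  case const i c' =>
    exact h.update_low hok.1 c' _ _ rfl rfl rfl (by simp [exec, ev, usedCoins, hf])
      (by simp [exec, ev, emits, Cfg.words, hw])
  case copy i j =>
    exact h.update_low hok.1 _ _ _ rfl (by simp [ev, hl j hok.2]) rfl
      (by simp [exec, ev, usedCoins, hf]) (by simp [exec, ev, emits, Cfg.words, hw])
  case add i j k =>
    exact h.update_low hok.1 _ _ _ rfl (by simp [ev, hl j hok.2.1, hl k hok.2.2.1]) rfl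
      (by simp [exec, ev, usedCoins, hf]) (by simp [exec, ev, emits, Cfg.words, hw])
  case sub i j k =>
    exact h.update_low hok.1 _ _ _ rfl (by simp [ev, hl j hok.2.1, hl k hok.2.2]) rfl
      (by simp [exec, ev, usedCoins, hf]) (by simp [exec, ev, emits, Cfg.words, hw])
  case mul i j k =>
    exact h.update_low hok.1 _ _ _ rfl (by simp [ev, hl j hok.2.1, hl k hok.2.2.1]) rfl
      (by simp [exec, ev, usedCoins, hf]) (by simp [exec, ev, emits, Cfg.words, hw])
  case load i j =>
    exact h.update_low hok.1 _ _ _ rfl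
      (by simp [ev, hl j hok.2.1, hh _ hok.2.2.1]) rfl
      (by simp [exec, ev, usedCoins, hf]) (by simp [exec, ev, emits, Cfg.words, hw])
  case store i j =>
    refine ⟨fun k hk => ?_, fun k hk => ?_, by simp [exec, ev, usedCoins, hf],
      by simp [exec, ev, emits, Cfg.words, hw]⟩
    · simp only [exec, newReg, ev, hl i hok.1]
      rw [Function.update_of_ne (by omega), hl k hk]
    · simp only [exec, newReg, ev, hl i hok.1, hl j hok.2.1]
      by_cases hki : k = σ.v i
      · subst hki; simp
      · simp [hki, hh k hk]
  case flip i =>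
    exact h.update_low hok _ _ _ rfl (by simp [ev, hf]) rfl
      (by simp [exec, ev, usedCoins, hf]) (by simp [exec, ev, emits, Cfg.words, hw])
  case output i j =>
    refine ⟨fun k hk => by simp [exec, newReg, ev, hl k hk],
      fun k hk => by simp [exec, newReg, ev, hh k hk], by simp [exec, ev, usedCoins, hf], ?_⟩
    simp only [exec, ev, emits, Cfg.words, hl i hok.1, hl j hok.2.1, List.map_append, hw,
      List.map_cons, List.map_nil, List.append_cancel_left_eq, List.cons.injEq, and_true]
    refine List.map_congr_left fun a ha => hh a ?_
    simp only [List.mem_range'_1] at ha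
    omega

/-! ## Total correctness with bounds on the number of steps -/

/-- Running the command `C` from the state `σ` takes at most `n` steps, respects the bounds, and
leads to a state satisfying `Q`. -/
def WP (D T W : ℕ) (ω : Coins) (C : Cmd) (n : ℕ) (Q : St → Prop) (σ : St) : Prop :=
  ∀ (P : Program) (c : Cfg), CodeAt P c.pc (C.code c.pc) → Rep D c σ → Good T W c →
    ∃ k, k ≤ n ∧ (∀ i, i ≤ k → Good T W ((step P ω)^[i] c)) ∧
      ((step P ω)^[k] c).pc = c.pc + C.len ∧
      ∃ σ', Rep D ((step P ω)^[k] c) σ' ∧ Q σ'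

theorem step_eq {P : Program} {ω : Coins} {c : Cfg} {I : Instr} (h : P[c.pc]? = some I) :
    step P ω c = I.exec ω c := by
  simp [step, h]

/-- Consecutive executions compose. -/
theorem good_iterate_add {T W : ℕ} {f : Cfg → Cfg} {c : Cfg} {k l : ℕ}
    (h : ∀ i, i ≤ k → Good T W (f^[i] c)) (h' : ∀ i, i ≤ l → Good T W (f^[i] (f^[k] c))) :
    ∀ i, i ≤ l + k → Good T W (f^[i] c) := by
  intro i hi
  by_cases hik : i ≤ k
  · exact h i hik
  · have := h' (i - k) (by omega)
    rwa [← Function.iterate_add_apply, Nat.sub_add_cancel (by omega)] at this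

/-! ### Proof rules for the structured language. -/

section Rules

variable {D T W : ℕ} {ω : Coins}

theorem WP.mono {C : Cmd} {n n' : ℕ} {Q Q' : St → Prop} {σ : St} (h : WP D T W ω C n Q σ)
    (hn : n ≤ n') (hQ : ∀ σ', Q σ' → Q' σ') : WP D T W ω C n' Q' σ := by
  intro P c h1 h2 h3
  obtain ⟨k, hk, hg, hp, σ', hr, hq⟩ := h P c h1 h2 h3
  exact ⟨k, hk.trans hn, hg, hp, σ', hr, hQ _ hq⟩

theorem WP.le {C : Cmd} {n n' : ℕ} {Q : St → Prop} {σ : St} (h : WP D T W ω C n Q σ)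
    (hn : n ≤ n') : WP D T W ω C n' Q σ :=
  h.mono hn fun _ => id

theorem WP.post {C : Cmd} {n : ℕ} {Q Q' : St → Prop} {σ : St} (h : WP D T W ω C n Q σ)
    (hQ : ∀ σ', Q σ' → Q' σ') : WP D T W ω C n Q' σ :=
  h.mono le_rfl hQ

theorem WP.seq {C C' : Cmd} {n n' : ℕ} {R Q : St → Prop} {σ : St} (h : WP D T W ω C n R σ)
    (h' : ∀ σ', R σ' → WP D T W ω C' n' Q σ') : WP D T W ω (C ;; C') (n + n') Q σ := by
  intro P c h1 h2 h3
  simp only [Cmd.code, codeAt_append, Cmd.length_code] at h1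
  obtain ⟨k, hk, hg, hp, σ', hr, hq⟩ := h P c h1.1 h2 h3
  obtain ⟨l, hl, hg', hp', σ'', hr', hq'⟩ := h' σ' hq P _ (hp ▸ h1.2) hr (hg k le_rfl)
  refine ⟨l + k, by omega, good_iterate_add hg hg', ?_, σ'', ?_, hq'⟩
  · rw [Function.iterate_add_apply, hp', hp, Cmd.len]; omega
  · rwa [Function.iterate_add_apply]

/-- Prepending one step that changes only the program counter. -/
theorem exec_jump_rep {c : Cfg} {σ : St} {I : Instr} (hD : D ≤ T)
    (hI : (∃ l, I = .jump l) ∨ ∃ i j l, i < D ∧ j < D ∧ I = .jumpLT i j l)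
    (h : Rep D c σ) (hg : Good T W c) : Rep D (I.exec ω c) σ ∧ Good T W (I.exec ω c) := by
  rcases hI with ⟨l, rfl⟩ | ⟨i, j, l, hi, hj, rfl⟩
  · refine ⟨⟨h.low, h.high, by simp [Instr.exec, Instr.usedCoins, h.fl], ?_⟩, ⟨?_, hg.reg⟩⟩
    · simpa [Instr.exec, Instr.emits, Cfg.words] using h.out
    · simpa [Instr.exec, Instr.accessed] using hg.top
  · refine ⟨⟨h.low, h.high, by simp [Instr.exec, Instr.usedCoins, h.fl], ?_⟩, ⟨?_, hg.reg⟩⟩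
    · simpa [Instr.exec, Instr.emits, Cfg.words] using h.out
    · refine foldr_max_le hg.top fun a ha => ?_
      simp [Instr.accessed] at ha
      omega

theorem good_le_one {f : Cfg → Cfg} {c : Cfg} (h : Good T W c) (h' : Good T W (f c)) :
    ∀ i, i ≤ 1 → Good T W (f^[i] c) := by
  intro i hi
  interval_cases i
  exacts [h, h']

/-- The two extra steps are the conditional jump and, after the `else` branch, which is placed
first, the jump over the other branch. -/
theorem WP.ite {C C' : Cmd} {n i j : ℕ} {Q : St → Prop} {σ : St} (hD : D ≤ T)
    (hi : i < D) (hj : j < D)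
    (h : σ.v i < σ.v j → WP D T W ω C n Q σ) (h' : σ.v j ≤ σ.v i → WP D T W ω C' n Q σ) :
    WP D T W ω (.ite i j C C') (n + 2) Q σ := by
  intro P c h1 h2 h3
  simp only [Cmd.code, codeAt_cons, codeAt_append, Cmd.length_code] at h1
  obtain ⟨a1, a2, a3, a4⟩ := h1
  have e1 := step_eq (ω := ω) a1
  obtain ⟨r1, g1⟩ := exec_jump_rep (ω := ω) hD (.inr ⟨i, j, _, hi, hj, rfl⟩) h2 h3
  rw [← e1] at r1 g1
  by_cases hc : σ.v i < σ.v j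
  · have hp1 : (step P ω c).pc = c.pc + C'.len + 2 := by
      rw [e1]; simp [Instr.exec, Instr.newPC, h2.low i hi, h2.low j hj, hc]
    obtain ⟨k, hk, hg, hp, σ', hr, hq⟩ := h hc P (step P ω c)
      (by rw [hp1]; convert a4 using 1; omega) r1 g1
    refine ⟨k + 1, by omega, good_iterate_add (good_le_one h3 g1) hg, ?_, σ', hr, hq⟩
    rw [Function.iterate_add_apply, Function.iterate_one, hp, hp1, Cmd.len]; omega
  · have hp1 : (step P ω c).pc = c.pc + 1 := by
      rw [e1]; simp [Instr.exec, Instr.newPC, h2.low i hi, h2.low j hj, hc]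
    obtain ⟨k, hk, hg, hp, σ', hr, hq⟩ := h' (by omega) P (step P ω c) (by rwa [hp1]) r1 g1
    have hgk := good_iterate_add (good_le_one h3 g1) hg
    have hpk : ((step P ω)^[k + 1] c).pc = c.pc + 1 + C'.len := by
      rw [Function.iterate_add_apply, Function.iterate_one, hp, hp1]
    have e2 := step_eq (ω := ω) (hpk ▸ a3)
    obtain ⟨r2, g2⟩ := exec_jump_rep (ω := ω) hD (.inl ⟨_, rfl⟩) hr (hg k le_rfl)
    rw [← Function.iterate_succ_apply, ← e2] at r2 g2
    refine ⟨1 + (k + 1), by omega, good_iterate_add hgk (good_le_one (hgk _ le_rfl) g2), ?_, σ', ?_, hq⟩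
    · rw [Function.iterate_add_apply, Function.iterate_one, e2]
      simp [Instr.exec, Instr.newPC, Cmd.len]; omega
    · rwa [Function.iterate_add_apply, Function.iterate_one]

theorem WP.loop_done {C : Cmd} {i j : ℕ} {Q : St → Prop} {σ : St} (hD : D ≤ T)
    (hi : i < D) (hj : j < D) (h : σ.v j ≤ σ.v i) (hQ : Q σ) :
    WP D T W ω (.loop i j C) 2 Q σ := by
  intro P c h1 h2 h3
  simp only [Cmd.code, codeAt_cons] at h1
  obtain ⟨a1, a2, -⟩ := h1
  have e1 := step_eq (ω := ω) a1
  obtain ⟨r1, g1⟩ := exec_jump_rep (ω := ω) hD (.inr ⟨i, j, _, hi, hj, rfl⟩) h2 h3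
  rw [← e1] at r1 g1
  have hp1 : (step P ω c).pc = c.pc + 1 := by
    rw [e1]; simp [Instr.exec, Instr.newPC, h2.low i hi, h2.low j hj, h]
  have e2 := step_eq (ω := ω) (hp1 ▸ a2)
  obtain ⟨r2, g2⟩ := exec_jump_rep (ω := ω) hD (.inl ⟨_, rfl⟩) r1 g1
  rw [← e2] at r2 g2
  refine ⟨1 + 1, by omega, good_iterate_add (good_le_one h3 g1) (good_le_one g1 g2), ?_, σ, r2, hQ⟩
  rw [Function.iterate_add_apply, Function.iterate_one, e2]
  simp [Instr.exec, Instr.newPC, Cmd.len]; omega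

/-- One round, from the loop test back to the loop test. It is stated outside `WP` because the main
loop need not terminate; `1 ≤ k` ensures that each round advances the run. -/
theorem WP.loop_enter {C : Cmd} {n i j : ℕ} {Q : St → Prop} {σ : St} (hD : D ≤ T)
    (hi : i < D) (hj : j < D) (h : σ.v i < σ.v j) (hC : WP D T W ω C n Q σ)
    {P : Program} {c : Cfg} (h1 : CodeAt P c.pc ((Cmd.loop i j C).code c.pc)) (h2 : Rep D c σ)
    (h3 : Good T W c) :
    ∃ k, 1 ≤ k ∧ k ≤ n + 2 ∧ (∀ i, i ≤ k → Good T W ((step P ω)^[i] c)) ∧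
      ((step P ω)^[k] c).pc = c.pc ∧ ∃ σ', Rep D ((step P ω)^[k] c) σ' ∧ Q σ' := by
  simp only [Cmd.code, codeAt_cons, codeAt_append, Cmd.length_code] at h1
  obtain ⟨a1, a2, a3, a4, -⟩ := h1
  have e1 := step_eq (ω := ω) a1
  obtain ⟨r1, g1⟩ := exec_jump_rep (ω := ω) hD (.inr ⟨i, j, _, hi, hj, rfl⟩) h2 h3
  rw [← e1] at r1 g1
  have hp1 : (step P ω c).pc = c.pc + 2 := by
    rw [e1]; simp [Instr.exec, Instr.newPC, h2.low i hi, h2.low j hj, h]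
  obtain ⟨k, hk, hg, hp, σ', hr, hq⟩ := hC P (step P ω c) (by rwa [hp1]) r1 g1
  have hgk := good_iterate_add (good_le_one h3 g1) hg
  have hpk : ((step P ω)^[k + 1] c).pc = c.pc + 1 + 1 + C.len := by
    rw [Function.iterate_add_apply, Function.iterate_one, hp, hp1]
  have e2 := step_eq (ω := ω) (hpk ▸ a4)
  obtain ⟨r2, g2⟩ := exec_jump_rep (ω := ω) hD (.inl ⟨_, rfl⟩) hr (hg k le_rfl)
  rw [← Function.iterate_succ_apply, ← e2] at r2 g2
  refine ⟨1 + (k + 1), by omega, by omega,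
    good_iterate_add hgk (good_le_one (hgk _ le_rfl) g2), ?_, σ', ?_, hq⟩
  · rw [Function.iterate_add_apply, Function.iterate_one, e2]
    simp [Instr.exec, Instr.newPC]
  · rwa [Function.iterate_add_apply, Function.iterate_one]

theorem WP.loop_step {C : Cmd} {n n' i j : ℕ} {R Q : St → Prop} {σ : St} (hD : D ≤ T)
    (hi : i < D) (hj : j < D) (h : σ.v i < σ.v j) (hC : WP D T W ω C n R σ)
    (h' : ∀ σ', R σ' → WP D T W ω (.loop i j C) n' Q σ') :
    WP D T W ω (.loop i j C) (n' + (n + 2)) Q σ := by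
  intro P c h1 h2 h3
  obtain ⟨k, -, hk, hg, hp, σ', hr, hq⟩ := hC.loop_enter hD hi hj h h1 h2 h3
  obtain ⟨l, hl, hg', hp', σ'', hr', hq'⟩ := h' σ' hq P _ (hp.symm ▸ h1) hr (hg k le_rfl)
  refine ⟨l + k, by omega, good_iterate_add hg hg', ?_, σ'', ?_, hq'⟩
  · rw [Function.iterate_add_apply, hp', hp]
  · rwa [Function.iterate_add_apply]

/-- A loop with an invariant indexed by the number of iterations done. -/
theorem WP.loop_count {C : Cmd} {n i j : ℕ} {Q : St → Prop} {σ : St} (hD : D ≤ T)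
    (hi : i < D) (hj : j < D) (N : ℕ) (Inv : ℕ → St → Prop)
    (hstep : ∀ k, k < N → ∀ τ, Inv k τ → τ.v i < τ.v j ∧ WP D T W ω C n (Inv (k + 1)) τ)
    (hend : ∀ τ, Inv N τ → τ.v j ≤ τ.v i ∧ Q τ) (h0 : Inv 0 σ) :
    WP D T W ω (.loop i j C) (N * (n + 2) + 2) Q σ := by
  have key : ∀ d k, k + d = N → ∀ τ, Inv k τ →
      WP D T W ω (.loop i j C) (d * (n + 2) + 2) Q τ := by
    intro d
    induction d with
    | zero =>
      intro k hk τ hτ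
      obtain rfl : k = N := by omega
      obtain ⟨h1, h2⟩ := hend τ hτ
      exact (WP.loop_done hD hi hj h1 h2).le (by omega)
    | succ d ih =>
      intro k hk τ hτ
      obtain ⟨h1, h2⟩ := hstep k (by omega) τ hτ
      refine (WP.loop_step hD hi hj h1 h2 fun σ' h' => ih (k + 1) (by omega) σ' h').le ?_
      ring_nf; omega
  exact key N 0 (by omega) σ h0

/-- The instructions of a block can be executed one after the other within the bounds. -/
def okAll (D T W : ℕ) (ω : Coins) : List Instr → St → Prop
  | [], _ => True
  | I :: l, σ => I.ok D T W σ ∧ okAll D T W ω l (I.ev ω σ)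

/-- The effect of a block. -/
def evAll (ω : Coins) : List Instr → St → St
  | [], σ => σ
  | I :: l, σ => evAll ω l (I.ev ω σ)

theorem WP.blk (hD : D ≤ T) (hW : 2 ≤ W) {l : List Instr} {Q : St → Prop} {σ : St}
    (h : okAll D T W ω l σ) (hQ : Q (evAll ω l σ)) : WP D T W ω (.blk l) l.length Q σ := by
  intro P c h1 h2 h3
  simp only [Cmd.code] at h1
  induction l generalizing c σ with
  | nil =>
    refine ⟨0, le_rfl, fun i hi => ?_, rfl, σ, h2, hQ⟩
    obtain rfl : i = 0 := by omega
    exact h3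
  | cons I l ih =>
    rw [codeAt_cons] at h1
    have e := step_eq (ω := ω) h1.1
    obtain ⟨r, hp⟩ := Instr.exec_rep (ω := ω) h2 h.1
    have g := Instr.exec_good (ω := ω) hD hW h2 h3 h.1
    rw [← e] at r hp g
    obtain ⟨k, hk, hg, hp', σ', hr, hq⟩ := ih h.2 hQ (step P ω c) (hp ▸ h1.2) r g
    refine ⟨k + 1, by simp; omega, good_iterate_add (good_le_one h3 g) hg, ?_, σ', hr, hq⟩
    rw [Function.iterate_add_apply, Function.iterate_one, hp', hp]
    simp [Cmd.len]; omega

theorem WP.blk_seq (hD : D ≤ T) (hW : 2 ≤ W) {l : List Instr} {C : Cmd} {n : ℕ} {Q : St → Prop}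
    {σ : St} (h : okAll D T W ω l σ) (hQ : WP D T W ω C n Q (evAll ω l σ)) :
    WP D T W ω (.blk l ;; C) (l.length + n) Q σ :=
  WP.seq (R := fun τ => τ = evAll ω l σ) (WP.blk hD hW h rfl) (by rintro _ rfl; exact hQ)

theorem WP.skip (hD : D ≤ T) (hW : 2 ≤ W) {n : ℕ} {Q : St → Prop} {σ : St} (h : Q σ) :
    WP D T W ω (.blk []) n Q σ :=
  (WP.blk (l := []) hD hW trivial h).le (by simp)

end Rules

/-! ## Associative memory in a log

The memory of a simulated program is kept as a list of pairs (address, value), the last pair with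
a given address being the relevant one.

Use of the low registers: 0 length of the instance, 1 zero, 2 one, 3 start of the instance,
4 the polynomial bound, 5 start of the candidate word, 6 and 7 start and end of the log,
8 simulated program counter, 9 coins used by the simulated program, 10 value looked up or to be
written, 11 simulated address, 14 length of the candidate, 15 status of the output of the
generator, 16 code of the candidate, 17 code of the reference solution (0 if there is none),
18 remaining budget, 19 length of the simulated program, 26 verdict; the others are temporary. -/

/-- The value at the address `a` in a log. -/
def lookupVal (l : List (ℕ × ℕ)) (a : ℕ) : ℕ :=
  l.foldl (fun r p => if p.1 = a then p.2 else r) 0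

theorem lookupVal_append (l l' : List (ℕ × ℕ)) (a : ℕ) :
    lookupVal (l ++ l') a = l'.foldl (fun r p => if p.1 = a then p.2 else r) (lookupVal l a) := by
  simp [lookupVal]

/-- The left fold lets later pairs override earlier ones, so a register write is a mere append. -/
theorem lookupVal_concat (l : List (ℕ × ℕ)) (b x : ℕ) :
    lookupVal (l ++ [(b, x)]) = Function.update (lookupVal l) b x := by
  funext a
  rw [lookupVal_append, Function.update_apply]
  simp [eq_comm]

/-- The state holds the log `l`. -/
structure HasLog (T : ℕ) (σ : St) (l : List (ℕ × ℕ)) : Prop where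
  one : σ.v 2 = 1
  base : 40 ≤ σ.v 6
  fin : σ.v 7 = σ.v 6 + 2 * l.length
  top : σ.v 7 ≤ T
  fst : ∀ i (h : i < l.length), σ.m (σ.v 6 + 2 * i) = l[i].1
  snd : ∀ i (h : i < l.length), σ.m (σ.v 6 + 2 * i + 1) = l[i].2

theorem HasLog.congr {T : ℕ} {σ σ' : St} {l : List (ℕ × ℕ)} (h : HasLog T σ l)
    (h2 : σ'.v 2 = σ.v 2) (h6 : σ'.v 6 = σ.v 6) (h7 : σ'.v 7 = σ.v 7)
    (hm : ∀ a, σ.v 6 ≤ a → σ'.m a = σ.m a) : HasLog T σ' l := by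
  refine ⟨h2 ▸ h.one, h6 ▸ h.base, by rw [h6, h7, h.fin], h7 ▸ h.top, fun i hi => ?_,
    fun i hi => ?_⟩
  · rw [h6, hm _ (by omega), h.fst]
  · rw [h6, hm _ (by omega), h.snd]

/-- Only the low registers in `S` may differ. -/
structure Keeps (S : List ℕ) (σ σ' : St) : Prop where
  v : ∀ i, i ∉ S → σ'.v i = σ.v i
  m : σ'.m = σ.m
  fl : σ'.fl = σ.fl
  out : σ'.out = σ.out

/-- `R 10 :=` the value at the simulated address `R 11`. -/
def lookupCmd : Cmd :=
  .blk [.const 10 0, .copy 12 6] ;;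
  .loop 12 7 (.blk [.load 13 12, .add 12 12 2] ;;
    .ite 13 11 (.blk []) (.ite 11 13 (.blk []) (.blk [.load 10 12])) ;;
    .blk [.add 12 12 2])

/-- Write the value `R 10` at the simulated address `R 11`. -/
def appendCmd : Cmd :=
  .blk [.store 7 11, .add 7 7 2, .store 7 10, .add 7 7 2]

/-- General bounds on the numbers of registers and their contents. -/
structure Bds (T W : ℕ) : Prop where
  low : 40 ≤ T
  lt : T < W

section

variable {T W : ℕ} {ω : Coins}

theorem Bds.two (b : Bds T W) : 2 ≤ W := by have := b.low; have := b.lt; omega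

/-- The whole log is scanned and `R 10` keeps the last match in the part already read; equality of
addresses is tested by two strict comparisons. Each pair costs at most 10 steps and there are at
most `T` pairs. -/
theorem lookup_spec (b : Bds T W) {σ : St} {l : List (ℕ × ℕ)} (hl : HasLog T σ l) :
    WP 40 T W ω lookupCmd (10 * T + 4)
      (fun σ' => Keeps [10, 12, 13] σ σ' ∧ σ'.v 10 = lookupVal l (σ.v 11)) σ := by
  have hb := b.low
  have hW := b.lt
  have h1 := hl.one
  have h2 := hl.base
  have h3 := hl.fin
  have h4 := hl.top
  have hN : l.length * 10 ≤ 10 * T := by omega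
  refine WP.le (WP.blk_seq hb b.two (by simp [okAll, Instr.ok]; omega)
    (WP.loop_count (n := 8) hb (by norm_num) (by norm_num) l.length
      (fun k τ => Keeps [10, 12, 13] σ τ ∧ τ.v 12 = σ.v 6 + 2 * k ∧
        τ.v 10 = lookupVal (l.take k) (σ.v 11)) ?_ ?_ ?_)) ?_
  · rintro k hk τ ⟨kp, e12, e10⟩
    have k7 := kp.v 7 (by simp)
    have k2 := kp.v 2 (by simp)
    have k11 := kp.v 11 (by simp)
    refine ⟨by omega, ?_⟩
    have hlook : lookupVal (l.take (k + 1)) (σ.v 11) =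
        if l[k].1 = σ.v 11 then l[k].2 else lookupVal (l.take k) (σ.v 11) := by
      rw [List.take_add_one, lookupVal_append]
      simp [hk]
    refine (WP.blk_seq (n := 6) hb b.two ?_ ?_).le (by simp)
    · simp [okAll, Instr.ok, Instr.ev]; omega
    have base : Keeps [10, 12, 13] σ (evAll ω [.load 13 12, .add 12 12 2] τ) := by
      refine ⟨fun i hi => ?_, kp.m, kp.fl, kp.out⟩
      have := kp.v i hi
      simp at hi
      simp [evAll, Instr.ev, hi, this]
    have e13 : (evAll ω [.load 13 12, .add 12 12 2] τ).v 13 = l[k].1 := by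
      simp [evAll, Instr.ev, e12, kp.m, hl.fst k hk]
    have e12' : (evAll ω [.load 13 12, .add 12 12 2] τ).v 12 = σ.v 6 + 2 * k + 1 := by
      simp [evAll, Instr.ev, e12, k2, h1]
    have e10' : (evAll ω [.load 13 12, .add 12 12 2] τ).v 10 =
        lookupVal (l.take k) (σ.v 11) := by
      simp [evAll, Instr.ev, e10]
    generalize evAll ω [.load 13 12, .add 12 12 2] τ = τ₁ at base e13 e12' e10'
    have k11 := base.v 11 (by simp)
    refine WP.seq (n := 5) (n' := 1) (R := fun τ' => Keeps [10, 12, 13] σ τ' ∧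
      τ'.v 12 = σ.v 6 + 2 * k + 1 ∧ τ'.v 10 = lookupVal (l.take (k + 1)) (σ.v 11)) ?_ ?_
    · refine WP.ite (n := 3) hb (by norm_num) (by norm_num) (fun hlt => ?_) (fun hle => ?_)
      · exact WP.skip hb b.two ⟨base, e12', by rw [hlook, if_neg (by omega), e10']⟩
      refine WP.ite (n := 1) hb (by norm_num) (by norm_num) (fun hlt => ?_) (fun hle' => ?_)
      · exact WP.skip hb b.two ⟨base, e12', by rw [hlook, if_neg (by omega), e10']⟩
      · refine WP.blk hb b.two (by simp [okAll, Instr.ok]; omega) ?_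
        refine ⟨⟨fun i hi => ?_, base.m, base.fl, base.out⟩, by simpa [evAll, Instr.ev], ?_⟩
        · have := base.v i hi
          simp only [List.mem_cons, List.not_mem_nil, or_false, not_or] at hi
          simpa [evAll, Instr.ev, hi] using this
        · rw [hlook, if_pos (by omega)]
          simp [evAll, Instr.ev, base.m, hl.snd k hk, e12']
    · rintro τ' ⟨kp', e12', e10'⟩
      have k2' := kp'.v 2 (by simp)
      refine WP.blk hb b.two (by simp [okAll, Instr.ok]; omega) ?_
      refine ⟨⟨fun i hi => ?_, kp'.m, kp'.fl, kp'.out⟩, ?_, ?_⟩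
      · have := kp'.v i hi
        simp at hi
        simpa [evAll, Instr.ev, hi] using this
      · simp [evAll, Instr.ev, e12', k2', h1]; omega
      · simpa [evAll, Instr.ev] using e10'
  · rintro τ ⟨kp, e12, e10⟩
    have k7 := kp.v 7 (by simp)
    refine ⟨by omega, kp, by simpa using e10⟩
  · refine ⟨⟨fun i hi => ?_, rfl, rfl, rfl⟩, by simp [evAll, Instr.ev],
      by simp [evAll, Instr.ev, lookupVal]⟩
    simp at hi
    simp [evAll, Instr.ev, hi]
  · simp; omega

theorem append_spec (b : Bds T W) {σ : St} {l : List (ℕ × ℕ)} (hl : HasLog T σ l)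
    (hcap : σ.v 6 + 2 * (l.length + 1) ≤ T) :
    WP 40 T W ω appendCmd 4
      (fun σ' => HasLog T σ' (l ++ [(σ.v 11, σ.v 10)]) ∧ (∀ i, i ≠ 7 → σ'.v i = σ.v i) ∧
        (∀ a, a < σ.v 6 → σ'.m a = σ.m a) ∧ σ'.fl = σ.fl ∧ σ'.out = σ.out) σ := by
  have hb := b.low
  have hW := b.lt
  have h1 := hl.one
  have h2 := hl.base
  have h3 := hl.fin
  have h4 := hl.top
  refine WP.blk hb b.two (by simp [okAll, Instr.ok, Instr.ev]; omega) ?_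
  refine ⟨⟨?_, ?_, ?_, ?_, ?_, ?_⟩, ?_, ?_, ?_, ?_⟩
  · simpa [evAll, Instr.ev] using h1
  · simpa [evAll, Instr.ev] using h2
  · simp [evAll, Instr.ev, h1, h3]; omega
  · simp [evAll, Instr.ev, h1, h3]; omega
  · intro i hi
    simp [evAll, Instr.ev, h1, h3] at hi ⊢
    rw [Function.update_of_ne (by omega)]
    by_cases h : i < l.length
    · rw [Function.update_of_ne (by omega), hl.fst i h, List.getElem_append_left h]
    · obtain rfl : i = l.length := by omega
      simp
  · intro i hi
    simp [evAll, Instr.ev, h1, h3] at hi ⊢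
    by_cases h : i < l.length
    · rw [Function.update_of_ne (by omega), Function.update_of_ne (by omega), hl.snd i h,
        List.getElem_append_left h]
    · obtain rfl : i = l.length := by omega
      simp
  · intro i hi
    simp [evAll, Instr.ev, hi]
  · intro a ha
    simp [evAll, Instr.ev, h1]
    rw [Function.update_of_ne (by omega), Function.update_of_ne (by omega)]
  · rfl
  · rfl

end

/-! ## Simulation of a program on a log -/

/-- Look up the value at the fixed simulated address `j`. -/
def lookAt (j : ℕ) : Cmd := .blk [.const 11 j] ;; lookupCmd

/-- Increment the simulated program counter. -/
def bump : Cmd := .blk [.add 8 8 2]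

/-- The simulation of one instruction. -/
def simInstr (onOut : ℕ → ℕ → Cmd) : Instr → Cmd
  | .const i c => .blk [.const 10 c, .const 11 i] ;; appendCmd ;; bump
  | .copy i j => lookAt j ;; .blk [.const 11 i] ;; appendCmd ;; bump
  | .add i j k => lookAt j ;; .blk [.copy 20 10] ;; lookAt k ;;
      .blk [.add 10 20 10, .const 11 i] ;; appendCmd ;; bump
  | .sub i j k => lookAt j ;; .blk [.copy 20 10] ;; lookAt k ;;
      .blk [.sub 10 20 10, .const 11 i] ;; appendCmd ;; bump
  | .mul i j k => lookAt j ;; .blk [.copy 20 10] ;; lookAt k ;;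
      .blk [.mul 10 20 10, .const 11 i] ;; appendCmd ;; bump
  | .load i j => lookAt j ;; .blk [.copy 11 10] ;; lookupCmd ;; .blk [.const 11 i] ;;
      appendCmd ;; bump
  | .store i j => lookAt i ;; .blk [.copy 20 10] ;; lookAt j ;; .blk [.copy 11 20] ;;
      appendCmd ;; bump
  | .jump l => .blk [.const 8 l]
  | .jumpLT i j l => lookAt i ;; .blk [.copy 20 10] ;; lookAt j ;;
      .ite 20 10 (.blk [.const 8 l]) bump
  | .flip i => .blk [.flip 10, .add 9 9 2, .const 11 i] ;; appendCmd ;; bump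
  | .output i j => onOut i j ;; bump

/-- The constants in an instruction. -/
def Instr.consts : Instr → List ℕ
  | .const i c => [i, c]
  | .copy i j => [i, j]
  | .add i j k => [i, j, k]
  | .sub i j k => [i, j, k]
  | .mul i j k => [i, j, k]
  | .load i j => [i, j]
  | .store i j => [i, j]
  | .jump l => [l]
  | .jumpLT i j l => [i, j, l]
  | .flip i => [i]
  | .output i j => [i, j]

theorem Keeps.trans {S : List ℕ} {σ σ' σ'' : St} (h : Keeps S σ σ') (h' : Keeps S σ' σ'') :
    Keeps S σ σ'' :=
  ⟨fun i hi => (h'.v i hi).trans (h.v i hi), h'.m.trans h.m, h'.fl.trans h.fl,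
    h'.out.trans h.out⟩

theorem Keeps.subset {S S' : List ℕ} {σ σ' : St} (h : Keeps S σ σ') (hS : S ⊆ S') :
    Keeps S' σ σ' :=
  ⟨fun i hi => h.v i fun h' => hi (hS h'), h.m, h.fl, h.out⟩

theorem HasLog.keeps {T : ℕ} {S : List ℕ} {σ σ' : St} {l : List (ℕ × ℕ)} (h : HasLog T σ l)
    (k : Keeps S σ σ') (h2 : 2 ∉ S) (h6 : 6 ∉ S) (h7 : 7 ∉ S) : HasLog T σ' l :=
  h.congr (k.v 2 h2) (k.v 6 h6) (k.v 7 h7) fun a _ => by rw [k.m]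

/-- The property `J` (of the words output by the simulated program, and of a state) does not
depend on the registers used by the simulation. -/
def SimStable (J : List (List ℕ) → St → Prop) : Prop :=
  ∀ ws σ σ', J ws σ → (∀ i, i ∉ [7, 8, 9, 10, 11, 12, 13, 20] → σ'.v i = σ.v i) →
    (∀ a, a < σ.v 6 → σ'.m a = σ.m a) → σ'.out = σ.out → J ws σ'

/-- The state `σ` represents the configuration `c` of the simulated program after `t` steps;
`Lb` is the start of the log, `L₀` its initial length, `f₀` the number of coins flipped before
the simulation. -/
structure Sim (T Lb L₀ f₀ : ℕ) (J : List (List ℕ) → St → Prop) (c : Cfg) (t : ℕ) (σ : St) :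
    Prop where
  log : ∃ l, HasLog T σ l ∧ l.length ≤ L₀ + t ∧ lookupVal l = c.reg
  base : σ.v 6 = Lb
  pc : σ.v 8 = c.pc
  fl : σ.fl = f₀ + c.flips
  coins : σ.v 9 = c.flips
  inv : J c.words σ

section

variable {T W : ℕ} {ω : Coins}

/-- Register 20 is listed among those that may change only to share one list with `lookAt_two`. Its
preservation is recorded separately, because it holds the first operand during the second lookup. -/
theorem lookAt_spec (b : Bds T W) {σ : St} {l : List (ℕ × ℕ)} (hl : HasLog T σ l) {j : ℕ}
    (hj : j < W) {C : Cmd} {n : ℕ} {Q : St → Prop}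
    (h : ∀ τ, Keeps [10, 11, 12, 13, 20] σ τ → τ.v 20 = σ.v 20 → τ.v 10 = lookupVal l j →
      WP 40 T W ω C n Q τ) : WP 40 T W ω (lookAt j ;; C) (10 * T + 5 + n) Q σ := by
  refine (WP.seq (WP.blk_seq (ω := ω) b.low b.two (by simp [okAll, Instr.ok, hj])
    (lookup_spec (ω := ω) b (l := l) ?_)) (fun τ hτ => h τ ?_ ?_ ?_)).le (by simp; omega)
  · exact hl.congr (by simp [evAll, Instr.ev]) (by simp [evAll, Instr.ev])
      (by simp [evAll, Instr.ev]) (by simp [evAll, Instr.ev])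
  · refine ⟨fun i hi => ?_, hτ.1.m, hτ.1.fl, hτ.1.out⟩
    simp at hi
    rw [hτ.1.v i (by simp [hi])]
    simp [evAll, Instr.ev, hi]
  · rw [hτ.1.v 20 (by simp)]
    simp [evAll, Instr.ev]
  · rw [hτ.2]
    simp [evAll, Instr.ev]

theorem lookAt_two (b : Bds T W) {σ : St} {l : List (ℕ × ℕ)} (hl : HasLog T σ l) {j k : ℕ}
    (hj : j < W) (hk : k < W) {C : Cmd} {n : ℕ} {Q : St → Prop}
    (h : ∀ τ, Keeps [10, 11, 12, 13, 20] σ τ → τ.v 20 = lookupVal l j → τ.v 10 = lookupVal l k →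
      WP 40 T W ω C n Q τ) :
    WP 40 T W ω (lookAt j ;; .blk [.copy 20 10] ;; lookAt k ;; C) (20 * T + 11 + n) Q σ := by
  refine (lookAt_spec b hl hj fun τ k1 _ e10 => WP.blk_seq b.low b.two (by simp [okAll, Instr.ok])
    (lookAt_spec b (l := l) (n := n) ?_ hk fun τ' k2 e20' e10' => h τ' ?_ ?_ e10')).le
    (by simp; omega)
  · exact (hl.keeps k1 (by simp) (by simp) (by simp)).congr (by simp [evAll, Instr.ev])
      (by simp [evAll, Instr.ev]) (by simp [evAll, Instr.ev]) (by simp [evAll, Instr.ev])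
  · refine k1.trans (Keeps.trans ⟨fun i hi => ?_, by rfl, by rfl, by rfl⟩ k2)
    simp at hi
    simp [evAll, Instr.ev, hi]
  · rw [e20']
    simp [evAll, Instr.ev, e10]

variable {Lb L₀ f₀ : ℕ} {J : List (List ℕ) → St → Prop}

/-- Common end of the simulation of all instructions that write one register: the appended pair is
the update, and the old log grows by exactly one. -/
theorem append_bump (b : Bds T W) (hJ : SimStable J) {c c' : Cfg} {t : ℕ} {τ : St}
    {l : List (ℕ × ℕ)} (hl : HasLog T τ l) (hlen : l.length ≤ L₀ + t)
    (hcap : Lb + 2 * (L₀ + t + 1) ≤ T) (hb : τ.v 6 = Lb) (hpc : τ.v 8 = c.pc)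
    (hpcW : c.pc + 1 < W)
    (hf : τ.fl = f₀ + c'.flips) (hf' : τ.v 9 = c'.flips) (hinv : J c'.words τ)
    (hreg : c'.reg = Function.update (lookupVal l) (τ.v 11) (τ.v 10))
    (hpc' : c'.pc = c.pc + 1) :
    WP 40 T W ω (appendCmd ;; bump) 5 (Sim T Lb L₀ f₀ J c' (t + 1)) τ := by
  have h1 := hl.one
  refine (WP.seq (append_spec b hl (by omega)) fun τ' h => WP.blk b.low b.two ?_ ?_).le
    (le_refl (4 + 1))
  · simp [okAll, Instr.ok, h.2.1, hpc, h1]; omega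
  obtain ⟨hl', hv, hm, hfl, hout⟩ := h
  refine ⟨⟨_, hl'.congr ?_ ?_ ?_ ?_, by simp; omega, ?_⟩, ?_, ?_, ?_, ?_, ?_⟩
  · simp [evAll, Instr.ev]
  · simp [evAll, Instr.ev]
  · simp [evAll, Instr.ev]
  · simp [evAll, Instr.ev]
  · rw [lookupVal_concat, hreg]
  · simp [evAll, Instr.ev, hv, hb]
  · simp [evAll, Instr.ev, hv, hpc, hpc', h1]
  · simp [evAll, Instr.ev, hfl, hf]
  · simp [evAll, Instr.ev, hv, hf']
  · refine hJ _ τ _ hinv (fun i hi => ?_) hm hout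
    simp at hi
    simp [evAll, Instr.ev, hi, hv]

theorem append_bump_of_keeps (b : Bds T W) (hJ : SimStable J) {c c' : Cfg} {t : ℕ} {σ τ : St}
    (hs : Sim T Lb L₀ f₀ J c t σ) (hk : Keeps [10, 11, 12, 13, 20] σ τ)
    (hcap : Lb + 2 * (L₀ + t + 1) ≤ T) (hpcW : c.pc + 1 < W)
    (hf : c'.flips = c.flips) (hw : c'.words = c.words)
    (hreg : c'.reg = Function.update c.reg (τ.v 11) (τ.v 10))
    (hpc' : c'.pc = c.pc + 1) :
    WP 40 T W ω (appendCmd ;; bump) 5 (Sim T Lb L₀ f₀ J c' (t + 1)) τ := by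
  obtain ⟨l, hl, hlen, hlv⟩ := hs.log
  refine append_bump b hJ (hl.keeps hk (by simp) (by simp) (by simp)) hlen hcap ?_ ?_ hpcW ?_ ?_ ?_
    (hlv ▸ hreg) hpc'
  · rw [hk.v 6 (by simp), hs.base]
  · rw [hk.v 8 (by simp), hs.pc]
  · rw [hk.fl, hf, hs.fl]
  · rw [hk.v 9 (by simp), hf, hs.coins]
  · rw [hw]
    refine hJ _ σ _ hs.inv (fun i hi => hk.v i ?_) (fun a _ => by rw [hk.m]) hk.out
    simp at hi ⊢
    omega

/-- The word output by an instruction `output i j`. -/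
def outWord (r : ℕ → ℕ) (i j : ℕ) : List ℕ := (List.range' (r i) (r j + 1 - r i)).map r

/-- No overflow occurs in sums and products because `hr'` bounds the simulated registers after the
step. What is done with an output is left to `onOut`, so that the same interpreter serves the
generator, whose output is recorded, and the test, whose output is dropped. -/
theorem simInstr_spec (b : Bds T W) (hJ : SimStable J) {onOut : ℕ → ℕ → Cmd} {nOut B : ℕ}
    {I : Instr} (hcI : ∀ a ∈ I.consts, a < W)
    (hOut : ∀ i j, I = .output i j → ∀ σ l ws, HasLog T σ l → σ.v 6 = Lb → J ws σ →
      (∀ a, lookupVal l a < B) → WP 40 T W ω (onOut i j) nOut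
        (fun σ' => J (ws ++ [outWord (lookupVal l) i j]) σ' ∧ HasLog T σ' l ∧ σ'.v 6 = σ.v 6 ∧
          σ'.fl = σ.fl ∧ σ'.v 8 = σ.v 8 ∧ σ'.v 9 = σ.v 9) σ)
    (hBW : B ≤ W) {c : Cfg} {t : ℕ} {σ : St}
    (hs : Sim T Lb L₀ f₀ J c t σ) (hr : ∀ a, c.reg a < B)
    (hr' : ∀ a, (I.exec (fun k => ω (f₀ + k)) c).reg a < B)
    (hcap : Lb + 2 * (L₀ + t + 1) ≤ T) (hpcW : c.pc + 1 < W) (hfW : c.flips + 1 < W) :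
    WP 40 T W ω (simInstr onOut I) (20 * T + 30 + nOut)
      (Sim T Lb L₀ f₀ J (I.exec (fun k => ω (f₀ + k)) c) (t + 1)) σ := by
  obtain ⟨l, hl, hlen, hlv⟩ := hs.log
  have hb := b.low
  have h2 := b.two
  have hpc := hs.pc
  have h1 := hl.one
  cases I with
  | const i x =>
    simp only [Instr.consts, List.mem_cons, List.not_mem_nil, or_false, forall_eq_or_imp,
      forall_eq] at hcI
    refine (WP.blk_seq hb h2 (by simp [okAll, Instr.ok, hcI])
      (append_bump_of_keeps b hJ hs ⟨fun i hi => ?_, rfl, rfl, rfl⟩ hcap hpcW (by rfl) ?_ ?_ (by rfl))).le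
      (by simp; omega)
    · simp at hi; simp [evAll, Instr.ev, hi]
    · simp [Instr.exec, Instr.emits, Cfg.words]
    · simp [evAll, Instr.ev, Instr.exec, Instr.newReg]
  | copy i j =>
    simp only [Instr.consts, List.mem_cons, List.not_mem_nil, or_false, forall_eq_or_imp,
      forall_eq] at hcI
    refine (lookAt_spec b hl hcI.2 fun τ hk _ e10 => WP.blk_seq hb h2 (by simp [okAll, Instr.ok, hcI])
      (append_bump_of_keeps b hJ hs (hk.trans ⟨fun i hi => ?_, rfl, rfl, rfl⟩) hcap hpcW (by rfl)
        ?_ ?_ (by rfl))).le (by simp; omega)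
    · simp at hi; simp [evAll, Instr.ev, hi]
    · simp [Instr.exec, Instr.emits, Cfg.words]
    · simp [evAll, Instr.ev, Instr.exec, Instr.newReg, e10, hlv]
  | add i j k =>
    simp only [Instr.consts, List.mem_cons, List.not_mem_nil, or_false, forall_eq_or_imp,
      forall_eq] at hcI
    refine (lookAt_two b hl hcI.2.1 hcI.2.2 fun τ hk e20 e10 => WP.blk_seq hb h2 ?_
      (append_bump_of_keeps b hJ hs (hk.trans ⟨fun i hi => ?_, rfl, rfl, rfl⟩) hcap hpcW (by rfl)
        ?_ ?_ (by rfl))).le (by simp; omega)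
    · have := hr' i
      simp [Instr.exec, Instr.newReg] at this
      simp [okAll, Instr.ok, e20, e10, hlv, hcI]; omega
    · simp at hi; simp [evAll, Instr.ev, hi]
    · simp [Instr.exec, Instr.emits, Cfg.words]
    · simp [evAll, Instr.ev, Instr.exec, Instr.newReg, e10, e20, hlv]
  | sub i j k =>
    simp only [Instr.consts, List.mem_cons, List.not_mem_nil, or_false, forall_eq_or_imp,
      forall_eq] at hcI
    refine (lookAt_two b hl hcI.2.1 hcI.2.2 fun τ hk e20 e10 => WP.blk_seq hb h2 ?_
      (append_bump_of_keeps b hJ hs (hk.trans ⟨fun i hi => ?_, rfl, rfl, rfl⟩) hcap hpcW (by rfl)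
        ?_ ?_ (by rfl))).le (by simp; omega)
    · simp [okAll, Instr.ok, hcI]
    · simp at hi; simp [evAll, Instr.ev, hi]
    · simp [Instr.exec, Instr.emits, Cfg.words]
    · simp [evAll, Instr.ev, Instr.exec, Instr.newReg, e10, e20, hlv]
  | mul i j k =>
    simp only [Instr.consts, List.mem_cons, List.not_mem_nil, or_false, forall_eq_or_imp,
      forall_eq] at hcI
    refine (lookAt_two b hl hcI.2.1 hcI.2.2 fun τ hk e20 e10 => WP.blk_seq hb h2 ?_
      (append_bump_of_keeps b hJ hs (hk.trans ⟨fun i hi => ?_, rfl, rfl, rfl⟩) hcap hpcW (by rfl)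
        ?_ ?_ (by rfl))).le (by simp; omega)
    · have := hr' i
      simp [Instr.exec, Instr.newReg] at this
      simp [okAll, Instr.ok, e20, e10, hlv, hcI]; omega
    · simp at hi; simp [evAll, Instr.ev, hi]
    · simp [Instr.exec, Instr.emits, Cfg.words]
    · simp [evAll, Instr.ev, Instr.exec, Instr.newReg, e10, e20, hlv]
  | load i j =>
    simp only [Instr.consts, List.mem_cons, List.not_mem_nil, or_false, forall_eq_or_imp,
      forall_eq] at hcI
    refine (lookAt_spec b hl hcI.2 fun τ hk _ e10 => WP.blk_seq hb h2 (by simp [okAll, Instr.ok])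
      (WP.seq (lookup_spec b (l := l) ?_) fun τ' hτ' => WP.blk_seq hb h2 ?_
      (append_bump_of_keeps b hJ hs ?_ hcap hpcW (by rfl)
        ?_ ?_ (by rfl)))).le (by simp; omega)
    · exact (hl.keeps hk (by simp) (by simp) (by simp)).congr (by simp [evAll, Instr.ev])
        (by simp [evAll, Instr.ev]) (by simp [evAll, Instr.ev]) (by simp [evAll, Instr.ev])
    · simp [okAll, Instr.ok, hcI]
    · refine hk.trans (Keeps.trans (σ' := τ') ?_ ⟨fun i hi => ?_, rfl, rfl, rfl⟩)
      · refine Keeps.trans ⟨fun i hi => ?_, by rfl, by rfl, by rfl⟩ (hτ'.1.subset (by simp))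
        simp at hi; simp [evAll, Instr.ev, hi]
      · simp at hi; simp [evAll, Instr.ev, hi]
    · simp [Instr.exec, Instr.emits, Cfg.words]
    · have h10 := hτ'.2
      simp [evAll, Instr.ev] at h10
      simp [evAll, Instr.ev, Instr.exec, Instr.newReg, h10, e10, hlv]
  | store i j =>
    simp only [Instr.consts, List.mem_cons, List.not_mem_nil, or_false, forall_eq_or_imp,
      forall_eq] at hcI
    refine (lookAt_two b hl hcI.1 hcI.2 fun τ hk e20 e10 => WP.blk_seq hb h2
      (by simp [okAll, Instr.ok])
      (append_bump_of_keeps b hJ hs (hk.trans ⟨fun i hi => ?_, rfl, rfl, rfl⟩) hcap hpcW (by rfl)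
        ?_ ?_ (by rfl))).le (by simp; omega)
    · simp at hi; simp [evAll, Instr.ev, hi]
    · simp [Instr.exec, Instr.emits, Cfg.words]
    · simp [evAll, Instr.ev, Instr.exec, Instr.newReg, e10, e20, hlv]
  | jump x =>
    simp only [Instr.consts, List.mem_cons, List.not_mem_nil, or_false, forall_eq] at hcI
    refine (WP.blk hb h2 (by simp [okAll, Instr.ok, hcI]) ⟨⟨l, hl.congr ?_ ?_ ?_ ?_, by omega, ?_⟩,
      ?_, ?_, ?_, ?_, hJ _ σ _ ?_ (fun i hi => ?_) (fun _ _ => rfl) ?_⟩).le (by simp; omega)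
    any_goals simp [evAll, Instr.ev]
    · simp [hlv, Instr.exec, Instr.newReg]
    · exact hs.base
    · simp [Instr.exec, Instr.newPC]
    · simp [Instr.exec, Instr.usedCoins, hs.fl]
    · simp [Instr.exec, Instr.usedCoins, hs.coins]
    · simpa [Cfg.words, Instr.exec, Instr.emits] using hs.inv
    · simp at hi
      simp [hi]
  | jumpLT i j x =>
    simp only [Instr.consts, List.mem_cons, List.not_mem_nil, or_false, forall_eq_or_imp,
      forall_eq] at hcI
    have key : ∀ τ τ' y, Keeps [10, 11, 12, 13, 20] σ τ → τ' = { τ with v := Function.update τ.v 8 y } →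
        y = (Instr.exec (fun k => ω (f₀ + k)) c (.jumpLT i j x)).pc →
        Sim T Lb L₀ f₀ J (Instr.exec (fun k => ω (f₀ + k)) c (.jumpLT i j x)) (t + 1) τ' := by
      rintro τ τ' y hk rfl hy
      refine ⟨⟨l, (hl.keeps hk (by simp) (by simp) (by simp)).congr ?_ ?_ ?_ ?_, by omega, ?_⟩,
        ?_, ?_, ?_, ?_, hJ _ σ _ ?_ (fun i hi => ?_) (fun _ _ => ?_) ?_⟩
      any_goals simp
      · simp [hlv, Instr.exec, Instr.newReg]
      · rw [hk.v 6 (by simp), hs.base]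
      · exact hy
      · simp [Instr.exec, Instr.usedCoins, hs.fl, hk.fl]
      · simp [Instr.exec, Instr.usedCoins, hs.coins, hk.v]
      · simpa [Cfg.words, Instr.exec, Instr.emits] using hs.inv
      · simp at hi
        simp [hi, hk.v]
      · rw [hk.m]
      · rw [hk.out]
    refine (lookAt_two b hl hcI.1 hcI.2.1 fun τ hk e20 e10 => WP.ite (n := 1) hb (by norm_num)
      (by norm_num) (fun hlt => ?_) (fun hle => ?_)).le (by omega)
    · refine WP.blk hb h2 (by simp [okAll, Instr.ok, hcI]) (key τ _ _ hk rfl ?_)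
      rw [e20, e10, hlv] at hlt
      simp [Instr.exec, Instr.newPC, hlt]
    · have k8 := hk.v 8 (by simp)
      have k2 := hk.v 2 (by simp)
      refine WP.blk hb h2 ?_ (key τ _ _ hk rfl ?_)
      · simp [okAll, Instr.ok, k8, k2, h1, hpc, hpcW]
      rw [e20, e10, hlv] at hle
      simp [Instr.exec, Instr.newPC, not_lt.mpr hle, k8, k2, h1, hpc]
  | flip i =>
    simp only [Instr.consts, List.mem_cons, List.not_mem_nil, or_false, forall_eq] at hcI
    have hc9 := hs.coins
    refine (WP.blk_seq hb h2 ?_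
      (append_bump (c := c) b hJ (l := l) (hl.congr ?_ ?_ ?_ ?_) hlen hcap ?_ ?_ hpcW ?_ ?_
        (hJ _ σ _ ?_ (fun i hi => ?_) (fun _ _ => (by rfl)) (by rfl)) ?_ (by rfl))).le
      (by simp; omega)
    · simp [okAll, Instr.ok, Instr.ev, hcI, hc9, h1, hfW]
    any_goals simp [evAll, Instr.ev]
    · exact hs.base
    · exact hpc
    · simp [Instr.exec, Instr.usedCoins, hs.fl]; omega
    · simp [Instr.exec, Instr.usedCoins, hc9, h1]
    · simpa [Cfg.words, Instr.exec, Instr.emits] using hs.inv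
    · simp at hi
      simp [hi]
    · simp [Instr.exec, Instr.newReg, hlv, hs.fl]
  | output i j =>
    refine (WP.seq (hOut i j rfl σ l c.words hl hs.base hs.inv (hlv ▸ hr))
      fun τ h => WP.blk hb h2 ?_ ?_).le
      (by omega : nOut + 1 ≤ _)
    · simp [okAll, Instr.ok, h.2.2.2.2.1, h.2.1.one, hpc, hpcW]
    obtain ⟨hj, hl', e6, efl, e8, e9⟩ := h
    refine ⟨⟨l, hl'.congr ?_ ?_ ?_ ?_, by omega, ?_⟩, ?_, ?_, ?_, ?_,
      hJ _ τ _ ?_ (fun i hi => ?_) (fun _ _ => rfl) ?_⟩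
    any_goals simp [evAll, Instr.ev]
    · simp [hlv, Instr.exec, Instr.newReg]
    · rw [e6, hs.base]
    · simp [Instr.exec, Instr.newPC, e8, hl'.one, hpc]
    · simp [Instr.exec, Instr.usedCoins, hs.fl, efl]
    · simp [Instr.exec, Instr.usedCoins, hs.coins, e9]
    · simp only [Instr.exec, Instr.emits, Cfg.words, List.map_append, List.map_cons, List.map_nil]
      rw [hlv] at hj
      exact hj
    · simp at hi
      simp [hi]

end

/-! ## Runs of programs -/

theorem run_succ (P : Program) (ω : Coins) (inp : List ℕ) (t : ℕ) :
    run P ω inp (t + 1) = step P ω (run P ω inp t) := by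
  simp [run, Function.iterate_succ_apply']

theorem step_of_length_le {P : Program} {ω : Coins} {c : Cfg} (h : P.length ≤ c.pc) :
    step P ω c = c := by
  simp [step, List.getElem?_eq_none h]

theorem run_of_length_le {P : Program} {ω : Coins} {inp : List ℕ} {t t' : ℕ}
    (h : P.length ≤ (run P ω inp t).pc) (htt' : t ≤ t') : run P ω inp t' = run P ω inp t := by
  induction t', htt' using Nat.le_induction with
  | base => rfl
  | succ n _ ih => rw [run_succ, ih, step_of_length_le h]

theorem bitLength_pos (v : ℕ) : 1 ≤ bitLength v := le_max_left _ _

theorem lt_two_pow_bitLength (v : ℕ) : v < 2 ^ bitLength v :=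
  (Nat.lt_size_self v).trans_le (Nat.pow_le_pow_right (by norm_num) (le_max_right _ _))

theorem bitLength_le {v n : ℕ} (h : v < 2 ^ n) (hn : 1 ≤ n) : bitLength v ≤ n :=
  max_le hn (Nat.size_le.mpr h)

theorem Instr.cost_pos (r : ℕ → ℕ) (I : Instr) : 1 ≤ I.cost r := by
  cases I <;> first | exact bitLength_pos _ | exact le_rfl

theorem flips_run_le (P : Program) (ω : Coins) (inp : List ℕ) (t : ℕ) :
    (run P ω inp t).flips ≤ t := by
  induction t with
  | zero => simp [run, init]
  | succ t ih =>
    rw [run_succ, step]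
    cases P[(run P ω inp t).pc]? with
    | none => simp; omega
    | some I => cases I <;> simp [Instr.exec, Instr.usedCoins] <;> omega

/-- Every instruction costs at least one, so bounds on the time are bounds on the number of steps.
-/
theorem le_time_run {P : Program} {ω : Coins} {inp : List ℕ} {t : ℕ}
    (h : ∀ k, k < t → (run P ω inp k).pc < P.length) : t ≤ (run P ω inp t).time := by
  induction t with
  | zero => simp
  | succ t ih =>
    have := ih fun k hk => h k (by omega)
    have hp := h t (by omega)
    rw [run_succ, step_eq (List.getElem?_eq_getElem hp)]
    have := Instr.cost_pos (run P ω inp t).reg P[(run P ω inp t).pc]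
    simp [Instr.exec]; omega

theorem Cfg.time_le_step (P : Program) (ω : Coins) (c : Cfg) : c.time ≤ (step P ω c).time := by
  rw [step]
  cases P[c.pc]? with
  | none => simp
  | some I => simp [Instr.exec]

theorem time_run_mono (P : Program) (ω : Coins) (inp : List ℕ) :
    Monotone fun t => (run P ω inp t).time :=
  monotone_nat_of_le_succ fun t => by rw [run_succ]; exact Cfg.time_le_step _ _ _

/-- The registers of a program have at most exponential contents. -/
theorem reg_run_lt {P : Program} {ω : Coins} {inp : List ℕ} {S : ℕ} (hS : 1 ≤ S)
    (hP : ∀ I ∈ P, ∀ a ∈ I.consts, a < 2 ^ S) (hinp : ∀ a ∈ inp, a < 2 ^ S) (t a : ℕ) :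
    (run P ω inp t).reg a < 2 ^ (S + (run P ω inp t).time) := by
  induction t generalizing a with
  | zero =>
    simp only [run, init, Function.iterate_zero, id_eq, Nat.add_zero]
    by_cases h : a < inp.length
    · simpa [h] using hinp _ (List.getElem_mem h)
    · simp [h]
  | succ t ih =>
    rw [run_succ, step]
    rcases hI : P[(run P ω inp t).pc]? with _ | I
    · exact ih a
    simp only [Instr.exec]
    set r := (run P ω inp t).reg
    set τ := (run P ω inp t).time
    have hmem := hP I (List.mem_of_getElem? hI)
    have old : ∀ x, r x < 2 ^ (S + (τ + I.cost r)) := fun x =>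
      (ih x).trans_le (Nat.pow_le_pow_right (by norm_num) (by omega))
    have upd : ∀ i x, x < 2 ^ (S + (τ + I.cost r)) →
        Function.update r i x a < 2 ^ (S + (τ + I.cost r)) := by
      intro i x hx
      by_cases h : a = i
      · subst h; simpa using hx
      · simpa [h] using old a
    have hadd : ∀ j k, bitLength (r j + r k) ≤ I.cost r → r j + r k < 2 ^ I.cost r := fun j k h =>
      (lt_two_pow_bitLength _).trans_le (Nat.pow_le_pow_right (by norm_num) h)
    have hcl : 2 ^ I.cost r ≤ 2 ^ (S + (τ + I.cost r)) :=
      Nat.pow_le_pow_right (by norm_num) (by omega)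
    cases I <;> simp only [Instr.newReg]
    case const i x =>
      exact upd _ _ ((hmem x (by simp [Instr.consts])).trans_le
        (Nat.pow_le_pow_right (by norm_num) (by omega)))
    case copy i j => exact upd _ _ (old j)
    case add i j k => exact upd _ _ ((hadd j k le_rfl).trans_le hcl)
    case sub i j k => exact upd _ _ ((Nat.sub_le _ _).trans_lt (old j))
    -- The first factor is bounded by the induction hypothesis, the second, being at most the sum,
    -- by 2 to the power of the cost. The bits gained are thus paid for by the time charged.
    case mul i j k =>
      refine upd _ _ ?_
      have h1 := hadd j k le_rfl
      calc r j * r k < 2 ^ (S + τ) * 2 ^ (Instr.mul i j k).cost r :=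
            Nat.mul_lt_mul'' (ih j) (by omega)
        _ = _ := by rw [← pow_add]; congr 1; omega
    case load i j => exact upd _ _ (old _)
    case store i j => exact upd _ _ (old _)
    case flip i =>
      refine upd _ _ ?_
      have : 2 ^ 1 ≤ 2 ^ (S + (τ + (Instr.flip i).cost r)) :=
        Nat.pow_le_pow_right (by norm_num) (by omega)
      cases ω (run P ω inp t).flips <;> (simp; try omega)
    all_goals exact old a

/-- The exact number of steps until `P` halts is `t`. -/
def StopsAt (P : Program) (ω : Coins) (inp : List ℕ) (t : ℕ) : Prop :=
  (∀ k, k < t → (run P ω inp k).pc < P.length) ∧ P.length ≤ (run P ω inp t).pc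

theorem HaltsAt.exists_stopsAt {P : Program} {ω : Coins} {inp : List ℕ} {c : Cfg}
    (h : HaltsAt P ω inp c) : ∃ t, StopsAt P ω inp t ∧ run P ω inp t = c ∧ t ≤ c.time := by
  classical
  obtain ⟨⟨t, rfl⟩, hp⟩ := h
  have hex : ∃ t, P.length ≤ (run P ω inp t).pc := ⟨t, hp⟩
  have h1 : StopsAt P ω inp (Nat.find hex) :=
    ⟨fun k hk => not_le.mp (Nat.find_min hex hk), Nat.find_spec hex⟩
  have h2 := run_of_length_le h1.2 (Nat.find_min' hex hp)
  exact ⟨_, h1, h2.symm, h2 ▸ le_time_run h1.1⟩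

theorem StopsAt.haltsAt {P : Program} {ω : Coins} {inp : List ℕ} {t : ℕ}
    (h : StopsAt P ω inp t) : HaltsAt P ω inp (run P ω inp t) := ⟨⟨t, rfl⟩, h.2⟩

theorem HaltsAt.unique {P : Program} {ω : Coins} {inp : List ℕ} {c c' : Cfg}
    (h : HaltsAt P ω inp c) (h' : HaltsAt P ω inp c') : c = c' := by
  obtain ⟨⟨t, rfl⟩, hp⟩ := h
  obtain ⟨⟨t', rfl⟩, hp'⟩ := h'
  rcases le_total t t' with ht | ht
  · exact (run_of_length_le hp ht).symm
  · exact run_of_length_le hp' ht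

/-- The first `t` steps depend on the first `t` coins only. -/
theorem run_congr {P : Program} {ω ω' : Coins} {inp : List ℕ} {t : ℕ}
    (h : ∀ i, i < t → ω i = ω' i) : run P ω inp t = run P ω' inp t := by
  induction t with
  | zero => rfl
  | succ t ih =>
    rw [run_succ, run_succ, ← ih fun i hi => h i (by omega), step, step]
    have := flips_run_le P ω inp t
    cases P[(run P ω inp t).pc]? with
    | none => rfl
    | some I => simp only [Instr.exec]; rw [h _ (by omega)]

/-! ## The simulation of a whole program -/

/-- Selection of the instruction to be simulated. -/
def simSwitch (onOut : ℕ → ℕ → Cmd) : List Instr → ℕ → Cmd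
  | [], _ => .blk []
  | I :: l, k => .blk [.const 20 (k + 1)] ;;
      .ite 8 20 (simInstr onOut I) (simSwitch onOut l (k + 1))

/-- The simulation of the program `P`, its input being in the log. -/
def simProg (onOut : ℕ → ℕ → Cmd) (P : Program) : Cmd :=
  .blk [.const 8 0, .const 9 0, .const 19 P.length] ;; .loop 8 19 (simSwitch onOut P 0)

/-- The simulated counter is compared with successive bounds; once the smaller ones are excluded,
being below `k + 1` means being equal to `k`. Each level costs three steps: the constant, the test,
and the jump over the other branch. -/
theorem simSwitch_spec {T W : ℕ} {ω : Coins} (b : Bds T W) {onOut : ℕ → ℕ → Cmd} {n : ℕ}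
    {Q : St → Prop} (l : List Instr) (k idx : ℕ) (hidx : idx < l.length) (σ : St)
    (hpc : σ.v 8 = k + idx) (hW : k + l.length < W)
    (h : ∀ τ, Keeps [20] σ τ → WP 40 T W ω (simInstr onOut l[idx]) n Q τ) :
    WP 40 T W ω (simSwitch onOut l k) (3 * l.length + n) Q σ := by
  induction l generalizing k idx σ with
  | nil => simp at hidx
  | cons I l ih =>
    have hkeep : Keeps [20] σ (evAll ω [.const 20 (k + 1)] σ) := by
      refine ⟨fun i hi => ?_, rfl, rfl, rfl⟩
      simp at hi
      simp [evAll, Instr.ev, hi]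
    simp only [List.length_cons] at hW hidx ⊢
    refine (WP.blk_seq b.low b.two (by simp [okAll, Instr.ok]; omega)
      (WP.ite (n := 3 * l.length + n) b.low (by norm_num) (by norm_num) (fun hlt => ?_)
        (fun hle => ?_))).le (by simp; omega)
    · simp [evAll, Instr.ev, hpc] at hlt
      obtain rfl : idx = 0 := by omega
      exact (h _ hkeep).le (by omega)
    · simp [evAll, Instr.ev, hpc] at hle
      obtain ⟨idx, rfl⟩ : ∃ i, idx = i + 1 := ⟨idx - 1, by omega⟩
      refine ih (k + 1) idx (by omega) _ ?_ (by omega) fun τ hτ => h τ (hkeep.trans hτ)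
      simp [evAll, Instr.ev, hpc]; omega

theorem Sim.keeps {T Lb L₀ f₀ : ℕ} {J : List (List ℕ) → St → Prop} (hJ : SimStable J) {c : Cfg}
    {t : ℕ} {σ τ : St} (h : Sim T Lb L₀ f₀ J c t σ) (hk : Keeps [20] σ τ) :
    Sim T Lb L₀ f₀ J c t τ := by
  obtain ⟨l, hl, hlen, hlv⟩ := h.log
  refine ⟨⟨l, hl.keeps hk (by simp) (by simp) (by simp), hlen, hlv⟩, ?_, ?_, ?_, ?_, ?_⟩
  · rw [hk.v 6 (by simp), h.base]
  · rw [hk.v 8 (by simp), h.pc]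
  · rw [hk.fl, h.fl]
  · rw [hk.v 9 (by simp), h.coins]
  · refine hJ _ σ _ h.inv (fun i hi => hk.v i ?_) (fun a _ => by rw [hk.m]) hk.out
    simp at hi ⊢
    omega

/-- The loop invariant is `Sim` for the successive configurations of the simulated run. Halting of
that run is the condition that its counter reaches its length, which is the exit condition of the
loop, so there are exactly `ts` rounds; `hJ19` protects the length in register 19. -/
theorem simProg_spec {T W : ℕ} {ω : Coins} (b : Bds T W) {J : List (List ℕ) → St → Prop}
    (hJ : SimStable J) {onOut : ℕ → ℕ → Cmd} {nOut B Lb L₀ f₀ : ℕ} {P : Program} {inp : List ℕ}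
    (hP : ∀ I ∈ P, ∀ a ∈ I.consts, a < W) (hPW : P.length < W)
    (hJ19 : ∀ ws σ, J ws σ → σ.v 19 = P.length)
    (hOut : ∀ i j, Instr.output i j ∈ P → ∀ σ l ws, HasLog T σ l → σ.v 6 = Lb → J ws σ →
      (∀ a, lookupVal l a < B) → WP 40 T W ω (onOut i j) nOut
        (fun σ' => J (ws ++ [outWord (lookupVal l) i j]) σ' ∧ HasLog T σ' l ∧ σ'.v 6 = σ.v 6 ∧
          σ'.fl = σ.fl ∧ σ'.v 8 = σ.v 8 ∧ σ'.v 9 = σ.v 9) σ)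
    (hBW : B ≤ W) {ts : ℕ} (hts : StopsAt P (fun k => ω (f₀ + k)) inp ts)
    (hreg : ∀ k, k ≤ ts → ∀ a, (run P (fun k => ω (f₀ + k)) inp k).reg a < B)
    (hcap : Lb + 2 * (L₀ + ts) ≤ T) (htsW : ts < W) {σ : St} {l : List (ℕ × ℕ)}
    (hl : HasLog T σ l) (hlen : l.length ≤ L₀) (hlv : lookupVal l = fun i => inp.getD i 0)
    (hbase : σ.v 6 = Lb) (hfl : σ.fl = f₀)
    (hJ0 : J [] (evAll ω [.const 8 0, .const 9 0, .const 19 P.length] σ)) :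
    WP 40 T W ω (simProg onOut P) (5 + ts * (3 * P.length + 20 * T + 32 + nOut))
      (Sim T Lb L₀ f₀ J (run P (fun k => ω (f₀ + k)) inp ts) ts) σ := by
  refine (WP.blk_seq b.low b.two (by have := b.two; simp [okAll, Instr.ok, hPW]; omega)
    (WP.loop_count (n := 3 * P.length + (20 * T + 30 + nOut)) b.low (by norm_num) (by norm_num) ts
      (fun k => Sim T Lb L₀ f₀ J (run P (fun k => ω (f₀ + k)) inp k) k) ?_ ?_ ?_)).le ?_
  · intro k hk τ hτ
    have hlt := hts.1 k hk
    refine ⟨by rw [hτ.pc, hJ19 _ _ hτ.inv]; exact hlt, ?_⟩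
    refine simSwitch_spec b P 0 _ hlt τ (by rw [hτ.pc]; omega) (by omega) fun τ' hk' => ?_
    have hs := Sim.keeps hJ hτ hk'
    have hrun : run P (fun k => ω (f₀ + k)) inp (k + 1) =
        P[(run P (fun k => ω (f₀ + k)) inp k).pc].exec (fun k => ω (f₀ + k))
          (run P (fun k => ω (f₀ + k)) inp k) := by
      rw [run_succ, step_eq (List.getElem?_eq_getElem hlt)]
    rw [hrun]
    refine simInstr_spec b hJ (hP _ (List.getElem_mem hlt)) (fun i j hij => ?_) hBW hs
      (hreg k (by omega)) (fun a => hrun ▸ hreg (k + 1) (by omega) a) (by omega) (by omega) ?_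
    · exact hOut i j (hij ▸ List.getElem_mem hlt)
    · have := flips_run_le P (fun k => ω (f₀ + k)) inp k
      omega
  · intro τ hτ
    exact ⟨by rw [hτ.pc, hJ19 _ _ hτ.inv]; exact hts.2, hτ⟩
  · refine ⟨⟨l, hl.congr ?_ ?_ ?_ ?_, by omega, ?_⟩, ?_, ?_, ?_, ?_, hJ0⟩
    any_goals simp [evAll, Instr.ev]
    · rw [hlv]; simp [run, init]
    · exact hbase
    · simp [run, init]
    · simp [run, init, hfl]
    · simp [run, init]
  · simp only [List.length_cons, List.length_nil]
    ring_nf; omega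

/-! ## Capturing the output of the generator -/

/-- A code for words with letters below `s`. -/
def wordCode (s : ℕ) (w : List ℕ) : ℕ := w.foldl (fun e a => e * (s + 1) + (a + 1)) 1

theorem wordCode_concat (s : ℕ) (w : List ℕ) (a : ℕ) :
    wordCode s (w ++ [a]) = wordCode s w * (s + 1) + (a + 1) := by
  simp [wordCode]

/-- This leaves the value 0 free to mean that there is no reference solution. -/
theorem wordCode_pos (s : ℕ) (w : List ℕ) : 1 ≤ wordCode s w := by
  induction w using List.reverseRecOn with
  | nil => simp [wordCode]
  | append_singleton w a ih => rw [wordCode_concat]; omega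

/-- Words are written in base `s + 1` with a leading 1 and digits from 1 to `s`. Division by `s + 1`
recovers the code of the prefix, and only the empty word has code 1. -/
theorem wordCode_injOn {s : ℕ} {w w' : List ℕ} (hw : ∀ a ∈ w, a < s) (hw' : ∀ a ∈ w', a < s)
    (h : wordCode s w = wordCode s w') : w = w' := by
  induction w using List.reverseRecOn generalizing w' with
  | nil =>
    rcases w'.eq_nil_or_concat' with rfl | ⟨u, a, rfl⟩
    · rfl
    · have ha := hw' a (by simp)
      have := wordCode_pos s u
      rw [wordCode_concat, show wordCode s [] = 1 from rfl] at h
      nlinarith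
  | append_singleton w a ih =>
    have ha := hw a (by simp)
    rcases w'.eq_nil_or_concat' with rfl | ⟨u, c, rfl⟩
    · have := wordCode_pos s w
      rw [wordCode_concat, show wordCode s [] = 1 from rfl] at h
      nlinarith
    · have hc := hw' c (by simp)
      rw [wordCode_concat, wordCode_concat] at h
      have h1 : (a + 1 + (s + 1) * wordCode s w) / (s + 1) =
          (c + 1 + (s + 1) * wordCode s u) / (s + 1) := by
        congr 1; linarith
      rw [Nat.add_mul_div_left _ _ (by omega), Nat.add_mul_div_left _ _ (by omega),
        Nat.div_eq_of_lt (by omega), Nat.div_eq_of_lt (by omega)] at h1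
      have h2 : wordCode s w = wordCode s u := by omega
      rw [ih (fun x hx => hw x (by simp [hx])) (fun x hx => hw' x (by simp [hx])) h2]
      rw [h2] at h
      simp; omega

/-- Only the low registers in `S` and the high registers in `[lo, hi)` may differ. -/
structure Frame (S : List ℕ) (lo hi : ℕ) (σ σ' : St) : Prop where
  v : ∀ i, i ∉ S → σ'.v i = σ.v i
  m : ∀ a, a < lo ∨ hi ≤ a → σ'.m a = σ.m a
  fl : σ'.fl = σ.fl
  out : σ'.out = σ.out

theorem Keeps.frame {S : List ℕ} {lo hi : ℕ} {σ σ' : St} (h : Keeps S σ σ') :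
    Frame S lo hi σ σ' := ⟨h.v, fun _ _ => by rw [h.m], h.fl, h.out⟩

theorem Frame.trans {S : List ℕ} {lo hi : ℕ} {σ σ' σ'' : St} (h : Frame S lo hi σ σ')
    (h' : Frame S lo hi σ' σ'') : Frame S lo hi σ σ'' :=
  ⟨fun i hi => (h'.v i hi).trans (h.v i hi), fun a ha => (h'.m a ha).trans (h.m a ha),
    h'.fl.trans h.fl, h'.out.trans h.out⟩

theorem Frame.subset {S S' : List ℕ} {lo hi : ℕ} {σ σ' : St} (h : Frame S lo hi σ σ')
    (hS : S ⊆ S') : Frame S' lo hi σ σ' :=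
  ⟨fun i hi => h.v i fun h' => hi (hS h'), h.m, h.fl, h.out⟩

/-- The constant part of the memory: parameters and the instance `xs`, the alphabet having `s`
letters. -/
structure Env (s Xb Bd : ℕ) (xs : List ℕ) (σ : St) : Prop where
  v0 : σ.v 0 = xs.length
  v1 : σ.v 1 = 0
  v2 : σ.v 2 = 1
  v3 : σ.v 3 = Xb
  v4 : σ.v 4 = Bd
  v5 : σ.v 5 = Xb + xs.length
  v6 : σ.v 6 = Xb + xs.length + Bd
  v25 : σ.v 25 = s + 1
  arr : ∀ i (h : i < xs.length), σ.m (Xb + i) = xs[i]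

/-- Only the low registers in `S` and the high registers from `lo` on may differ, and nothing has
been output. -/
structure Pres (S : List ℕ) (lo : ℕ) (σ σ' : St) : Prop where
  v : ∀ i, i ∉ S → σ'.v i = σ.v i
  m : ∀ a, a < lo → σ'.m a = σ.m a
  out : σ'.out = σ.out

theorem Frame.pres {S : List ℕ} {lo hi : ℕ} {σ σ' : St} (h : Frame S lo hi σ σ') :
    Pres S lo σ σ' := ⟨h.v, fun a ha => h.m a (.inl ha), h.out⟩

theorem Keeps.pres {S : List ℕ} {lo : ℕ} {σ σ' : St} (h : Keeps S σ σ') :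
    Pres S lo σ σ' := ⟨h.v, fun _ _ => by rw [h.m], h.out⟩

theorem Pres.trans {S : List ℕ} {lo : ℕ} {σ σ' σ'' : St} (h : Pres S lo σ σ')
    (h' : Pres S lo σ' σ'') : Pres S lo σ σ'' :=
  ⟨fun i hi => (h'.v i hi).trans (h.v i hi), fun a ha => (h'.m a ha).trans (h.m a ha),
    h'.out.trans h.out⟩

theorem Pres.mono {S S' : List ℕ} {lo lo' : ℕ} {σ σ' : St} (h : Pres S lo σ σ')
    (hS : S ⊆ S') (hlo : lo' ≤ lo) : Pres S' lo' σ σ' :=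
  ⟨fun i hi => h.v i fun h' => hi (hS h'), fun a ha => h.m a (by omega), h.out⟩

theorem Env.pres {s Xb Bd lo : ℕ} {xs : List ℕ} {S : List ℕ} {σ σ' : St}
    (h : Env s Xb Bd xs σ) (k : Pres S lo σ σ') (hlo : Xb + xs.length ≤ lo)
    (hS : ∀ i ∈ [0, 1, 2, 3, 4, 5, 6, 25], i ∉ S) : Env s Xb Bd xs σ' := by
  simp only [List.mem_cons, List.not_mem_nil, or_false, forall_eq_or_imp, forall_eq] at hS
  obtain ⟨h0, h1, h2, h3, h4, h5, h6, h25⟩ := hS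
  refine ⟨(k.v _ h0).trans h.v0, (k.v _ h1).trans h.v1, (k.v _ h2).trans h.v2,
    (k.v _ h3).trans h.v3, (k.v _ h4).trans h.v4, (k.v _ h5).trans h.v5, (k.v _ h6).trans h.v6,
    (k.v _ h25).trans h.v25, fun i hi => ?_⟩
  rw [k.m _ (by omega), h.arr i hi]

theorem Env.frame {s Xb Bd : ℕ} {xs : List ℕ} {S : List ℕ} {hi : ℕ} {σ σ' : St}
    (h : Env s Xb Bd xs σ) (k : Frame S (Xb + xs.length) hi σ σ')
    (hS : ∀ i ∈ [0, 1, 2, 3, 4, 5, 6, 25], i ∉ S) : Env s Xb Bd xs σ' :=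
  h.pres k.pres le_rfl hS

/-- The words `ws` output by the generator are recorded: there is none, or exactly one which is
short and has letters below `s` and then stands at `Ob`, or register 15 contains 2. -/
def Cand (s Ob Bd : ℕ) (ws : List (List ℕ)) (σ : St) : Prop :=
  (ws = [] ∧ σ.v 15 = 0) ∨
  (∃ w, ws = [w] ∧ σ.v 15 = 1 ∧ w.length ≤ Bd ∧ (∀ a ∈ w, a < s) ∧ σ.v 14 = w.length ∧
    σ.v 16 = wordCode s w ∧ ∀ i (h : i < w.length), σ.m (Ob + i) = w[i]) ∨
  (σ.v 15 = 2 ∧ ws ≠ [] ∧ ¬ ∃ w, ws = [w] ∧ w.length ≤ Bd ∧ ∀ a ∈ w, a < s)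

/-- Record a word output by the generator. -/
def genOut (i j : ℕ) : Cmd :=
  .ite 1 15 (.blk [.const 15 2])
    (lookAt j ;; .blk [.copy 20 10] ;; lookAt i ;;
      .blk [.add 20 20 2, .sub 14 20 10, .copy 24 10, .copy 21 5, .add 22 5 14, .const 16 1,
        .const 15 1] ;;
      .ite 4 14 (.blk [.const 15 2])
        (.loop 21 22 (.blk [.copy 11 24] ;; lookupCmd ;; .blk [.add 23 10 2] ;;
          .ite 23 25 (.blk [.store 21 10, .mul 16 16 25, .add 16 16 23]) (.blk [.const 15 2]) ;;
          .blk [.add 21 21 2, .add 24 24 2])))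

theorem outWord_length (r : ℕ → ℕ) (i j : ℕ) : (outWord r i j).length = r j + 1 - r i := by
  simp [outWord]

theorem outWord_getElem (r : ℕ → ℕ) (i j k : ℕ) (h : k < (outWord r i j).length) :
    (outWord r i j)[k] = r (r i + k) := by
  simp [outWord]

section

variable {T W : ℕ} {ω : Coins}

/-- One letter of the recorded word, legal if and only if `w[k] + 1 < s + 1`. An illegal letter is
not stored and sets register 15 to 2, but the loop continues and no later letter resets this mark.
The bound on register 16 is maintained in both cases, as it has to hold whatever the generator
outputs. -/
theorem genOut_body (b : Bds T W) {s Xb Bd B : ℕ} {xs : List ℕ} {σ τ : St} {l : List (ℕ × ℕ)}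
    (hl : HasLog T σ l) (he : Env s Xb Bd xs σ) (hXb : 40 ≤ Xb) (hB : ∀ a, lookupVal l a < B)
    (hBW : B + T < W) (hE : 2 * (s + 1) ^ Bd ≤ W) {k c : ℕ} {w : List ℕ} (hw : w.length ≤ Bd)
    (hk : k < w.length) (hc : c < B) (hwk : w[k] = lookupVal l (c + k))
    (hf : Frame [10, 11, 12, 13, 14, 15, 16, 20, 21, 22, 23, 24] (Xb + xs.length)
      (Xb + xs.length + Bd) σ τ)
    (e14 : τ.v 14 = w.length)
    (e21 : τ.v 21 = Xb + xs.length + k) (e22 : τ.v 22 = Xb + xs.length + w.length)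
    (e24 : τ.v 24 = c + k)
    (e16 : τ.v 16 < 2 * (s + 1) ^ k)
    (hgood : (∀ a ∈ w.take k, a < s) → τ.v 15 = 1 ∧ τ.v 16 = wordCode s (w.take k) ∧
      ∀ i (h : i < w.length), i < k → τ.m (Xb + xs.length + i) = w[i])
    (hbad : (¬ ∀ a ∈ w.take k, a < s) → τ.v 15 = 2) :
    WP 40 T W ω (.blk [.copy 11 24] ;; lookupCmd ;; .blk [.add 23 10 2] ;;
          .ite 23 25 (.blk [.store 21 10, .mul 16 16 25, .add 16 16 23]) (.blk [.const 15 2]) ;;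
          .blk [.add 21 21 2, .add 24 24 2]) (10 * T + 13)
      (fun τ => Frame [10, 11, 12, 13, 14, 15, 16, 20, 21, 22, 23, 24] (Xb + xs.length)
          (Xb + xs.length + Bd) σ τ ∧ τ.v 14 = w.length ∧
        τ.v 21 = Xb + xs.length + (k + 1) ∧ τ.v 22 = Xb + xs.length + w.length ∧
        τ.v 24 = c + (k + 1) ∧ τ.v 16 < 2 * (s + 1) ^ (k + 1) ∧
        ((∀ a ∈ w.take (k + 1), a < s) → τ.v 15 = 1 ∧ τ.v 16 = wordCode s (w.take (k + 1)) ∧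
          ∀ i (h : i < w.length), i < k + 1 → τ.m (Xb + xs.length + i) = w[i]) ∧
        ((¬ ∀ a ∈ w.take (k + 1), a < s) → τ.v 15 = 2)) τ := by
  have hb := b.low
  have h2 := b.two
  have hlt := b.lt
  have hT : Xb + xs.length + Bd ≤ T := by
    have h1 := hl.fin; have h2 := hl.top; have := he.v6; omega
  have htake : w.take (k + 1) = w.take k ++ [w[k]] := by
    rw [List.take_add_one]; simp [hk]
  have hpow : 2 * (s + 1) ^ (k + 1) ≤ W :=
    le_trans (Nat.mul_le_mul_left 2 (Nat.pow_le_pow_right (by omega) (by omega))) hE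
  -- From `v < 2(s+1)^k` follows `(v + 1)(s + 1) ≤ 2(s+1)^(k+1)`, which leaves room for a digit at
  -- most `s`.
  have hE1 : τ.v 16 * (s + 1) + s < 2 * (s + 1) ^ (k + 1) := by
    have h3 := Nat.mul_le_mul_right (s + 1) (Nat.succ_le_of_lt e16)
    rw [pow_succ, ← mul_assoc]
    rw [Nat.succ_mul] at h3
    omega
  have hE0 : τ.v 16 < 2 * (s + 1) ^ (k + 1) := by
    have := Nat.le_mul_of_pos_right (τ.v 16) (show 0 < s + 1 by omega)
    omega
  have hwB : w[k] < B := hwk ▸ hB _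
  have het := he.frame hf (by simp)
  have hlog : HasLog T τ l := hl.congr (hf.v _ (by simp)) (hf.v _ (by simp)) (hf.v _ (by simp))
    fun a ha => hf.m a (by rw [he.v6] at ha; omega)
  refine (WP.blk_seq hb h2 (by simp [okAll, Instr.ok])
    (WP.seq (lookup_spec b (l := l) ?_) fun τ₁ h₁ =>
      WP.blk_seq (n := 7) hb h2 ?_ ?_)).le (by simp; omega)
  · exact hlog.congr (by simp [evAll, Instr.ev]) (by simp [evAll, Instr.ev])
        (by simp [evAll, Instr.ev]) (by simp [evAll, Instr.ev])
  · have h10 := h₁.2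
    have k2 := h₁.1.v 2 (by simp)
    simp [evAll, Instr.ev, e24] at h10 k2
    simp [okAll, Instr.ok, h10, k2, het.v2]
    omega
  obtain ⟨kp, h10⟩ := h₁
  simp [evAll, Instr.ev, e24, ← hwk] at h10
  have ka : ∀ i, i ∉ [10, 11, 12, 13] → τ₁.v i = τ.v i := by
    intro i hi
    simp at hi
    rw [kp.v i (by simp [hi])]
    simp [evAll, Instr.ev, hi]
  have hm : τ₁.m = τ.m := kp.m
  have hfl : τ₁.fl = τ.fl := kp.fl
  have hout : τ₁.out = τ.out := kp.out
  clear kp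
  have a2 := ka 2 (by simp)
  have a15 := ka 15 (by simp)
  have a16 := ka 16 (by simp)
  have a25 := ka 25 (by simp)
  have a21 := ka 21 (by simp)
  have a22 := ka 22 (by simp)
  have a24 := ka 24 (by simp)
  have a14 := ka 14 (by simp)
  rw [het.v2] at a2
  rw [het.v25] at a25
  have hFr : Frame [10, 11, 12, 13, 14, 15, 16, 20, 21, 22, 23, 24] (Xb + xs.length)
          (Xb + xs.length + Bd) σ τ₁ :=
    hf.trans ⟨fun i hi => ka i (by simp at hi ⊢; omega), fun a _ => by rw [hm], hfl, hout⟩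
  refine (WP.seq (n := 5) (n' := 2) (R := fun τ' =>
      Frame [10, 11, 12, 13, 14, 15, 16, 20, 21, 22, 23, 24] (Xb + xs.length)
          (Xb + xs.length + Bd) σ τ' ∧ τ'.v 14 = w.length ∧
        τ'.v 21 = Xb + xs.length + k ∧ τ'.v 22 = Xb + xs.length + w.length ∧
        τ'.v 24 = c + k ∧ τ'.v 16 < 2 * (s + 1) ^ (k + 1) ∧
        ((∀ a ∈ w.take (k + 1), a < s) → τ'.v 15 = 1 ∧ τ'.v 16 = wordCode s (w.take (k + 1)) ∧
          ∀ i (h : i < w.length), i < k + 1 → τ'.m (Xb + xs.length + i) = w[i]) ∧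
        ((¬ ∀ a ∈ w.take (k + 1), a < s) → τ'.v 15 = 2)) ?_ ?_)
  · refine WP.ite (n := 3) hb (by norm_num) (by norm_num) (fun hlt => ?_) (fun hle => ?_)
    · simp [evAll, Instr.ev, h10, a2, a25] at hlt
      have hE2 : τ.v 16 * (s + 1) + (w[k] + 1) < 2 * (s + 1) ^ (k + 1) := by omega
      refine WP.blk hb h2 ?_ ?_
      · simp [okAll, Instr.ok, evAll, Instr.ev, a21, e21, a16, a25, h10, a2]
        omega
      refine ⟨⟨fun i hi => ?_, fun a ha => ?_, hFr.fl, hFr.out⟩, ?_, ?_, ?_, ?_, ?_,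
        fun h => ⟨?_, ?_, fun i hi hik => ?_⟩, fun h => ?_⟩
      · have := hFr.v i hi
        simp at hi
        simp [evAll, Instr.ev, hi, this]
      · simp [evAll, Instr.ev, a21, e21]
        rw [Function.update_of_ne (by omega)]
        exact hFr.m a ha
      · simp [evAll, Instr.ev, a14, e14]
      · simp [evAll, Instr.ev, a21, e21]
      · simp [evAll, Instr.ev, a22, e22]
      · simp [evAll, Instr.ev, a24, e24]
      · simpa [evAll, Instr.ev, a16, a25, h10, a2] using hE2
      · rw [htake] at h
        simp [evAll, Instr.ev, a15, (hgood fun a ha => h a (List.mem_append_left _ ha)).1]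
      · rw [htake] at h ⊢
        rw [wordCode_concat, ← (hgood fun a ha => h a (List.mem_append_left _ ha)).2.1]
        simp [evAll, Instr.ev, a16, a25, h10, a2]
      · simp [evAll, Instr.ev, a21, e21, h10]
        rw [htake] at h
        by_cases hik' : i = k
        · subst hik'; simp
        · rw [Function.update_of_ne (by omega), hm]
          exact (hgood fun a ha => h a (List.mem_append_left _ ha)).2.2 i hi (by omega)
      · simp [evAll, Instr.ev, a15]
        refine hbad fun h' => h fun a ha => ?_
        rw [htake] at ha
        simp only [List.mem_append, List.mem_singleton] at ha
        rcases ha with ha | rfl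
        · exact h' a ha
        · exact hlt
    · simp [evAll, Instr.ev, h10, a2, a25] at hle
      refine (WP.blk hb h2 (by simp [okAll, Instr.ok]; omega) ?_).le (by simp : 1 ≤ 3)
      refine ⟨⟨fun i hi => ?_, hFr.m, hFr.fl, hFr.out⟩, ?_, ?_, ?_, ?_, ?_,
        fun h => absurd (h w[k] (htake ▸ List.mem_append_right _ (List.mem_singleton_self _))) (by omega), fun h => ?_⟩
      · have := hFr.v i hi
        simp at hi
        simp [evAll, Instr.ev, hi, this]
      · simp [evAll, Instr.ev, a14, e14]
      · simp [evAll, Instr.ev, a21, e21]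
      · simp [evAll, Instr.ev, a22, e22]
      · simp [evAll, Instr.ev, a24, e24]
      · simpa [evAll, Instr.ev, a16] using hE0
      · simp [evAll, Instr.ev]
  · rintro τ' ⟨f, g14, g21, g22, g24, g16, gg, gb⟩
    have g2 := f.v 2 (by simp)
    rw [he.v2] at g2
    refine WP.blk hb h2 ?_ ⟨⟨fun i hi => ?_, f.m, f.fl, f.out⟩, ?_, ?_, ?_, ?_, ?_,
        fun h => ?_, fun h => ?_⟩
    · simp [okAll, Instr.ok, Instr.ev, g2, g21, g24]; omega
    · have := f.v i hi
      simp at hi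
      simp [evAll, Instr.ev, hi, this]
    · simp [evAll, Instr.ev, g14]
    · simp [evAll, Instr.ev, g21, g2]; omega
    · simp [evAll, Instr.ev, g22]
    · simp [evAll, Instr.ev, g24, g2]; omega
    · simpa [evAll, Instr.ev] using g16
    · simpa [evAll, Instr.ev] using gg h
    · simpa [evAll, Instr.ev] using gb h

/-- A second output invalidates the record for good, since any nonzero status leads to status 2. The
assumption `B + T < W` leaves room for the running address in register 24, which starts below `B`
and advances at most `T` times. -/
theorem genOut_spec (b : Bds T W) {s Xb Bd B : ℕ} {xs : List ℕ} {σ : St} {l : List (ℕ × ℕ)}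
    (hl : HasLog T σ l) (he : Env s Xb Bd xs σ) (hXb : 40 ≤ Xb) (hB : ∀ a, lookupVal l a < B)
    (hBW : B + T < W) (hE : 2 * (s + 1) ^ Bd ≤ W) {i j : ℕ} (hi : i < W) (hj : j < W)
    {ws : List (List ℕ)} (hws : Cand s (Xb + xs.length) Bd ws σ) :
    WP 40 T W ω (genOut i j) (20 * T + 30 + T * (10 * T + 15))
      (fun σ' => Frame [10, 11, 12, 13, 14, 15, 16, 20, 21, 22, 23, 24] (Xb + xs.length)
          (Xb + xs.length + Bd) σ σ' ∧
        Cand s (Xb + xs.length) Bd (ws ++ [outWord (lookupVal l) i j]) σ') σ := by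
  have hb := b.low
  have h2 := b.two
  have hlt := b.lt
  have hT : Xb + xs.length + Bd ≤ T := by
    have h1 := hl.fin; have h2 := hl.top; have := he.v6; omega
  have h1 := he.v1
  refine (WP.ite (n := 20 * T + 24 + T * (10 * T + 15)) hb (by norm_num) (by norm_num)
    (fun hlt => ?_) (fun hle => ?_)).le (by omega)
  · refine (WP.blk hb h2 (by simp [okAll, Instr.ok]; omega) ?_).le
      (by omega : 1 ≤ _)
    refine ⟨⟨fun i hi => ?_, fun _ _ => rfl, rfl, rfl⟩, .inr (.inr ⟨?_, by simp, ?_⟩)⟩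
    · simp at hi
      simp [evAll, Instr.ev, hi]
    · simp [evAll, Instr.ev]
    · rintro ⟨w, hw, -⟩
      rcases hws with ⟨rfl, h0⟩ | ⟨w, rfl, -⟩ | ⟨-, hne, -⟩
      · omega
      · simp at hw
      · cases ws
        · simp at hne
        · simp at hw
  · have hnil : ws = [] := by
      rcases hws with ⟨rfl, -⟩ | ⟨w, rfl, h, -⟩ | ⟨h, -⟩
      · rfl
      · omega
      · omega
    subst hnil
    set w := outWord (lookupVal l) i j with hw
    set c := lookupVal l i with hc
    have hwlen : w.length = lookupVal l j + 1 - c := outWord_length _ _ _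
    refine (lookAt_two b hl hj hi fun τ k1 e20 e10 => WP.blk_seq
      (n := T * (10 * T + 15) + 4) hb h2 ?_ ?_).le (by simp; omega)
    · have := hB i
      have := hB j
      have := k1.v 2 (by simp)
      have := k1.v 5 (by simp)
      have := he.v2
      have := he.v5
      simp [okAll, Instr.ok, Instr.ev, *]
      omega
    set τ₁ := evAll ω [.add 20 20 2, .sub 14 20 10, .copy 24 10, .copy 21 5, .add 22 5 14,
      .const 16 1, .const 15 1] τ with hτ₁
    have k2 := k1.v 2 (by simp)
    have k5 := k1.v 5 (by simp)
    rw [he.v2] at k2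
    rw [he.v5] at k5
    have hf : Frame [10, 11, 12, 13, 14, 15, 16, 20, 21, 22, 23, 24] (Xb + xs.length)
        (Xb + xs.length + Bd) σ τ₁ := by
      refine (k1.frame.subset (by simp)).trans ⟨fun i hi => ?_, fun _ _ => rfl, rfl, rfl⟩
      simp at hi
      simp [hτ₁, evAll, Instr.ev, hi]
    have e14 : τ₁.v 14 = w.length := by
      simp [hτ₁, evAll, Instr.ev, e20, e10, k2, hwlen, hc]
    have e24 : τ₁.v 24 = c := by
      simp [hτ₁, evAll, Instr.ev, e10, hc]
    have e21 : τ₁.v 21 = Xb + xs.length := by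
      simp [hτ₁, evAll, Instr.ev, k5]
    have e22 : τ₁.v 22 = Xb + xs.length + w.length := by
      rw [← e14]
      simp [hτ₁, evAll, Instr.ev, k5]
    have e16 : τ₁.v 16 = 1 := by simp [hτ₁, evAll, Instr.ev]
    have e15 : τ₁.v 15 = 1 := by simp [hτ₁, evAll, Instr.ev]
    have e4 : τ₁.v 4 = Bd := (hf.v 4 (by simp)).trans he.v4
    clear_value τ₁
    -- The length is compared with `Bd` before anything is copied, so a long output cannot overrun
    -- the area reserved for the candidate and damage the log.
    refine (WP.ite (n := T * (10 * T + 15) + 2) hb (by norm_num) (by norm_num)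
      (fun hlt => ?_) (fun hle => ?_)).le (by omega)
    · refine (WP.blk hb h2 (by simp [okAll, Instr.ok]; omega) ?_).le
        (by simp : 1 ≤ _)
      refine ⟨hf.trans ⟨fun i hi => ?_, fun _ _ => rfl, rfl, rfl⟩,
        .inr (.inr ⟨?_, by simp, ?_⟩)⟩
      · simp at hi
        simp [evAll, Instr.ev, hi]
      · simp [evAll, Instr.ev]
      · rintro ⟨w', hw', h', -⟩
        simp at hw'
        subst hw'
        omega
    · have hwB : w.length ≤ Bd := by omega
      refine (WP.loop_count (n := 10 * T + 13) hb (by norm_num) (by norm_num) w.length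
        (fun k τ => Frame [10, 11, 12, 13, 14, 15, 16, 20, 21, 22, 23, 24] (Xb + xs.length)
          (Xb + xs.length + Bd) σ τ ∧ τ.v 14 = w.length ∧
        τ.v 21 = Xb + xs.length + k ∧ τ.v 22 = Xb + xs.length + w.length ∧
        τ.v 24 = c + k ∧ τ.v 16 < 2 * (s + 1) ^ k ∧
        ((∀ a ∈ w.take k, a < s) → τ.v 15 = 1 ∧ τ.v 16 = wordCode s (w.take k) ∧
          ∀ i (h : i < w.length), i < k → τ.m (Xb + xs.length + i) = w[i]) ∧
        ((¬ ∀ a ∈ w.take k, a < s) → τ.v 15 = 2)) ?_ ?_ ?_).le ?_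
      · rintro k hk τ' ⟨f, g14, g21, g22, g24, g16, gg, gb⟩
        exact ⟨by omega, genOut_body b hl he hXb hB hBW hE hwB hk (hB i)
          (outWord_getElem _ _ _ _ hk) f g14 g21 g22 g24 g16 gg gb⟩
      · rintro τ' ⟨f, g14, g21, g22, g24, g16, gg, gb⟩
        refine ⟨by omega, f, ?_⟩
        rw [List.take_length] at gg gb
        by_cases hall : ∀ a ∈ w, a < s
        · obtain ⟨g1, g2, g3⟩ := gg hall
          exact .inr (.inl ⟨w, by simp, g1, hwB, hall, g14, g2, fun i hi => g3 i hi hi⟩)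
        · refine .inr (.inr ⟨gb hall, by simp, ?_⟩)
          rintro ⟨w', hw', -, h'⟩
          simp at hw'
          subst hw'
          exact hall h'
      · exact ⟨hf, e14, by simp [e21], e22, by simp [e24], by simp [e16],
          fun _ => ⟨e15, by simp [e16, wordCode], fun i _ hi => absurd hi (by omega)⟩,
          fun h => absurd h (by simp)⟩
      · have : w.length ≤ T := by omega
        have := Nat.mul_le_mul_right (10 * T + 15) this
        rw [show 10 * T + 13 + 2 = 10 * T + 15 from rfl]
        omega

end

/-! ## Loading the input of a simulated program -/

/-- Append the contents of the registers from `R 21` to `R 22 - 1` to the log, at the simulated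
addresses from `R 20` on. -/
def loadArr : Cmd :=
  .loop 21 22 (.blk [.load 10 21, .copy 11 20] ;; appendCmd ;; .blk [.add 20 20 2, .add 21 21 2])

/-- Load the input of the generator. -/
def genSetup : Cmd :=
  .blk [.const 15 0, .copy 7 6, .const 11 0, .copy 10 0] ;; appendCmd ;;
    .blk [.const 20 1, .copy 21 3, .copy 22 5] ;; loadArr

/-- Load the input of the test. -/
def testSetup : Cmd :=
  .blk [.copy 7 6, .const 11 0, .copy 10 0] ;; appendCmd ;;
    .blk [.const 11 1, .copy 10 14] ;; appendCmd ;;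
    .blk [.const 20 2, .copy 21 3, .copy 22 5] ;; loadArr ;;
    .blk [.copy 21 5, .add 22 5 14] ;; loadArr

/-- The contents of a memory after the array `ys` has been written at the address `o`. -/
def overlay (o : ℕ) (ys : List ℕ) (r : ℕ → ℕ) (a : ℕ) : ℕ :=
  if o ≤ a ∧ a < o + ys.length then ys.getD (a - o) 0 else r a

section

variable {T W : ℕ} {ω : Coins}

/-- The array lies below the start of the log, by `ha'`, so it is not disturbed by the pairs
appended while it is read. -/
theorem loadArr_spec (b : Bds T W) {σ : St} {l : List (ℕ × ℕ)} (hl : HasLog T σ l)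
    {ys : List ℕ} {o a : ℕ} (h20 : σ.v 20 = o) (h21 : σ.v 21 = a) (h22 : σ.v 22 = a + ys.length)
    (ha : 40 ≤ a) (ha' : a + ys.length ≤ σ.v 6) (ho : o + ys.length < W)
    (hys : ∀ i (h : i < ys.length), σ.m (a + i) = ys[i])
    (hcap : σ.v 6 + 2 * (l.length + ys.length) ≤ T) :
    WP 40 T W ω loadArr (10 * T + 2)
      (fun σ' => (∃ l', HasLog T σ' l' ∧ l'.length = l.length + ys.length ∧
          lookupVal l' = overlay o ys (lookupVal l)) ∧
        Pres [7, 10, 11, 20, 21] (σ.v 6) σ σ' ∧ σ'.fl = σ.fl ∧ σ'.v 20 = o + ys.length) σ := by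
  have hb := b.low
  have h2 := b.two
  have hlt := b.lt
  have hlen : ys.length * 10 ≤ 10 * T := by omega
  refine (WP.loop_count (n := 8) hb (by norm_num) (by norm_num) ys.length
    (fun k τ => (∃ l', HasLog T τ l' ∧ l'.length = l.length + k ∧
          lookupVal l' = overlay o (ys.take k) (lookupVal l)) ∧
        Pres [7, 10, 11, 20, 21] (σ.v 6) σ τ ∧ τ.fl = σ.fl ∧ τ.v 20 = o + k ∧ τ.v 21 = a + k)
    ?_ ?_ ?_).le (by omega)
  · rintro k hk τ ⟨⟨l', hl', hlen', hlv⟩, hp, hfl, e20, e21⟩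
    have p22 := hp.v 22 (by simp)
    have p6 := hp.v 6 (by simp)
    refine ⟨by omega, ?_⟩
    have hx : τ.m (a + k) = ys[k] := by rw [hp.m _ (by omega), hys]
    refine (WP.blk_seq (n := 4 + 2) hb h2 ?_ (WP.seq (append_spec b (l := l') ?_ ?_)
      fun τ' h => WP.blk hb h2 ?_ ?_)).le (by simp)
    · simp [okAll, Instr.ok, e21]; omega
    · exact hl'.congr (by simp [evAll, Instr.ev]) (by simp [evAll, Instr.ev])
        (by simp [evAll, Instr.ev]) (by simp [evAll, Instr.ev])
    · simp [evAll, Instr.ev]; omega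
    · obtain ⟨g1, g2, -⟩ := h
      have v20 := g2 20 (by simp)
      have v21 := g2 21 (by simp)
      have v2 := g2 2 (by simp)
      simp [evAll, Instr.ev, hl'.one] at v20 v21 v2
      simp [okAll, Instr.ok, Instr.ev, v20, v21, v2, e20, e21]
      omega
    · obtain ⟨g1, g2, g3, g4, g5⟩ := h
      have v20 := g2 20 (by simp)
      have v21 := g2 21 (by simp)
      have v2 := g2 2 (by simp)
      simp [evAll, Instr.ev, hl'.one] at v20 v21 v2
      refine ⟨⟨_, g1.congr ?_ ?_ ?_ ?_, ?_, ?_⟩, ⟨fun i hi => ?_, fun x hx => ?_, ?_⟩, ?_, ?_, ?_⟩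
      · simp [evAll, Instr.ev]
      · simp [evAll, Instr.ev]
      · simp [evAll, Instr.ev]
      · simp [evAll, Instr.ev]
      · simp [hlen']; omega
      · rw [lookupVal_concat, hlv]
        funext x
        simp [evAll, Instr.ev, e20, e21, hx, overlay, Function.update_apply]
        have hmin : min k ys.length = k := by omega
        have hmin' : min (k + 1) ys.length = k + 1 := by omega
        rw [hmin, hmin']
        by_cases hxk : x = o + k
        · subst hxk; simp [hk]
        · rw [if_neg hxk]
          by_cases hx1 : o ≤ x ∧ x < o + k
          · rw [if_pos hx1, if_pos (by omega)]
            simp [show x - o < k by omega, show x - o < k + 1 by omega]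
          · rw [if_neg hx1, if_neg (by omega)]
      · have := hp.v i hi
        simp at hi
        simp [evAll, Instr.ev, hi, g2, this]
      · have : τ'.m x = _ := g3 x (by simp [evAll, Instr.ev, p6]; exact hx)
        simp [evAll, Instr.ev] at this
        simp [evAll, Instr.ev, this, hp.m x hx]
      · simpa [evAll, Instr.ev, hp.out] using g5
      · simpa [evAll, Instr.ev, hfl] using g4
      · simp [evAll, Instr.ev, v20, v2, e20]; omega
      · simp [evAll, Instr.ev, v21, v2, e21]; omega
  · rintro τ ⟨⟨l', hl', hlen', hlv⟩, hp, hfl, e20, e21⟩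
    have p22 := hp.v 22 (by simp)
    exact ⟨by omega, ⟨l', hl', hlen', by simpa using hlv⟩, hp, hfl, e20⟩
  · refine ⟨⟨l, hl, by simp, ?_⟩, ⟨fun _ _ => rfl, fun _ _ => rfl, rfl⟩, rfl, by simp [h20],
      by simp [h21]⟩
    funext x
    simp [overlay]

theorem overlay_one (n : ℕ) (xs : List ℕ) (r : ℕ → ℕ) (hn : xs.length = n)
    (h0 : r 0 = n) (hr : ∀ a, a ≠ 0 → r a = 0) :
    overlay 1 xs r = fun i => (n :: xs).getD i 0 := by
  funext a
  rcases a with _ | a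
  · simp [overlay, h0]
  · simp only [overlay, List.getD_cons_succ, Nat.add_sub_cancel]
    split_ifs with h
    · rfl
    · rw [hr _ (by omega), List.getD_eq_default]; omega

theorem overlay_two (n k : ℕ) (xs ys : List ℕ) (r : ℕ → ℕ) (hn : xs.length = n)
    (hk : ys.length = k) (h0 : r 0 = n) (h1 : r 1 = k) (hr : ∀ a, 2 ≤ a → r a = 0) :
    overlay (2 + n) ys (overlay 2 xs r) = fun i => (n :: k :: (xs ++ ys)).getD i 0 := by
  funext a
  rcases a with _ | _ | a
  · simp [overlay, h0]
  · simp [overlay, h1]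
    omega
  · simp only [overlay, List.getD_cons_succ]
    by_cases h : a < n
    · rw [if_neg (by omega), if_pos (by omega), List.getD_append _ _ _ _ (by omega)]
      congr 1
    · rw [List.getD_append_right _ _ _ _ (by omega)]
      split_ifs with h1 h2
      · congr 1; omega
      · omega
      · rw [hr _ (by omega), List.getD_eq_default]; omega

theorem HasLog.nil {σ : St} (h2 : σ.v 2 = 1) (h6 : 40 ≤ σ.v 6) (h7 : σ.v 7 = σ.v 6)
    (hT : σ.v 6 ≤ T) : HasLog T σ [] :=
  ⟨h2, h6, by simpa using h7, by omega, by simp, by simp⟩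

/-- Resetting the end of the log to its start discards the previous simulation, so all draws share
the same memory. -/
theorem genSetup_spec (b : Bds T W) {s Xb Bd : ℕ} {xs : List ℕ} {σ : St}
    (he : Env s Xb Bd xs σ) (hXb : 40 ≤ Xb)
    (hcap : Xb + xs.length + Bd + 2 * (1 + xs.length) ≤ T) :
    WP 40 T W ω genSetup (10 * T + 20)
      (fun σ' => (∃ l, HasLog T σ' l ∧ l.length = 1 + xs.length ∧
          lookupVal l = fun i => (xs.length :: xs).getD i 0) ∧
        Pres [7, 10, 11, 15, 20, 21, 22] (Xb + xs.length + Bd) σ σ' ∧ σ'.fl = σ.fl ∧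
        σ'.v 15 = 0) σ := by
  have hb := b.low
  have h2 := b.two
  have hlt := b.lt
  set σ₁ := evAll ω [.const 15 0, .copy 7 6, .const 11 0, .copy 10 0] σ with hσ₁
  have k1 : Keeps [7, 10, 11, 15, 20, 21, 22] σ σ₁ := by
    refine ⟨fun i hi => ?_, rfl, rfl, rfl⟩
    simp at hi
    simp [hσ₁, evAll, Instr.ev, hi]
  have he1 := he.pres (k1.pres (lo := Xb + xs.length)) le_rfl (by simp)
  have hl1 : HasLog T σ₁ [] := HasLog.nil he1.v2 (by rw [he1.v6]; omega)
    (by simp [hσ₁, evAll, Instr.ev]) (by rw [he1.v6]; omega)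
  have e11 : σ₁.v 11 = 0 := by simp [hσ₁, evAll, Instr.ev]
  have e10 : σ₁.v 10 = xs.length := by simp [hσ₁, evAll, Instr.ev, he.v0]
  have e15 : σ₁.v 15 = 0 := by simp [hσ₁, evAll, Instr.ev]
  refine (WP.blk_seq (n := 10 * T + 16) hb h2 (by simp [okAll, Instr.ok]; omega)
    ((WP.seq (n := 4) (n' := 10 * T + 12) (append_spec b hl1 ?_) fun σ₂ h => ?_).le
    (by omega))).le (by simp; omega)
  · simp [he1.v6]; omega
  obtain ⟨g1, g2, g3, g4, g5⟩ := h
  rw [e11, e10] at g1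
  rw [he1.v6] at g3
  clear_value σ₁
  have p2 : Pres [7, 10, 11, 15, 20, 21, 22] (Xb + xs.length + Bd) σ σ₂ :=
    k1.pres.trans ⟨fun i hi => g2 i (by simp at hi; omega), g3, g5⟩
  have he2 := he.pres p2 (by omega) (by simp)
  refine (WP.blk_seq hb h2 (by simp [okAll, Instr.ok]; omega)
    ((loadArr_spec b (l := [(0, xs.length)]) (ys := xs) (o := 1) (a := Xb) ?_
      ?_ ?_ ?_ ?_ ?_ ?_ ?_ ?_).post fun σ₄ h4 => ?_)).le (by simp; omega)
  · exact g1.congr (by simp [evAll, Instr.ev]) (by simp [evAll, Instr.ev])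
        (by simp [evAll, Instr.ev]) (by simp [evAll, Instr.ev])
  · simp [evAll, Instr.ev]
  · simp [evAll, Instr.ev, he2.v3]
  · simp [evAll, Instr.ev, he2.v5]
  · exact hXb
  · simp [evAll, Instr.ev, he2.v6]
  · omega
  · intro i hi
    simpa [evAll, Instr.ev] using he2.arr i hi
  · simp [evAll, Instr.ev, he2.v6]; omega
  · obtain ⟨⟨l, hl, hlen, hlv⟩, hp, hfl, -⟩ := h4
    refine ⟨⟨l, hl, by simpa [add_comm] using hlen, ?_⟩, ?_, ?_, ?_⟩
    · rw [hlv]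
      refine overlay_one _ _ _ rfl (by simp [lookupVal]) fun a ha => by
        simp [lookupVal, Ne.symm ha]
    · refine p2.trans (Pres.trans (Keeps.pres (S := [7, 10, 11, 15, 20, 21, 22])
        ⟨fun i hi => ?_, by rfl, by rfl, by rfl⟩)
        (hp.mono (by simp) (by simp [evAll, Instr.ev, he2.v6])))
      simp at hi
      simp [evAll, Instr.ev, hi]
    · simpa [evAll, Instr.ev, g4, k1.fl] using hfl
    · have := hp.v 15 (by simp)
      simpa [evAll, Instr.ev, g2, e15] using this

/-- The log of the generator is overwritten here; the candidate survives because it was copied below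
the log. -/
theorem testSetup_spec (b : Bds T W) {s Xb Bd : ℕ} {xs w : List ℕ} {σ : St}
    (he : Env s Xb Bd xs σ) (hXb : 40 ≤ Xb) (hw : w.length ≤ Bd) (h14 : σ.v 14 = w.length)
    (harr : ∀ i (h : i < w.length), σ.m (Xb + xs.length + i) = w[i])
    (hcap : Xb + xs.length + Bd + 2 * (2 + xs.length + Bd) ≤ T) :
    WP 40 T W ω testSetup (20 * T + 30)
      (fun σ' => (∃ l, HasLog T σ' l ∧ l.length = 2 + xs.length + w.length ∧
          lookupVal l = fun i => (xs.length :: w.length :: (xs ++ w)).getD i 0) ∧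
        Pres [7, 10, 11, 20, 21, 22] (Xb + xs.length + Bd) σ σ' ∧ σ'.fl = σ.fl) σ := by
  have hb := b.low
  have h2 := b.two
  have hlt := b.lt
  set σ₁ := evAll ω [.copy 7 6, .const 11 0, .copy 10 0] σ with hσ₁
  have k1 : Keeps [7, 10, 11, 20, 21, 22] σ σ₁ := by
    refine ⟨fun i hi => ?_, rfl, rfl, rfl⟩
    simp at hi
    simp [hσ₁, evAll, Instr.ev, hi]
  have he1 := he.pres (k1.pres (lo := Xb + xs.length)) le_rfl (by simp)
  have hl1 : HasLog T σ₁ [] := HasLog.nil he1.v2 (by rw [he1.v6]; omega)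
    (by simp [hσ₁, evAll, Instr.ev]) (by rw [he1.v6]; omega)
  have e11 : σ₁.v 11 = 0 := by simp [hσ₁, evAll, Instr.ev]
  have e10 : σ₁.v 10 = xs.length := by simp [hσ₁, evAll, Instr.ev, he.v0]
  refine (WP.blk_seq (n := 20 * T + 27) hb h2 (by simp [okAll, Instr.ok]; omega)
    ((WP.seq (n := 4) (n' := 20 * T + 23) (append_spec b hl1 ?_) fun σ₂ h => ?_).le
    (by omega))).le (by simp; omega)
  · simp [he1.v6]; omega
  obtain ⟨g1, g2, g3, g4, g5⟩ := h
  rw [e11, e10] at g1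
  rw [he1.v6] at g3
  clear_value σ₁
  have p2 : Pres [7, 10, 11, 20, 21, 22] (Xb + xs.length + Bd) σ σ₂ :=
    k1.pres.trans ⟨fun i hi => g2 i (by simp at hi; omega), g3, g5⟩
  have f2 : σ₂.fl = σ.fl := g4.trans k1.fl
  clear g2 g3 g4 g5 k1 he1 hl1 e11 e10
  set σ₃ := evAll ω [.const 11 1, .copy 10 14] σ₂ with hσ₃
  have p3 : Pres [7, 10, 11, 20, 21, 22] (Xb + xs.length + Bd) σ σ₃ := by
    refine p2.trans ⟨fun i hi => ?_, fun _ _ => rfl, rfl⟩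
    simp at hi
    simp [hσ₃, evAll, Instr.ev, hi]
  have f3 : σ₃.fl = σ.fl := f2
  have g1' : HasLog T σ₃ [(0, xs.length)] := g1.congr (by simp [hσ₃, evAll, Instr.ev])
    (by simp [hσ₃, evAll, Instr.ev]) (by simp [hσ₃, evAll, Instr.ev]) fun _ _ => rfl
  have e11 : σ₃.v 11 = 1 := by simp [hσ₃, evAll, Instr.ev]
  have e10 : σ₃.v 10 = w.length := by
    simp [hσ₃, evAll, Instr.ev, p2.v 14 (by simp), h14]
  have he3 := he.pres p3 (by omega) (by simp)
  refine (WP.blk_seq (n := 20 * T + 21) hb h2 (by simp [okAll, Instr.ok]; omega)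
    ((WP.seq (n := 4) (n' := 20 * T + 17) (append_spec b g1' ?_) fun σ₄ h => ?_).le
    (by omega))).le (by simp; omega)
  · simp [he3.v6]; omega
  obtain ⟨g1, g2, g3, g4, g5⟩ := h
  rw [e11, e10] at g1
  rw [he3.v6] at g3
  clear_value σ₃
  have p4 : Pres [7, 10, 11, 20, 21, 22] (Xb + xs.length + Bd) σ σ₄ :=
    p3.trans ⟨fun i hi => g2 i (by simp at hi; omega), g3, g5⟩
  have f4 : σ₄.fl = σ.fl := g4.trans f3
  have he4 := he.pres p4 (by omega) (by simp)
  set σ₅ := evAll ω [.const 20 2, .copy 21 3, .copy 22 5] σ₄ with hσ₅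
  have p5 : Pres [7, 10, 11, 20, 21, 22] (Xb + xs.length + Bd) σ σ₅ := by
    refine p4.trans ⟨fun i hi => ?_, fun _ _ => rfl, rfl⟩
    simp at hi
    simp [hσ₅, evAll, Instr.ev, hi]
  have f5 : σ₅.fl = σ.fl := f4
  have he5 := he.pres p5 (by omega) (by simp)
  have l5 : HasLog T σ₅ ([(0, xs.length)] ++ [(1, w.length)]) :=
    g1.congr (by simp [hσ₅, evAll, Instr.ev])
    (by simp [hσ₅, evAll, Instr.ev]) (by simp [hσ₅, evAll, Instr.ev]) fun _ _ => rfl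
  refine (WP.blk_seq (n := 20 * T + 14) hb h2 (by simp [okAll, Instr.ok]; omega)
    ((WP.seq (n' := 10 * T + 6) (loadArr_spec b l5 (ys := xs) (o := 2) (a := Xb) ?_
      ?_ ?_ ?_ ?_ ?_ ?_ ?_) fun σ₆ h6 => ?_).le (by omega))).le (by simp; omega)
  · simp [hσ₅, evAll, Instr.ev]
  · simp [hσ₅, evAll, Instr.ev, he4.v3]
  · simp [hσ₅, evAll, Instr.ev, he4.v5]
  · exact hXb
  · simp [he5.v6]
  · omega
  · intro i hi
    exact he5.arr i hi
  · simp [he5.v6]; omega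
  clear_value σ₅
  obtain ⟨⟨l, hl, hlen, hlv⟩, hp, hfl, e20⟩ := h6
  rw [he5.v6] at hp
  have p6 : Pres [7, 10, 11, 20, 21, 22] (Xb + xs.length + Bd) σ σ₆ :=
    p5.trans (hp.mono (by simp) le_rfl)
  set σ₇ := evAll ω [.copy 21 5, .add 22 5 14] σ₆ with hσ₇
  have he6 := he.pres p6 (by omega) (by simp)
  have p7 : Pres [7, 10, 11, 20, 21, 22] (Xb + xs.length + Bd) σ σ₇ := by
    refine p6.trans ⟨fun i hi => ?_, fun _ _ => rfl, rfl⟩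
    simp at hi
    simp [hσ₇, evAll, Instr.ev, hi]
  have he7 := he.pres p7 (by omega) (by simp)
  have l7 : HasLog T σ₇ l := hl.congr (by simp [hσ₇, evAll, Instr.ev])
    (by simp [hσ₇, evAll, Instr.ev]) (by simp [hσ₇, evAll, Instr.ev]) fun _ _ => rfl
  have e14 := p6.v 14 (by simp)
  simp at hlen
  refine (WP.blk_seq hb h2 ?_ ((loadArr_spec b l7 (ys := w) (o := 2 + xs.length)
    (a := Xb + xs.length) ?_ ?_ ?_ ?_ ?_ ?_ ?_ ?_).post fun σ₈ h8 => ?_)).le (by simp; omega)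
  · simp [okAll, Instr.ok, Instr.ev, he6.v5, e14, h14]; omega
  · simp [hσ₇, evAll, Instr.ev, e20]
  · simp [hσ₇, evAll, Instr.ev, he6.v5]
  · simp [hσ₇, evAll, Instr.ev, he6.v5, e14, h14]
  · omega
  · simp [he7.v6, hw]
  · omega
  · intro i hi
    rw [p7.m _ (by omega), harr i hi]
  · simp [he7.v6]; omega
  obtain ⟨⟨l', hl', hlen', hlv'⟩, hp', hfl', -⟩ := h8
  rw [he7.v6] at hp'
  refine ⟨⟨l', hl', by omega, ?_⟩, p7.trans (hp'.mono (by simp) le_rfl), ?_⟩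
  · rw [hlv', hlv]
    refine overlay_two _ _ _ _ _ rfl rfl (by simp [lookupVal]) (by simp [lookupVal]) fun a ha => ?_
    simp [lookupVal]
    rw [if_neg (by omega), if_neg (by omega)]
  · rw [hfl', ← f5, ← hfl]; rfl

end

/-! ## One draw of the enumeration algorithm -/

/-- The words output by a program that halts. -/
noncomputable def finalWords (P : Program) (ω : Coins) (inp : List ℕ) : List (List ℕ) :=
  open Classical in if h : ∃ c, HaltsAt P ω inp c then h.choose.words else []

theorem HaltsAt.finalWords {P : Program} {ω : Coins} {inp : List ℕ} {c : Cfg}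
    (h : HaltsAt P ω inp c) : finalWords P ω inp = c.words := by
  have hex : ∃ c, HaltsAt P ω inp c := ⟨c, h⟩
  rw [EnumRAM.finalWords, dif_pos hex, hex.choose_spec.unique h]

/-- The solution found by the generator if it has output the words `ws`. -/
noncomputable def drawOf (s Bd : ℕ) (Acc : List ℕ → Prop) (ws : List (List ℕ)) :
    Option (List ℕ) :=
  match ws with
  | [w] => open Classical in
      if w.length ≤ Bd ∧ (∀ a ∈ w, a < s) ∧ Acc w then some w else none
  | _ => none

/-- The test uses no coins, so a draw uses exactly those of the generator stage. -/
theorem flips_run_eq_zero {P : Program} (hP : ∀ i, Instr.flip i ∉ P) (ω : Coins) (inp : List ℕ)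
    (t : ℕ) : (run P ω inp t).flips = 0 := by
  induction t with
  | zero => simp [run, init]
  | succ t ih =>
    rw [run_succ, step]
    rcases hI : P[(run P ω inp t).pc]? with _ | I
    · exact ih
    have := List.mem_of_getElem? hI
    cases I <;> simp [Instr.exec, Instr.usedCoins, ih]
    exact hP _ this

/-- The algorithm runs the generator `Pg` and the test `Pt` on the instance `xs`, the candidates
to be accepted being those satisfying `Acc`, within the bounds. -/
structure Setting (s : ℕ) (Pg Pt : Program) (xs : List ℕ) (Acc : List ℕ → Prop)
    (Xb Bd B Ts T W : ℕ) : Prop where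
  bds : Bds T W
  base : 40 ≤ Xb
  sep : B + T < W
  code : 2 * (s + 1) ^ Bd ≤ W
  genW : ∀ I ∈ Pg, ∀ a ∈ I.consts, a < W
  genLen : Pg.length < W
  testW : ∀ I ∈ Pt, ∀ a ∈ I.consts, a < W
  testLen : Pt.length < W
  testFlip : ∀ i, Instr.flip i ∉ Pt
  cap : Xb + xs.length + Bd + 2 * (2 + xs.length + Bd + Ts + Bd) ≤ T
  gen : ∀ ω, ∃ t, t ≤ Bd ∧ StopsAt Pg ω (xs.length :: xs) t ∧
    ∀ k, k ≤ t → ∀ a, (run Pg ω (xs.length :: xs) k).reg a < B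
  test : ∀ (ω : Coins) (w : List ℕ), w.length ≤ Bd → (∀ a ∈ w, a < s) →
    ∃ t, t ≤ Ts ∧ StopsAt Pt ω (xs.length :: w.length :: (xs ++ w)) t ∧
    (∀ k, k ≤ t → ∀ a, (run Pt ω (xs.length :: w.length :: (xs ++ w)) k).reg a < B) ∧
    ((run Pt ω (xs.length :: w.length :: (xs ++ w)) t).reg 0 = 1 ↔ Acc w)

/-- Run the generator. -/
def genStage (Pg : Program) : Cmd :=
  genSetup ;; simProg genOut Pg ;; .loop 9 4 (.blk [.flip 10, .add 9 9 2])

/-- Run the test on the candidate. -/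
def testStage (Pt : Program) : Cmd :=
  testSetup ;; simProg (fun _ _ => .blk []) Pt ;; lookAt 0 ;;
    .ite 10 2 (.blk []) (.ite 2 10 (.blk []) (.blk [.const 26 1]))

/-- Run the generator, and the test on its output. -/
def drawCmd (Pg Pt : Program) : Cmd :=
  genStage Pg ;; .blk [.const 26 0, .add 23 2 2] ;;
    .ite 1 15 (.ite 15 23 (testStage Pt) (.blk [])) (.blk [])

/-- The low registers modified by a draw. -/
abbrev drawRegs : List ℕ := [7, 8, 9, 10, 11, 12, 13, 14, 15, 16, 19, 20, 21, 22, 23, 24, 26]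

/-- The low registers modified by the test. -/
abbrev testRegs : List ℕ := [7, 8, 9, 10, 11, 12, 13, 19, 20, 21, 22, 26]

theorem Cand.congr {s Ob Bd : ℕ} {ws : List (List ℕ)} {σ σ' : St} (h : Cand s Ob Bd ws σ)
    (h14 : σ'.v 14 = σ.v 14) (h15 : σ'.v 15 = σ.v 15) (h16 : σ'.v 16 = σ.v 16)
    (hm : ∀ a, a < Ob + Bd → σ'.m a = σ.m a) : Cand s Ob Bd ws σ' := by
  rcases h with ⟨h, h'⟩ | ⟨w, a1, a2, a3, a4, a5, a6, a7⟩ | ⟨h, h'⟩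
  · exact .inl ⟨h, h15.trans h'⟩
  · exact .inr (.inl ⟨w, a1, h15.trans a2, a3, a4, h14.trans a5, h16.trans a6, fun i hi => by
      rw [hm _ (by omega), a7]⟩)
  · exact .inr (.inr ⟨h15.trans h, h'⟩)

section

variable {s : ℕ} {Pg Pt : Program} {xs : List ℕ} {Acc : List ℕ → Prop} {Xb Bd B Ts T W : ℕ}
  {ω : Coins}

/-- A bound on the number of steps of `genStage`. -/
def genSteps (Pg : Program) (T : ℕ) : ℕ :=
  16 * T + 30 + T * (3 * Pg.length + 40 * T + 62 + T * (10 * T + 15))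

/-- The generator runs for at most `Bd` steps, hence flips at most `Bd` coins; the last loop flips
dummy coins up to exactly `Bd`. The result of the draw therefore depends on a block of coins whose
position is known in advance. -/
theorem genStage_spec (S : Setting s Pg Pt xs Acc Xb Bd B Ts T W) {σ : St}
    (he : Env s Xb Bd xs σ) :
    WP 40 T W ω (genStage Pg) (genSteps Pg T)
      (fun σ' => Pres drawRegs (Xb + xs.length) σ σ' ∧ σ'.fl = σ.fl + Bd ∧
        Cand s (Xb + xs.length) Bd
          (finalWords Pg (fun k => ω (σ.fl + k)) (xs.length :: xs)) σ') σ := by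
  have b := S.bds
  have hb := b.low
  have h2 := b.two
  have hlt := b.lt
  have hcap := S.cap
  have hsep := S.sep
  have hXb := S.base
  obtain ⟨ts, htB, hts, hreg⟩ := S.gen fun k => ω (σ.fl + k)
  rw [hts.haltsAt.finalWords]
  refine (WP.seq (n := 10 * T + 20) (genSetup_spec b he hXb (by omega)) fun σ₁ h₁ =>
    WP.seq (n' := Bd * 4 + 2) (R := fun τ => Pres drawRegs (Xb + xs.length) σ τ ∧
      τ.v 9 = (run Pg (fun k => ω (σ.fl + k)) (xs.length :: xs) ts).flips ∧
      τ.fl = σ.fl + τ.v 9 ∧ Cand s (Xb + xs.length) Bd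
        (run Pg (fun k => ω (σ.fl + k)) (xs.length :: xs) ts).words τ)
      ((simProg_spec (ω := ω) (T := T) (B := B) (Lb := Xb + xs.length + Bd) (L₀ := 1 + xs.length)
        (f₀ := σ.fl) (nOut := 20 * T + 30 + T * (10 * T + 15))
        (J := fun ws τ => Pres drawRegs (Xb + xs.length) σ τ ∧ τ.v 19 = Pg.length ∧
          Cand s (Xb + xs.length) Bd ws τ) b ?_ S.genW S.genLen (fun ws τ h => h.2.1) ?_
        (by omega) hts hreg ?_ ?_ h₁.1.choose_spec.1 h₁.1.choose_spec.2.1.le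
        h₁.1.choose_spec.2.2 ?_ h₁.2.2.1 ?_).post fun τ h => ?_) fun τ h => ?_).le ?_
  · intro ws τ τ' ⟨hp, h19, hc⟩ hv hm hout
    have h6 := (he.pres hp le_rfl (by simp)).v6
    refine ⟨hp.trans ⟨fun i hi => hv i ?_, fun a ha => hm a (by omega), hout⟩, ?_, ?_⟩
    · simp at hi ⊢; omega
    · rw [hv 19 (by simp), h19]
    · exact hc.congr (hv 14 (by simp)) (hv 15 (by simp)) (hv 16 (by simp))
        fun a ha => hm a (by omega)
  · intro i j hij τ l ws hl h6 ⟨hp, h19, hc⟩ hB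
    have hcs := S.genW _ hij
    simp only [Instr.consts, List.mem_cons, List.not_mem_nil, or_false, forall_eq_or_imp,
      forall_eq] at hcs
    refine (genOut_spec b hl (he.pres hp le_rfl (by simp)) hXb hB hsep S.code hcs.1 hcs.2
      hc).post fun τ' ⟨hf, hc'⟩ => ⟨⟨hp.trans (hf.pres.mono (by simp) le_rfl),
        (hf.v 19 (by simp)).trans h19, hc'⟩, ?_, hf.v 6 (by simp), hf.fl, hf.v 8 (by simp),
        hf.v 9 (by simp)⟩
    exact hl.congr (hf.v 2 (by simp)) (hf.v 6 (by simp)) (hf.v 7 (by simp)) fun a ha =>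
      hf.m a (by omega)
  · omega
  · omega
  · rw [h₁.2.1.v 6 (by simp), he.v6]
  · obtain ⟨-, hp, -, h15⟩ := h₁
    refine ⟨(hp.mono (by simp) (by omega)).trans ⟨fun i hi => ?_, fun _ _ => by rfl, by rfl⟩, ?_,
      .inl ⟨rfl, ?_⟩⟩
    · simp at hi
      simp [evAll, Instr.ev, hi]
    · simp [evAll, Instr.ev]
    · simpa [evAll, Instr.ev] using h15
  · exact ⟨h.inv.1, h.coins, h.coins.symm ▸ h.fl, h.inv.2.2⟩
  · obtain ⟨hp, h9, hfl, hc⟩ := h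
    have hle : τ.v 9 ≤ Bd := h9 ▸ (flips_run_le _ _ _ _).trans htB
    refine (WP.loop_count (n := 2) hb (by norm_num) (by norm_num) (Bd - τ.v 9)
      (fun k τ' => Pres drawRegs (Xb + xs.length) σ τ' ∧ τ'.v 9 = τ.v 9 + k ∧
        τ'.fl = σ.fl + τ'.v 9 ∧ Cand s (Xb + xs.length) Bd
        (run Pg (fun k => ω (σ.fl + k)) (xs.length :: xs) ts).words τ') ?_ ?_
      ⟨hp, rfl, hfl, hc⟩).le (by omega)
    · rintro k hk τ' ⟨hp', h9', hfl', hc'⟩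
      have he' := he.pres hp' le_rfl (by simp)
      refine ⟨by rw [he'.v4]; omega, WP.blk hb h2 ?_ ⟨hp'.trans ⟨fun i hi => ?_,
        fun _ _ => rfl, rfl⟩, ?_, ?_, hc'.congr ?_ ?_ ?_ fun _ _ => rfl⟩⟩
      · simp [okAll, Instr.ok, Instr.ev, he'.v2]; omega
      · simp at hi
        simp [evAll, Instr.ev, hi]
      · simp [evAll, Instr.ev, he'.v2, h9']; omega
      · simp [evAll, Instr.ev, he'.v2, hfl']; omega
      · simp [evAll, Instr.ev]
      · simp [evAll, Instr.ev]
      · simp [evAll, Instr.ev]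
    · rintro τ' ⟨hp', h9', hfl', hc'⟩
      have he' := he.pres hp' le_rfl (by simp)
      exact ⟨by rw [he'.v4]; omega, hp', by omega, hc'⟩
  · have : ts ≤ T := by omega
    have := Nat.mul_le_mul_right (3 * Pg.length + 40 * T + 62 + T * (10 * T + 15)) this
    rw [show 3 * Pg.length + 20 * T + 32 + (20 * T + 30 + T * (10 * T + 15)) =
      3 * Pg.length + 40 * T + 62 + T * (10 * T + 15) by ring, genSteps]
    omega

/-- A bound on the number of steps of `testStage`. -/
def testSteps (Pt : Program) (T : ℕ) : ℕ := 30 * T + 60 + T * (3 * Pt.length + 20 * T + 40)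

/-- Memory is preserved up to the start of the log, and registers 14 and 16 are not in `testRegs`:
the candidate, its length and its code survive the test. -/
theorem testStage_spec (S : Setting s Pg Pt xs Acc Xb Bd B Ts T W) {σ : St}
    (he : Env s Xb Bd xs σ) {w : List ℕ} (hw : w.length ≤ Bd) (hws : ∀ a ∈ w, a < s)
    (h14 : σ.v 14 = w.length) (harr : ∀ i (h : i < w.length), σ.m (Xb + xs.length + i) = w[i])
    (h26 : σ.v 26 = 0) :
    WP 40 T W ω (testStage Pt) (testSteps Pt T)
      (fun σ' => Pres testRegs (Xb + xs.length + Bd) σ σ' ∧ σ'.fl = σ.fl ∧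
        ((Acc w ∧ σ'.v 26 = 1) ∨ (¬ Acc w ∧ σ'.v 26 = 0))) σ := by
  have b := S.bds
  have hb := b.low
  have h2 := b.two
  have hlt := b.lt
  have hcap := S.cap
  have hsep := S.sep
  have hXb := S.base
  obtain ⟨ts, htB, hts, hreg, hacc⟩ := S.test (fun k => ω (σ.fl + k)) w hw hws
  set c := run Pt (fun k => ω (σ.fl + k)) (xs.length :: w.length :: (xs ++ w)) ts with hc
  refine (WP.seq (n := 20 * T + 30) (testSetup_spec b he hXb hw h14 harr (by omega)) fun σ₁ h₁ =>
    WP.seq (n' := 10 * T + 5 + 5) (R := fun τ => Pres testRegs (Xb + xs.length + Bd) σ τ ∧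
      τ.v 26 = 0 ∧ τ.fl = σ.fl ∧ ∃ l, HasLog T τ l ∧ lookupVal l = c.reg)
      ((simProg_spec (ω := ω) (T := T) (B := B) (Lb := Xb + xs.length + Bd)
        (L₀ := 2 + xs.length + w.length)
        (f₀ := σ.fl) (nOut := 0)
        (J := fun ws τ => Pres testRegs (Xb + xs.length + Bd) σ τ ∧ τ.v 19 = Pt.length ∧
          τ.v 26 = 0) b ?_ S.testW S.testLen (fun ws τ h => h.2.1) ?_
        (by omega) hts hreg ?_ ?_ h₁.1.choose_spec.1 h₁.1.choose_spec.2.1.le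
        h₁.1.choose_spec.2.2 ?_ h₁.2.2 ?_).post fun τ h => ?_) fun τ h => ?_).le ?_
  · intro ws τ τ' ⟨hp, h19, h26⟩ hv hm hout
    have h6 := (he.pres hp (by omega) (by simp)).v6
    refine ⟨hp.trans ⟨fun i hi => hv i ?_, fun a ha => hm a (by omega), hout⟩, ?_, ?_⟩
    · simp at hi ⊢; omega
    · rw [hv 19 (by simp), h19]
    · rw [hv 26 (by simp), h26]
  · intro i j hij τ l ws hl h6 hJ hB
    exact WP.skip hb h2 ⟨hJ, hl, rfl, rfl, rfl, rfl⟩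
  · omega
  · omega
  · rw [h₁.2.1.v 6 (by simp), he.v6]
  · obtain ⟨-, hp, -⟩ := h₁
    refine ⟨(hp.mono (by simp) le_rfl).trans ⟨fun i hi => ?_, fun _ _ => by rfl, by rfl⟩, ?_, ?_⟩
    · simp at hi
      simp [evAll, Instr.ev, hi]
    · simp [evAll, Instr.ev]
    · simpa [evAll, Instr.ev, h26] using hp.v 26 (by simp)
  · obtain ⟨l, hl, -, hlv⟩ := h.log
    refine ⟨h.inv.1, h.inv.2.2, ?_, l, hl, hlv⟩
    rw [h.fl, flips_run_eq_zero S.testFlip, Nat.add_zero]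
  · obtain ⟨hp, h26, hfl, l, hl, hlv⟩ := h
    refine lookAt_spec b hl (by omega) fun τ₁ k1 _ e10 => ?_
    have hp1 : Pres testRegs (Xb + xs.length + Bd) σ τ₁ :=
      hp.trans (k1.pres.mono (by simp) le_rfl)
    have e2 := (he.pres hp1 (by omega) (by simp)).v2
    have e26 := (k1.v 26 (by simp)).trans h26
    have efl := k1.fl.trans hfl
    rw [hlv] at e10
    refine WP.ite (n := 3) hb (by norm_num) (by norm_num) (fun hlt => ?_) (fun hle => ?_)
    · exact WP.skip hb h2 ⟨hp1, efl, .inr ⟨by rw [← hacc]; omega, e26⟩⟩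
    refine WP.ite (n := 1) hb (by norm_num) (by norm_num) (fun hlt => ?_) (fun hle' => ?_)
    · exact WP.skip hb h2 ⟨hp1, efl, .inr ⟨by rw [← hacc]; omega, e26⟩⟩
    · refine WP.blk hb h2 (by simp [okAll, Instr.ok]; omega) ⟨hp1.trans ⟨fun i hi => ?_,
        fun _ _ => rfl, rfl⟩, efl, .inl ⟨by rw [← hacc]; omega, ?_⟩⟩
      · simp at hi
        simp [evAll, Instr.ev, hi]
      · simp [evAll, Instr.ev]
  · have : ts ≤ T := by omega
    have := Nat.mul_le_mul_right (3 * Pt.length + 20 * T + 32) this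
    have : T * (3 * Pt.length + 20 * T + 32) ≤ T * (3 * Pt.length + 20 * T + 40) :=
      Nat.mul_le_mul_left _ (by omega)
    simp only [testSteps, Nat.add_zero]
    omega

theorem drawOf_eq_some {ws : List (List ℕ)} {w : List ℕ} (h : drawOf s Bd Acc ws = some w) :
    ws = [w] ∧ w.length ≤ Bd ∧ (∀ a ∈ w, a < s) ∧ Acc w := by
  unfold drawOf at h
  split at h
  · split_ifs at h with hc
    cases h
    exact ⟨rfl, hc⟩
  · cases h

theorem drawOf_eq_none {ws : List (List ℕ)}
    (h : ¬ ∃ w, ws = [w] ∧ w.length ≤ Bd ∧ ∀ a ∈ w, a < s) : drawOf s Bd Acc ws = none := by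
  by_contra hne
  obtain ⟨w, hw⟩ := Option.ne_none_iff_exists'.mp hne
  obtain ⟨h1, h2, h3, -⟩ := drawOf_eq_some hw
  exact h ⟨w, h1, h2, h3⟩

/-- The two comparisons `0 < R 15` and `R 15 < 2` select status 1, so only a single, short word with
legal letters reaches the test. This is what makes the bounds of `Setting.test` applicable even when
the generator misbehaves. -/
theorem drawCmd_spec (S : Setting s Pg Pt xs Acc Xb Bd B Ts T W) {σ : St}
    (he : Env s Xb Bd xs σ) :
    WP 40 T W ω (drawCmd Pg Pt) (genSteps Pg T + (testSteps Pt T + 6))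
      (fun σ' => Pres drawRegs (Xb + xs.length) σ σ' ∧ σ'.fl = σ.fl + Bd ∧
        ((∃ w, drawOf s Bd Acc (finalWords Pg (fun k => ω (σ.fl + k)) (xs.length :: xs)) = some w ∧
          w.length ≤ Bd ∧ σ'.v 26 = 1 ∧ σ'.v 14 = w.length ∧ σ'.v 16 = wordCode s w ∧
          ∀ i (h : i < w.length), σ'.m (Xb + xs.length + i) = w[i]) ∨
        (drawOf s Bd Acc (finalWords Pg (fun k => ω (σ.fl + k)) (xs.length :: xs)) = none ∧
          σ'.v 26 = 0))) σ := by
  have b := S.bds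
  have hb := b.low
  have h2 := b.two
  have hlt := b.lt
  refine WP.seq (genStage_spec S he) fun σ₁ ⟨hp, hfl, hc⟩ => ?_
  set ws := finalWords Pg (fun k => ω (σ.fl + k)) (xs.length :: xs)
  have he1 := he.pres hp le_rfl (by simp)
  set σ₂ := evAll ω [.const 26 0, .add 23 2 2] σ₁ with hσ₂
  have hp2 : Pres drawRegs (Xb + xs.length) σ σ₂ := by
    refine hp.trans ⟨fun i hi => ?_, fun _ _ => rfl, rfl⟩
    simp at hi
    simp [hσ₂, evAll, Instr.ev, hi]
  have he2 := he.pres hp2 le_rfl (by simp)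
  have hfl2 : σ₂.fl = σ.fl + Bd := hfl
  have hc2 : Cand s (Xb + xs.length) Bd ws σ₂ :=
    hc.congr (by simp [hσ₂, evAll, Instr.ev]) (by simp [hσ₂, evAll, Instr.ev])
      (by simp [hσ₂, evAll, Instr.ev]) fun _ _ => rfl
  have e26 : σ₂.v 26 = 0 := by simp [hσ₂, evAll, Instr.ev]
  have e23 : σ₂.v 23 = 2 := by simp [hσ₂, evAll, Instr.ev, he1.v2]
  refine (WP.blk_seq (n := testSteps Pt T + 4) hb h2 ?_ ?_).le (by simp; omega)
  · simp [okAll, Instr.ok, Instr.ev, he1.v2]; omega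
  rw [← hσ₂]
  clear_value σ₂
  have hv1 := he2.v1
  have none_of : σ₂.v 15 ≠ 1 → drawOf s Bd Acc ws = none := by
    intro h15
    rcases hc2 with ⟨h, h'⟩ | ⟨w, -, h, -⟩ | ⟨-, hne, h⟩
    · rw [h]; rfl
    · exact absurd h h15
    · exact drawOf_eq_none h
  refine WP.ite (n := testSteps Pt T + 2) hb (by norm_num) (by norm_num) (fun hlt => ?_)
    (fun hle => ?_)
  · refine WP.ite (n := testSteps Pt T) hb (by norm_num) (by norm_num) (fun hlt => ?_)
      (fun hle => ?_)
    · rcases hc2 with ⟨h, h'⟩ | ⟨w, hw, h15, hlen, hlet, h14, h16, harr⟩ | ⟨h, -⟩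
      · omega
      · refine (testStage_spec S he2 hlen hlet h14 harr e26).post fun σ' ⟨hp', hfl', h⟩ =>
          ⟨hp2.trans (hp'.mono (by simp) (by omega)), hfl'.trans hfl2, ?_⟩
        rcases h with ⟨hacc, h26⟩ | ⟨hacc, h26⟩
        · refine .inl ⟨w, ?_, hlen, h26, (hp'.v 14 (by simp)).trans h14,
            (hp'.v 16 (by simp)).trans h16, fun i hi => ?_⟩
          · rw [hw, drawOf, if_pos ⟨hlen, hlet, hacc⟩]
          · rw [hp'.m _ (by omega), harr]
        · refine .inr ⟨?_, h26⟩
          rw [hw, drawOf, if_neg fun h => hacc h.2.2]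
      · omega
    · exact WP.skip hb h2 ⟨hp2, hfl2, .inr ⟨none_of (by omega), e26⟩⟩
  · exact WP.skip hb h2 ⟨hp2, hfl2, .inr ⟨none_of (by omega), e26⟩⟩

/-! ## One iteration of the enumeration algorithm -/

/-- Output an accepted candidate, and update the reference solution and the budget. -/
def updateCmd : Cmd :=
  .ite 1 26
    (.blk [.add 21 5 14, .sub 21 21 2, .output 5 21] ;;
      .ite 1 17
        (.ite 16 17 (.blk []) (.ite 17 16 (.blk []) (.blk [.sub 18 18 2])))
        (.blk [.copy 17 16, .copy 18 4]))
    (.ite 1 17 (.blk []) (.blk [.sub 18 18 2]))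

/-- The body of the main loop. -/
def bodyCmd (Pg Pt : Program) : Cmd := drawCmd Pg Pt ;; updateCmd

/-- The reference solution and the remaining budget after the outcome `d` of a draw, the initial
budget being `K`. -/
def nextState {α : Type*} [DecidableEq α] (K : ℕ) : Option α × ℕ → Option α → Option α × ℕ
  | (none, g), none => (none, g - 1)
  | (none, _), some y => (some y, K)
  | (some y, g), none => (some y, g)
  | (some y, g), some z => if z = y then (some y, g - 1) else (some y, g)

/-- The state of the machine between two iterations. -/
structure Between (s Xb Bd : ℕ) (xs : List ℕ) (q : Option (List ℕ) × ℕ) (σ : St) : Prop where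
  env : Env s Xb Bd xs σ
  ref : σ.v 17 = q.1.elim 0 (wordCode s)
  lets : ∀ y, q.1 = some y → ∀ a ∈ y, a < s
  budget : σ.v 18 = q.2

/-- A bound on the number of steps of one iteration. -/
def bodySteps (Pg Pt : Program) (T : ℕ) : ℕ := genSteps Pg T + testSteps Pt T + 18

/-- The candidate and the reference are compared through their codes; `wordCode_injOn` applies since
both have legal letters. Storing one code instead of a word keeps the comparison at two
instructions. -/
theorem bodyCmd_spec (S : Setting s Pg Pt xs Acc Xb Bd B Ts T W) {σ : St}
    {q : Option (List ℕ) × ℕ} (hq : Between s Xb Bd xs q σ) {d : Option (List ℕ)}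
    (hd : d = drawOf s Bd Acc (finalWords Pg (fun k => ω (σ.fl + k)) (xs.length :: xs))) :
    WP 40 T W ω (bodyCmd Pg Pt) (bodySteps Pg Pt T)
      (fun σ' => Between s Xb Bd xs (nextState Bd q d) σ' ∧ σ'.fl = σ.fl + Bd ∧
        σ'.out = σ.out ++ d.toList) σ := by
  have b := S.bds
  have hb := b.low
  have h2 := b.two
  have hlt := b.lt
  have hcap := S.cap
  have hXb := S.base
  have he := hq.env
  refine (WP.seq (n' := 12) (drawCmd_spec S he) fun σ₁ ⟨hp, hfl, hc⟩ => ?_).le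
    (by rw [bodySteps]; omega)
  rw [← hd] at hc
  have he1 := he.pres hp le_rfl (by simp)
  have e17 := (hp.v 17 (by simp)).trans hq.ref
  have e18 := (hp.v 18 (by simp)).trans hq.budget
  have hv1 := he1.v1
  obtain ⟨Y, g⟩ := q
  refine WP.ite (n := 10) hb (by norm_num) (by norm_num) (fun hlt => ?_) (fun hle => ?_)
  · rcases hc with ⟨w, hdw, hlen, h26, h14, h16, harr⟩ | ⟨-, h26⟩
    swap
    · omega
    have hlets := (drawOf_eq_some (hd ▸ hdw)).2.2.1
    set σ₂ := evAll ω [.add 21 5 14, .sub 21 21 2, .output 5 21] σ₁ with hσ₂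
    have hv2 : ∀ i, i ≠ 21 → σ₂.v i = σ₁.v i := by
      intro i hi
      simp [hσ₂, evAll, Instr.ev, hi]
    have hm2 : σ₂.m = σ₁.m := rfl
    have hfl2 : σ₂.fl = σ.fl + Bd := hfl
    -- For the empty word the end address is one less than the start, which the model reads as an
    -- empty output; truncated subtraction is harmless because the start is at least 40.
    have hout2 : σ₂.out = σ.out ++ [w] := by
      simp [hσ₂, evAll, Instr.ev, he1.v5, h14, he1.v2, hp.out]
      refine List.ext_getElem (by simp; omega) fun i h1 h2 => ?_
      simpa using harr i h2
    have he2 : Env s Xb Bd xs σ₂ := by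
      refine ⟨?_, ?_, ?_, ?_, ?_, ?_, ?_, ?_, fun i hi => he1.arr i hi⟩ <;>
        rw [hv2 _ (by norm_num)]
      exacts [he1.v0, he1.v1, he1.v2, he1.v3, he1.v4, he1.v5, he1.v6, he1.v25]
    refine (WP.blk_seq (n := 7) hb h2 ?_ ?_).le (by simp)
    · simp [okAll, Instr.ok, Instr.ev, he1.v5, he1.v2, h14]
      omega
    rw [← hσ₂]
    have v17 := hv2 17 (by norm_num)
    have v18 := hv2 18 (by norm_num)
    have v16 := hv2 16 (by norm_num)
    have v1 := he2.v1
    clear_value σ₂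
    refine WP.ite (n := 5) hb (by norm_num) (by norm_num) (fun hlt => ?_) (fun hle => ?_)
    · obtain ⟨y, rfl⟩ : ∃ y, Y = some y := by
        cases Y with
        | none => simp at e17; omega
        | some y => exact ⟨y, rfl⟩
      have hy := hq.lets y rfl
      have e17' : σ₂.v 17 = wordCode s y := v17.trans e17
      have e16' : σ₂.v 16 = wordCode s w := v16.trans h16
      have e18' : σ₂.v 18 = g := v18.trans e18
      have hne : wordCode s w ≠ wordCode s y →
          Between s Xb Bd xs (nextState Bd (some y, g) d) σ₂ := by
        intro hne
        rw [hdw]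
        simp only [nextState]
        rw [if_neg (by rintro rfl; exact hne rfl)]
        exact ⟨he2, e17', hq.lets, e18'⟩
      have hout2' : σ₂.out = σ.out ++ d.toList := by simpa [hdw] using hout2
      refine WP.ite (n := 3) hb (by norm_num) (by norm_num) (fun hlt => ?_) (fun hle => ?_)
      · exact WP.skip hb h2 ⟨hne (by omega), hfl2, hout2'⟩
      refine (WP.ite (n := 1) hb (by norm_num) (by norm_num) (fun hlt => ?_)
        (fun hle' => ?_)).le (by norm_num : 1 + 2 ≤ 3)
      · exact WP.skip hb h2 ⟨hne (by omega), hfl2, hout2'⟩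
      · refine WP.blk hb h2 (by simp [okAll, Instr.ok]) ⟨?_, hfl2, hout2'⟩
        have : w = y := wordCode_injOn hlets hy (by omega)
        rw [hdw]
        simp only [nextState, if_pos this]
        refine ⟨he2.pres (lo := Xb + xs.length) (S := [18]) ⟨fun i hi => ?_, fun _ _ => rfl, rfl⟩
          le_rfl (by simp), ?_, hq.lets, ?_⟩
        · simp at hi
          simp [evAll, Instr.ev, hi]
        · simpa [evAll, Instr.ev] using e17'
        · simp [evAll, Instr.ev, e18', he2.v2]
    · have : Y = none := by
        cases Y with
        | none => rfl
        | some y =>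
          have := wordCode_pos s y
          simp at e17; omega
      subst this
      refine (WP.blk hb h2 (by simp [okAll, Instr.ok]) ⟨?_, hfl2, by
        simpa [hdw, evAll, Instr.ev] using hout2⟩).le
        (by simp : 2 ≤ 5)
      rw [hdw]
      refine ⟨he2.pres (lo := Xb + xs.length) (S := [17, 18]) ⟨fun i hi => ?_, fun _ _ => rfl, rfl⟩
          le_rfl (by simp), ?_, ?_, ?_⟩
      · simp at hi
        simp [evAll, Instr.ev, hi]
      · simp [evAll, Instr.ev, nextState, v16, h16]
      · intro y hy
        cases hy
        exact hlets
      · simp [evAll, Instr.ev, he2.v4, nextState]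
  · rcases hc with ⟨w, hdw, hlen, h26, -⟩ | ⟨hdn, h26⟩
    · omega
    have hout : σ₁.out = σ.out ++ d.toList := by simp [hdn, hp.out]
    refine (WP.ite (n := 1) hb (by norm_num) (by norm_num) (fun hlt => ?_)
      (fun hle => ?_)).le (by norm_num : 1 + 2 ≤ 10)
    · obtain ⟨y, rfl⟩ : ∃ y, Y = some y := by
        cases Y with
        | none => simp at e17; omega
        | some y => exact ⟨y, rfl⟩
      refine WP.skip hb h2 ⟨?_, hfl, hout⟩
      rw [hdn]
      exact ⟨he1, e17, hq.lets, e18⟩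
    · have : Y = none := by
        cases Y with
        | none => rfl
        | some y =>
          have := wordCode_pos s y
          simp at e17; omega
      subst this
      refine WP.blk hb h2 (by simp [okAll, Instr.ok]) ⟨?_, hfl, hout⟩
      rw [hdn]
      refine ⟨he1.pres (lo := Xb + xs.length) (S := [18]) ⟨fun i hi => ?_, fun _ _ => rfl, rfl⟩
          le_rfl (by simp), ?_, ?_, ?_⟩
      · simp at hi
        simp [evAll, Instr.ev, hi]
      · simpa [evAll, Instr.ev, nextState] using e17
      · intro y hy; cases hy
      · simp [evAll, Instr.ev, e18, he1.v2, nextState]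

end

/-! ## The prologue: moving the instance out of the way, computing the parameters -/

/-- Change of the number of low registers. -/
theorem WP.change {D D' T W : ℕ} {ω : Coins} {C : Cmd} {n : ℕ} {Q Q' : St → Prop} {σ σ' : St}
    (h : WP D T W ω C n Q σ) (hσ : ∀ c, Rep D' c σ' → Rep D c σ)
    (hQ : ∀ τ, Q τ → ∃ τ', (∀ c, Rep D c τ → Rep D' c τ') ∧ Q' τ') :
    WP D' T W ω C n Q' σ' := by
  intro P c h1 h2 h3
  obtain ⟨k, hk, hg, hp, τ, hr, hq⟩ := h P c h1 (hσ c h2) h3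
  obtain ⟨τ', hτ', hq'⟩ := hQ τ hq
  exact ⟨k, hk, hg, hp, τ', hτ' _ hr, hq'⟩

/-- The contents of all the registers. -/
def St.reg (D : ℕ) (σ : St) (i : ℕ) : ℕ := if i < D then σ.v i else σ.m i

/-- The state given by the contents of all the registers. -/
def St.ofReg (r : ℕ → ℕ) (fl : ℕ) (out : List (List ℕ)) : St := ⟨r, r, fl, out⟩

theorem Rep.of_reg {D : ℕ} {c : Cfg} {σ : St} (h : Rep D c σ) (D' : ℕ) :
    Rep D' c (St.ofReg (σ.reg D) σ.fl σ.out) := by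
  have : ∀ i, c.reg i = σ.reg D i := by
    intro i
    rw [St.reg]
    split_ifs with hi
    exacts [h.low i hi, h.high i (by omega)]
  exact ⟨fun i _ => this i, fun i _ => this i, h.fl, h.out⟩

theorem Rep.ofReg_change {D D' : ℕ} {c : Cfg} {r : ℕ → ℕ} {fl : ℕ} {out : List (List ℕ)}
    (h : Rep D c (St.ofReg r fl out)) : Rep D' c (St.ofReg r fl out) := by
  have : ∀ i, c.reg i = r i := by
    intro i
    by_cases hi : i < D
    exacts [h.low i hi, h.high i (by omega)]
  exact ⟨fun i _ => this i, fun i _ => this i, h.fl, h.out⟩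

/-- Move the instance to the address `8 * n + 13 * m + 40`, where `n` and `m` are the contents of
the registers 0 and 1, which are restored. -/
def moveCmd : Cmd :=
  .blk [.add 0 0 1, .add 1 0 1, .add 0 0 1, .add 1 0 1, .add 0 0 1, .add 1 0 1] ;;
  .ite 0 1 (.blk [.store 1 2]) (.blk []) ;;
  .blk [.const 2 41, .add 2 2 1, .store 2 3, .const 3 1, .add 2 2 3, .store 2 4, .add 2 2 3,
    .store 2 5, .add 2 2 3, .store 2 6, .add 2 2 3, .store 2 7] ;;
  .ite 0 1 (.blk [.load 4 1]) (.blk []) ;;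
  .blk [.const 2 40, .add 2 2 1, .store 2 4, .sub 1 1 0, .sub 0 0 1, .sub 1 1 0, .sub 0 0 1,
    .sub 1 1 0, .sub 0 0 1, .const 4 8, .const 5 2, .add 5 5 0, .const 6 6, .add 6 6 2] ;;
  .loop 4 5 (.blk [.load 7 4, .store 6 7, .add 4 4 3, .add 6 6 3])

section

variable {T W : ℕ} {ω : Coins}

/-- The instance fills the registers from 2 on, so no scratch register is free at the beginning. Six
additions turn the pair (n, m) into (5n + 8m, 8n + 13m), and six subtractions undo this at the end.
Meanwhile register 1 is an address beyond the instance at which register 2 can be parked. The freed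
register 2 then serves as a pointer to save registers 3 to 7, and a loop copies the rest. -/
theorem moveCmd_spec (b : Bds T W) {n m : ℕ} {r : ℕ → ℕ} {fl : ℕ} {out : List (List ℕ)}
    (h0 : r 0 = n) (h1 : r 1 = m) (hT : 9 * n + 13 * m + 50 ≤ T) :
    WP 8 T W ω moveCmd (60 + n * 6)
      (fun σ => σ.v 0 = n ∧ σ.v 1 = m ∧ σ.v 2 = 8 * n + 13 * m + 40 ∧ σ.fl = fl ∧ σ.out = out ∧
        ∀ i, i < n → σ.m (8 * n + 13 * m + 40 + i) = r (2 + i)) (St.ofReg r fl out) := by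
  have hb : 8 ≤ T := by omega
  have h2 := b.two
  have hlt := b.lt
  set σ₁ := evAll ω [.add 0 0 1, .add 1 0 1, .add 0 0 1, .add 1 0 1, .add 0 0 1, .add 1 0 1]
    (St.ofReg r fl out) with hσ₁
  have e0 : σ₁.v 0 = 5 * n + 8 * m := by
    simp [hσ₁, evAll, Instr.ev, St.ofReg, h0, h1]; omega
  have e1 : σ₁.v 1 = 8 * n + 13 * m := by
    simp [hσ₁, evAll, Instr.ev, St.ofReg, h0, h1]; omega
  have ev : ∀ i, 2 ≤ i → σ₁.v i = r i := by
    intro i hi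
    simp [hσ₁, evAll, Instr.ev, St.ofReg, show i ≠ 0 by omega, show i ≠ 1 by omega]
  have em : σ₁.m = r := rfl
  have ef : σ₁.fl = fl ∧ σ₁.out = out := ⟨rfl, rfl⟩
  refine (WP.blk_seq (n := 3 + (12 + (3 + (14 + (n * 6 + 2))))) hb h2 ?_ ?_).le (by simp; omega)
  · simp [okAll, Instr.ok, Instr.ev, St.ofReg, h0, h1]; omega
  rw [← hσ₁]
  clear_value σ₁
  refine WP.seq (R := fun σ₂ => σ₂.v = σ₁.v ∧ σ₂.fl = fl ∧ σ₂.out = out ∧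
    (n ≠ 0 → σ₂.m (8 * n + 13 * m) = r 2) ∧ ∀ a, a < n + 2 → σ₂.m a = r a) ?_ ?_
  -- The test `5n + 8m < 8n + 13m` fails only for n = m = 0, when there is nothing to save.
  -- Otherwise the address 8n + 13m is at least 8 and lies beyond the instance.
  · refine WP.ite (n := 1) hb (by norm_num) (by norm_num) (fun hlt => ?_) (fun hle => ?_)
    · have h8 : 8 ≤ 8 * n + 13 * m := by rcases Nat.eq_zero_or_pos n <;> omega
      refine WP.blk hb h2 (by simp [okAll, Instr.ok, e1]; omega)
        ⟨rfl, ef.1, ef.2, fun hn => ?_, fun a ha => ?_⟩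
      · simp [evAll, Instr.ev, e1, ev]
      · simp only [evAll, Instr.ev, e1, em, ev 2 le_rfl]
        by_cases hn : n = 0
        · rw [Function.update_apply]
          split_ifs <;> [skip; rfl]
          omega
        · rw [Function.update_of_ne (by omega)]
    · exact WP.skip hb h2 ⟨rfl, ef.1, ef.2, fun hn => by omega, fun a _ => by rw [em]⟩
  rintro σ₂ ⟨hv, hf, ho, hm2, hma⟩
  clear ef em
  rw [← hv] at e0 e1 ev
  clear hv
  set G := 8 * n + 13 * m + 40 with hG
  set σ₃ := evAll ω [.const 2 41, .add 2 2 1, .store 2 3, .const 3 1, .add 2 2 3, .store 2 4,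
    .add 2 2 3, .store 2 5, .add 2 2 3, .store 2 6, .add 2 2 3, .store 2 7] σ₂ with hσ₃
  have f0 : σ₃.v 0 = 5 * n + 8 * m := by simp [hσ₃, evAll, Instr.ev, e0]
  have f1 : σ₃.v 1 = 8 * n + 13 * m := by simp [hσ₃, evAll, Instr.ev, e1]
  have f3 : σ₃.v 3 = 1 := by simp [hσ₃, evAll, Instr.ev]
  have fm : σ₃.m = Function.update (Function.update (Function.update (Function.update
      (Function.update σ₂.m (G + 1) (r 3)) (G + 2) (r 4)) (G + 3) (r 5)) (G + 4) (r 6))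
      (G + 5) (r 7) := by
    simp [hσ₃, evAll, Instr.ev, e1, ev]
    rw [show 41 + (8 * n + 13 * m) = G + 1 by omega]
  have hf3 : σ₃.fl = fl ∧ σ₃.out = out := ⟨hf, ho⟩
  refine WP.blk_seq hb h2 ?_ ?_
  · simp [okAll, Instr.ok, Instr.ev, e1]; omega
  rw [← hσ₃]
  clear_value σ₃
  have fm' : ∀ a, a ≤ G → σ₃.m a = σ₂.m a := by
    intro a ha
    rw [fm, Function.update_of_ne (by omega), Function.update_of_ne (by omega),
      Function.update_of_ne (by omega), Function.update_of_ne (by omega),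
      Function.update_of_ne (by omega)]
  have fm'' : ∀ i, 1 ≤ i → i < 6 → σ₃.m (G + i) = r (2 + i) := by
    intro i hi hi'
    rw [fm]
    interval_cases i <;> simp
  refine WP.seq (R := fun σ₄ => (n ≠ 0 → σ₄.v 4 = r 2) ∧ (∀ i, i ≠ 4 → σ₄.v i = σ₃.v i) ∧
    σ₄.m = σ₃.m ∧ σ₄.fl = fl ∧ σ₄.out = out) ?_ ?_
  · refine WP.ite (n := 1) hb (by norm_num) (by norm_num) (fun hlt => ?_) (fun hle => ?_)
    · have h8 : 8 ≤ 8 * n + 13 * m := by rcases Nat.eq_zero_or_pos n <;> omega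
      refine WP.blk hb h2 (by simp [okAll, Instr.ok, f1]; omega)
        ⟨fun hn => ?_, fun i hi => ?_, rfl, hf3.1, hf3.2⟩
      · simp [evAll, Instr.ev, f1]
        rw [fm' _ (by omega), hm2 hn]
      · simp [evAll, Instr.ev, hi]
    · exact WP.skip hb h2 ⟨fun hn => by omega, fun _ _ => rfl, rfl, hf3.1, hf3.2⟩
  rintro σ₄ ⟨g4, gv, gm, gf, go⟩
  have g0 := (gv 0 (by norm_num)).trans f0
  have g1 := (gv 1 (by norm_num)).trans f1
  have g3 := (gv 3 (by norm_num)).trans f3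
  set σ₅ := evAll ω [.const 2 40, .add 2 2 1, .store 2 4, .sub 1 1 0, .sub 0 0 1, .sub 1 1 0,
    .sub 0 0 1, .sub 1 1 0, .sub 0 0 1, .const 4 8, .const 5 2, .add 5 5 0, .const 6 6,
    .add 6 6 2] σ₄ with hσ₅
  have k0 : σ₅.v 0 = n := by simp [hσ₅, evAll, Instr.ev, g0, g1]; omega
  have k1 : σ₅.v 1 = m := by simp [hσ₅, evAll, Instr.ev, g0, g1]; omega
  have k2 : σ₅.v 2 = G := by simp [hσ₅, evAll, Instr.ev, g1]; omega
  have k3 : σ₅.v 3 = 1 := by simp [hσ₅, evAll, Instr.ev, g3]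
  have k4 : σ₅.v 4 = 8 := by simp [hσ₅, evAll, Instr.ev]
  have k5 : σ₅.v 5 = n + 2 := by simp [hσ₅, evAll, Instr.ev, g0, g1]; omega
  have k6 : σ₅.v 6 = G + 6 := by simp [hσ₅, evAll, Instr.ev, g1]; omega
  have km : σ₅.m = Function.update σ₃.m G (σ₄.v 4) := by
    simp [hσ₅, evAll, Instr.ev, g1, gm]
    rw [show 40 + (8 * n + 13 * m) = G by omega]
  have kf : σ₅.fl = fl ∧ σ₅.out = out := ⟨gf, go⟩
  refine WP.blk_seq hb h2 ?_ ?_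
  · simp [okAll, Instr.ok, Instr.ev, g0, g1]; omega
  rw [← hσ₅]
  clear_value σ₅
  have km1 : ∀ i, i < n → i < 6 → σ₅.m (G + i) = r (2 + i) := by
    intro i hi hi'
    rw [km]
    by_cases hi0 : i = 0
    · subst hi0; simp [g4 (by omega)]
    · rw [Function.update_of_ne (by omega), fm'' i (by omega) hi']
  have km2 : ∀ a, a < n + 2 → σ₅.m a = r a := by
    intro a ha
    rw [km, Function.update_of_ne (by omega), fm' a (by omega), hma a ha]
  -- Six letters, from the registers 2 to 7, have been moved already; for n ≤ 6 the truncated count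
  -- is zero.
  refine (WP.loop_count (n := 4) hb (by norm_num) (by norm_num) (n - 6)
    (fun k σ => σ.v 0 = n ∧ σ.v 1 = m ∧ σ.v 2 = G ∧ σ.v 3 = 1 ∧ σ.v 4 = 8 + k ∧ σ.v 5 = n + 2 ∧
      σ.v 6 = G + 6 + k ∧ σ.fl = fl ∧ σ.out = out ∧ (∀ a, a < n + 2 → σ.m a = r a) ∧
      ∀ i, i < n → i < 6 + k → σ.m (G + i) = r (2 + i)) ?_ ?_ ?_).le (by omega)
  · rintro k hk σ ⟨q0, q1, q2, q3, q4, q5, q6, qf, qo, qm, qx⟩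
    refine ⟨by omega, WP.blk hb h2 ?_ ?_⟩
    · simp [okAll, Instr.ok, Instr.ev, q3, q4, q6]; omega
    simp [evAll, Instr.ev, q0, q1, q2, q3, q4, q5, q6, qf, qo]
    refine ⟨by omega, by omega, fun a ha => ?_, fun i hi hi' => ?_⟩
    · rw [Function.update_of_ne (by omega), qm a ha]
    · by_cases hik : i = 6 + k
      · subst hik
        rw [show G + (6 + k) = G + 6 + k by omega, Function.update_self, qm _ (by omega)]
        congr 1; omega
      · rw [Function.update_of_ne (by omega), qx i hi (by omega)]
  · rintro σ ⟨q0, q1, q2, q3, q4, q5, q6, qf, qo, qm, qx⟩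
    exact ⟨by omega, q0, q1, q2, qf, qo, fun i hi => qx i hi (by omega)⟩
  · exact ⟨k0, k1, k2, k3, k4, k5, k6, kf.1, kf.2, km2, km1⟩

/-- Compute the parameters, with the bound `κ * (n + m + 1) ^ d`. -/
def paramCmd (s κ d : ℕ) : Cmd :=
  .blk [.copy 3 2, .const 2 1, .const 25 (s + 1), .add 8 0 1, .add 8 8 2, .const 4 κ] ;;
  .blk (List.replicate d (.mul 4 4 8)) ;;
  .blk [.add 5 3 0, .add 6 5 4, .const 1 0, .const 17 0, .copy 18 4]

/-- As `1 ≤ y`, the partial products are at most the last one, so one bound on the result excludes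
every overflow. -/
theorem mul_replicate_spec (hT : 40 ≤ T) (hW : 2 ≤ W) {d x y : ℕ} {σ : St} (h4 : σ.v 4 = x)
    (h8 : σ.v 8 = y) (hy : 1 ≤ y) (hxy : x * y ^ d < W) :
    WP 40 T W ω (.blk (List.replicate d (.mul 4 4 8))) d
      (fun σ' => σ'.v 4 = x * y ^ d ∧ Keeps [4] σ σ') σ := by
  have key : okAll 40 T W ω (List.replicate d (.mul 4 4 8)) σ ∧
      (evAll ω (List.replicate d (.mul 4 4 8)) σ).v 4 = x * y ^ d ∧
      Keeps [4] σ (evAll ω (List.replicate d (.mul 4 4 8)) σ) := by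
    induction d generalizing σ x with
    | zero => exact ⟨trivial, by simpa [evAll] using h4, ⟨fun _ _ => rfl, rfl, rfl, rfl⟩⟩
    | succ d ih =>
      have e : x * y ^ (d + 1) = x * y * y ^ d := by ring
      have hle : x * y ≤ x * y * y ^ d := Nat.le_mul_of_pos_right _ (Nat.pow_pos (by omega))
      rw [e] at hxy ⊢
      obtain ⟨a1, a2, a3⟩ := ih (σ := Instr.ev ω σ (.mul 4 4 8)) (x := x * y)
        (by simp [Instr.ev, h4, h8]) (by simp [Instr.ev, h8]) hxy
      refine ⟨⟨?_, a1⟩, a2, Keeps.trans ⟨fun i hi => ?_, by rfl, by rfl, by rfl⟩ a3⟩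
      · simp [Instr.ok, h4, h8]; omega
      · simp at hi
        simp [Instr.ev, hi]
  exact (WP.blk hT hW key.1 key.2).le (by simp)

/-- The commands before the main loop. -/
def prologue (s κ d : ℕ) : Cmd := moveCmd ;; paramCmd s κ d

theorem prologue_spec (b : Bds T W) {s κ d n m Bd : ℕ} {xs : List ℕ} (hn : xs.length = n)
    (hBd : Bd = κ * (n + m + 1) ^ d) (hT : 9 * n + 13 * m + 50 + Bd ≤ T) (hs : s + 1 < W)
    (hκ : κ < W) :
    WP 40 T W ω (prologue s κ d) (60 + n * 6 + (11 + d))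
      (fun σ => Between s (8 * n + 13 * m + 40) Bd xs (none, Bd) σ ∧ σ.fl = 0 ∧ σ.out = [])
      (St.ofReg (fun i => (n :: m :: xs).getD i 0) 0 []) := by
  have hb := b.low
  have h2 := b.two
  have hlt := b.lt
  set G := 8 * n + 13 * m + 40 with hG
  refine WP.seq (R := fun σ => σ.v 0 = n ∧ σ.v 1 = m ∧ σ.v 2 = G ∧ σ.fl = 0 ∧ σ.out = [] ∧
    ∀ i (h : i < xs.length), σ.m (G + i) = xs[i]) ?_ ?_
  · refine (moveCmd_spec (ω := ω) b (n := n) (m := m) (r := fun i => (n :: m :: xs).getD i 0)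
      -- During the move only 8 registers count as low, because the registers from 8 on may hold
      -- letters to be read indirectly; afterwards 40 are available.
      (fl := 0) (out := []) (by simp) (by simp) (by omega)).change
      (fun c hc => hc.ofReg_change) fun τ hτ => ⟨_, fun c hc => hc.of_reg 40, ?_⟩
    obtain ⟨e0, e1, e2, ef, eo, ex⟩ := hτ
    refine ⟨by simpa [St.ofReg, St.reg] using e0, by simpa [St.ofReg, St.reg] using e1,
      by simpa [St.ofReg, St.reg] using e2, ef, eo, fun i hi => ?_⟩
    rw [← hG] at ex
    simp only [St.ofReg, St.reg]
    rw [if_neg (by omega), ex i (by omega), add_comm 2 i]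
    simp [hi]
  · rintro σ ⟨e0, e1, e2, ef, eo, ex⟩
    set σ₁ := evAll ω [.copy 3 2, .const 2 1, .const 25 (s + 1), .add 8 0 1, .add 8 8 2,
      .const 4 κ] σ with hσ₁
    refine (WP.blk_seq (n := d + 5) hb h2 ?_ (WP.seq (mul_replicate_spec (x := κ) (y := n + m + 1)
      hb h2 ?_ ?_ (by omega) (by omega))
      fun σ₂ ⟨h4, hk⟩ => WP.blk hb h2 ?_ ?_)).le (by simp; omega)
    · simp [okAll, Instr.ok, Instr.ev, hs, hκ, e0, e1]; omega
    · simp [evAll, Instr.ev]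
    · simp [evAll, Instr.ev, e0, e1]
    all_goals
      rw [← hBd] at h4
      have k0 := hk.v 0 (by simp)
      have k2 := hk.v 2 (by simp)
      have k3 := hk.v 3 (by simp)
      have k25 := hk.v 25 (by simp)
      simp [evAll, Instr.ev, e0, e2] at k0 k2 k3 k25
    · simp [okAll, Instr.ok, Instr.ev, k0, k3, h4]; omega
    · refine ⟨⟨⟨?_, ?_, ?_, ?_, ?_, ?_, ?_, ?_, fun i hi => ?_⟩, ?_, ?_, ?_⟩, ?_, ?_⟩
      any_goals simp [evAll, Instr.ev, k0, k2, k3, k25, h4, hn]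
      · rw [hk.m]; exact ex i hi
      · exact hk.fl.trans ef
      · exact hk.out.trans eo

end

open MeasureTheory

/-! ## Independent draws from a sequence of coins -/

instance : IsProbabilityMeasure coinLaw := by
  unfold coinLaw; infer_instance

/-- Whether `ω` belongs to `E` depends on the first `N` coins only. -/
def DependsOnFirst (N : ℕ) (E : Set Coins) : Prop :=
  ∀ ω ω' : Coins, (∀ i, i < N → ω i = ω' i) → (ω ∈ E ↔ ω' ∈ E)

/-- The coins from number `B` on. -/
def shift (B : ℕ) (ω : Coins) : Coins := fun k => ω (B + k)

theorem measurable_shift (B : ℕ) : Measurable (shift B) :=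
  measurable_pi_lambda _ fun k => measurable_pi_apply (B + k)

/-- An event on finitely many coins is the preimage of a subset of a finite discrete space. This
gives measurability, and independence for disjoint windows of coins. -/
theorem DependsOnFirst.exists_preimage {N : ℕ} {E : Set Coins} (h : DependsOnFirst N E)
    (B : ℕ) : ∃ S : Set (Finset.Ico B (B + N) → Bool),
      shift B ⁻¹' E = (fun ω (i : Finset.Ico B (B + N)) => ω i) ⁻¹' S := by
  refine ⟨(fun ω (i : Finset.Ico B (B + N)) => ω i) '' (shift B ⁻¹' E), ?_⟩
  refine Set.Subset.antisymm (Set.subset_preimage_image _ _) ?_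
  rintro ω ⟨ω', h', he⟩
  refine (h _ _ fun i hi => ?_).mp h'
  exact congrFun he ⟨B + i, by simp; omega⟩

theorem shift_zero : shift 0 = id := by
  funext ω k; simp [shift]

theorem DependsOnFirst.measurableSet {N : ℕ} {E : Set Coins} (h : DependsOnFirst N E) :
    MeasurableSet E := by
  obtain ⟨S, hS⟩ := h.exists_preimage 0
  rw [shift_zero, Set.preimage_id] at hS
  rw [hS]
  exact (measurable_pi_lambda _ fun i => measurable_pi_apply _) (MeasurableSet.of_discrete)

/-- It is enough to compare finite boxes, and shifting a box only renames its coordinates, all of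
which have the same law. -/
theorem map_shift (B : ℕ) : coinLaw.map (shift B) = coinLaw := by
  conv_rhs => rw [coinLaw]
  refine Measure.eq_infinitePi _ fun s t ht => ?_
  rw [Measure.map_apply (measurable_shift B) (.pi s.countable_toSet fun i _ => ht i)]
  have : shift B ⁻¹' (Set.pi s t) =
      Set.pi ((s.map (addLeftEmbedding B) : Finset ℕ) : Set ℕ) fun i => t (i - B) := by
    ext ω
    simp [shift, Set.mem_pi]
  rw [this, coinLaw, Measure.infinitePi_pi _ fun i _ => ht _]
  simp

/-- The first event reads the coins below `B`, the second those from `B` to `B + N - 1`, and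
independent coordinates make disjoint finite blocks independent. -/
theorem coinLaw_inter_shift {B N : ℕ} {E F : Set Coins} (hE : DependsOnFirst B E)
    (hF : DependsOnFirst N F) : coinLaw (E ∩ shift B ⁻¹' F) = coinLaw E * coinLaw F := by
  have hind : ProbabilityTheory.iIndepFun (fun (i : ℕ) (ω : Coins) => ω i) coinLaw :=
    ProbabilityTheory.iIndepFun_infinitePi (X := fun _ x => x) fun _ => measurable_id
  have h2 := hind.indepFun_finset (Finset.Ico 0 (0 + B)) (Finset.Ico B (B + N))
    (Finset.disjoint_left.mpr fun i => by simp; omega) fun i => measurable_pi_apply i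
  obtain ⟨S, hS⟩ := hE.exists_preimage 0
  rw [shift_zero, Set.preimage_id] at hS
  obtain ⟨S', hS'⟩ := hF.exists_preimage B
  have hFm : coinLaw (shift B ⁻¹' F) = coinLaw F := by
    rw [← Measure.map_apply (measurable_shift B) hF.measurableSet, map_shift]
  rw [← hFm, hS', hS]
  exact h2.measure_inter_preimage_eq_mul _ _ MeasurableSet.of_discrete MeasurableSet.of_discrete

/-- The outcomes of the first `t` draws, each one using `B` coins. -/
def draws {α : Type*} (D : Coins → Option α) (B t : ℕ) (ω : Coins) : List (Option α) :=
  (List.range t).map fun i => D fun k => ω (i * B + k)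

/-- A draw with `B` coins that fails with probability at most `1 / 2`, or else gives a uniformly
distributed element of `A`. -/
structure UniformDraw {α : Type*} (B : ℕ) (D : Coins → Option α) (A : Finset α) : Prop where
  dep : ∀ ω ω' : Coins, (∀ i, i < B → ω i = ω' i) → D ω = D ω'
  mem : ∀ ω y, D ω = some y → y ∈ A
  unif : ∀ y ∈ A, ∀ y' ∈ A, coinLaw {ω | D ω = some y} = coinLaw {ω | D ω = some y'}
  fail : coinLaw {ω | D ω = none} ≤ 1 / 2

section

variable {α : Type*} {B : ℕ} {D : Coins → Option α} {A : Finset α}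

theorem length_draws (D : Coins → Option α) (B t : ℕ) (ω : Coins) :
    (draws D B t ω).length = t := by simp [draws]

/-- Removing the first draw restarts the process on shifted coins, which is the form used for the
probabilities; `draws_succ'` removes the last draw and follows the machine. -/
theorem draws_succ (D : Coins → Option α) (B t : ℕ) (ω : Coins) :
    draws D B (t + 1) ω = D ω :: draws D B t (shift B ω) := by
  simp only [draws, List.range_succ_eq_map, List.map_cons, List.map_map, List.cons.injEq]
  refine ⟨by simp, List.map_congr_left fun i _ => ?_⟩
  simp only [Function.comp, shift]
  congr 1; funext k; congr 1; rw [Nat.succ_mul]; omega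

theorem draws_succ' (D : Coins → Option α) (B t : ℕ) (ω : Coins) :
    draws D B (t + 1) ω = draws D B t ω ++ [D fun k => ω (t * B + k)] := by
  simp [draws, List.range_succ]

theorem draws_prefix (D : Coins → Option α) (B : ℕ) {t t' : ℕ} (h : t ≤ t') (ω : Coins) :
    draws D B t ω <+: draws D B t' ω := by
  induction t', h using Nat.le_induction with
  | base => exact List.prefix_rfl
  | succ n _ ih => rw [draws_succ']; exact ih.trans (List.prefix_append _ _)

theorem UniformDraw.dependsOnFirst (h : UniformDraw B D A) (t : ℕ)
    (R : List (Option α) → Prop) : DependsOnFirst (t * B) {ω | R (draws D B t ω)} := by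
  intro ω ω' hω
  have : draws D B t ω = draws D B t ω' := by
    refine List.map_congr_left fun i hi => h.dep _ _ fun j hj => hω _ ?_
    have hi' : i + 1 ≤ t := List.mem_range.mp hi
    have := Nat.mul_le_mul_right B hi'
    rw [Nat.succ_mul] at this
    omega
  simp [this]

theorem UniformDraw.dependsOnFirst_one (h : UniformDraw B D A) (d : Option α) :
    DependsOnFirst B {ω | D ω = d} := by
  intro ω ω' hω
  simp [h.dep ω ω' hω]

/-- The probability of each element. -/
theorem UniformDraw.exists_prob (h : UniformDraw B D A) (hA : A.Nonempty) :
    ∃ ρ p₀ : ℝ, (∀ y ∈ A, coinLaw.real {ω | D ω = some y} = ρ) ∧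
      coinLaw.real {ω | D ω = none} = p₀ ∧ 0 ≤ p₀ ∧ p₀ ≤ 1 / 2 ∧ A.card * ρ + p₀ = 1 := by
  obtain ⟨z, hz⟩ := hA
  refine ⟨coinLaw.real {ω | D ω = some z}, coinLaw.real {ω | D ω = none}, fun y hy => ?_, rfl,
    measureReal_nonneg, ?_, ?_⟩
  · simp [Measure.real, h.unif y hy z hz]
  · have := ENNReal.toReal_mono (by norm_num) h.fail
    simpa [Measure.real] using this
  · classical
    have hun : (Set.univ : Set Coins) =
        (⋃ y ∈ A, {ω | D ω = some y}) ∪ {ω | D ω = none} := by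
      ext ω
      simp only [Set.mem_univ, Set.mem_union, Set.mem_iUnion, Set.mem_ofPred_eq, true_iff]
      cases hd : D ω with
      | none => simp
      | some y => exact .inl ⟨y, h.mem ω y hd, rfl⟩
    have h1 : coinLaw.real (Set.univ : Set Coins) = 1 := by simp
    rw [← h1, hun, measureReal_union ?_ ?_ (measure_ne_top _ _) (measure_ne_top _ _),
      measureReal_biUnion_finset]
    · rw [Finset.sum_congr rfl fun y hy => show coinLaw.real {ω | D ω = some y} =
        coinLaw.real {ω | D ω = some z} by simp [Measure.real, h.unif y hy z hz]]
      simp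
    · intro y _ y' _ hne
      refine Set.disjoint_left.mpr fun ω h1 h2 => hne ?_
      simp only [Set.mem_ofPred_eq] at h1 h2
      rw [h1] at h2
      exact Option.some.inj h2
    · exact fun y _ => (h.dependsOnFirst_one _).measurableSet
    · refine Set.disjoint_left.mpr fun ω h1 h2 => ?_
      simp only [Set.mem_iUnion, Set.mem_ofPred_eq] at h1 h2
      obtain ⟨y, -, h1⟩ := h1
      rw [h1] at h2
      cases h2
    · exact (h.dependsOnFirst_one _).measurableSet

/-- Markov's inequality for a potential that decreases by a factor `c` in expectation. -/
theorem UniformDraw.prob_foldl_le (h : UniformDraw B D A) {ρ p₀ : ℝ}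
    (hρ : ∀ y ∈ A, coinLaw.real {ω | D ω = some y} = ρ)
    (hp₀ : coinLaw.real {ω | D ω = none} = p₀) {S : Type*} (upd : S → Option α → S)
    (base : S → Prop) (ψ : S → ℝ) (hψ : ∀ s, 0 ≤ ψ s) (hbase : ∀ s, base s → 1 ≤ ψ s) {c : ℝ}
    (hc : 0 ≤ c)
    (hstep : ∀ s, p₀ * ψ (upd s none) + ∑ y ∈ A, ρ * ψ (upd s (some y)) ≤ c * ψ s) (t : ℕ)
    (s : S) : coinLaw.real {ω | base ((draws D B t ω).foldl upd s)} ≤ c ^ t * ψ s := by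
  classical
  induction t generalizing s with
  | zero =>
    simp only [draws, List.range_zero, List.map_nil, List.foldl_nil, pow_zero, one_mul]
    by_cases hs : base s
    · simpa [hs] using hbase s hs
    · simpa [hs] using hψ s
  | succ t ih =>
    -- Split according to the first draw; the remaining `t` draws are independent of it, so the
    -- induction hypothesis applies from the updated state.
    have hsub : {ω | base ((draws D B (t + 1) ω).foldl upd s)} ⊆
        ({ω | D ω = none} ∩ shift B ⁻¹' {ω | base ((draws D B t ω).foldl upd (upd s none))}) ∪
        ⋃ y ∈ A, ({ω | D ω = some y} ∩
          shift B ⁻¹' {ω | base ((draws D B t ω).foldl upd (upd s (some y)))}) := by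
      intro ω hω
      simp only [Set.mem_ofPred_eq, draws_succ, List.foldl_cons] at hω
      simp only [Set.mem_union, Set.mem_iUnion, Set.mem_inter_iff, Set.mem_ofPred_eq,
        Set.mem_preimage]
      cases hd : D ω with
      | none => rw [hd] at hω; exact .inl ⟨rfl, hω⟩
      | some y => rw [hd] at hω; exact .inr ⟨y, h.mem ω y hd, rfl, hω⟩
    have hprod : ∀ d, coinLaw.real ({ω | D ω = d} ∩
        shift B ⁻¹' {ω | base ((draws D B t ω).foldl upd (upd s d))}) ≤
        coinLaw.real {ω | D ω = d} * (c ^ t * ψ (upd s d)) := by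
      intro d
      rw [Measure.real, coinLaw_inter_shift (h.dependsOnFirst_one d)
        (h.dependsOnFirst t fun L => base (L.foldl upd (upd s d))), ENNReal.toReal_mul]
      exact mul_le_mul_of_nonneg_left (ih (upd s d)) ENNReal.toReal_nonneg
    calc _ ≤ _ := measureReal_mono hsub
      _ ≤ _ := measureReal_union_le _ _
      _ ≤ p₀ * (c ^ t * ψ (upd s none)) + ∑ y ∈ A, ρ * (c ^ t * ψ (upd s (some y))) := by
          refine add_le_add (hp₀ ▸ hprod none) ((measureReal_biUnion_finset_le _ _).trans ?_)
          exact Finset.sum_le_sum fun y hy => hρ y hy ▸ hprod (some y)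
      _ = c ^ t * (p₀ * ψ (upd s none) + ∑ y ∈ A, ρ * ψ (upd s (some y))) := by
          rw [mul_add, Finset.mul_sum]
          congr 1
          · ring
          · exact Finset.sum_congr rfl fun y _ => by ring
      _ ≤ c ^ t * (c * ψ s) := mul_le_mul_of_nonneg_left (hstep s) (pow_nonneg hc t)
      _ = c ^ (t + 1) * ψ s := by ring

end

/-! ## The outcomes of the draws are good with high probability -/

theorem foldl_seen_eq {α : Type*} (b : Bool) (L : List (Option α)) :
    L.foldl (fun b d => b || d.isSome) b = true ↔ b = true ∨ ∃ d ∈ L, d ≠ none := by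
  induction L generalizing b with
  | nil => simp
  | cons d L ih =>
    rw [List.foldl_cons, ih]
    cases d <;> simp

theorem UniformDraw.mem_of_mem_draws {α : Type*} {B : ℕ} {D : Coins → Option α}
    {A : Finset α} (h : UniformDraw B D A) {t : ℕ} {ω : Coins} {y : α}
    (hy : some y ∈ draws D B t ω) : y ∈ A := by
  obtain ⟨i, -, hi⟩ := List.mem_map.mp hy
  exact h.mem _ _ hi

/-- The potential is 1 until something has been found and 0 afterwards; one draw multiplies its
expectation by `p₀ ≤ 1/2`. -/
theorem UniformDraw.prob_none_found {α : Type*} {B : ℕ} {D : Coins → Option α}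
    {A : Finset α} {ρ p₀ : ℝ} (h : UniformDraw B D A)
    (hρ : ∀ y ∈ A, coinLaw.real {ω | D ω = some y} = ρ)
    (hp₀ : coinLaw.real {ω | D ω = none} = p₀) (hle : p₀ ≤ 1 / 2) (K : ℕ) :
    coinLaw.real {ω | ¬ ∃ d ∈ draws D B K ω, d ≠ none} ≤ (1 / 2) ^ K := by
  have := h.prob_foldl_le hρ hp₀ (fun (b : Bool) d => b || d.isSome) (fun b => ¬ b = true)
    (fun b => if b then 0 else 1) (by intro b; split_ifs <;> norm_num)
    (by intro b hb; simp [hb]) (c := 1 / 2) (by norm_num)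
    (by intro b; cases b <;> simp; linarith) K false
  simp only [foldl_seen_eq] at this
  simpa using this

section

variable {α : Type*} [DecidableEq α]

/-- The set of the elements obtained in a list of draws. -/
def found (L : List (Option α)) : Finset α := L.reduceOption.toFinset

theorem mem_found {L : List (Option α)} {y : α} : y ∈ found L ↔ some y ∈ L := by
  rw [found, List.mem_toFinset, List.reduceOption_mem_iff]

theorem found_mono {L L' : List (Option α)} (h : L <+: L') : found L ⊆ found L' := fun _ hy =>
  mem_found.mpr (h.subset (mem_found.mp hy))

theorem foldl_insert_eq (S : Finset α) (L : List (Option α)) :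
    L.foldl (fun S d => d.elim S (insert · S)) S = S ∪ found L := by
  induction L generalizing S with
  | nil => simp [found]
  | cons d L ih =>
    rw [List.foldl_cons, ih]
    ext z
    cases d <;> simp [mem_found, eq_comm, or_left_comm]

theorem foldl_count_eq (y : α) (h : ℕ) (L : List (Option α)) :
    L.foldl (fun h d => if d = some y then h + 1 else h) h = h + L.count (some y) := by
  induction L generalizing h with
  | nil => simp
  | cons d L ih =>
    rw [List.foldl_cons, ih, List.count_cons]
    by_cases hd : d = some y <;> simp [hd]; omega

/-- Whether `y` has been seen before the `K`-th occurrence of `z`, and the number of occurrences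
of `z` until then. -/
def raceUpd (K : ℕ) (z y : α) (q : Bool × ℕ) (d : Option α) : Bool × ℕ :=
  if K ≤ q.2 then q else (q.1 || d = some y, if d = some z then q.2 + 1 else q.2)

/-- The race is frozen once decided, so its result can be read at a fixed later time instead of at
the random time of the stop. -/
theorem foldl_raceUpd_of_le {K : ℕ} (z y : α) {q : Bool × ℕ} (h : K ≤ q.2)
    (L : List (Option α)) : L.foldl (raceUpd K z y) q = q := by
  induction L with
  | nil => rfl
  | cons d L ih => rw [List.foldl_cons, raceUpd, if_pos h, ih]

theorem foldl_raceUpd {K : ℕ} {z y : α} {L : List (Option α)} (hy : some y ∉ L) (h : ℕ)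
    (hK : K ≤ h + L.count (some z)) (hh : h ≤ K) :
    L.foldl (raceUpd K z y) (false, h) = (false, K) := by
  induction L generalizing h with
  | nil => simp at hK; simp; omega
  | cons d L ih =>
    obtain hh | rfl := hh.lt_or_eq
    · have hd : d ≠ some y := fun hd => hy (by simp [hd])
      rw [List.foldl_cons, raceUpd, if_neg (by simpa using hh)]
      rw [List.count_cons] at hK
      have := ih (fun hm => hy (by simp [hm])) (if d = some z then h + 1 else h)
        (by split_ifs at hK ⊢ <;> simp_all; omega) (by split_ifs <;> omega)
      simpa [hd] using this
    · exact foldl_raceUpd_of_le (q := (false, h)) z y le_rfl _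

/-- The state of the algorithm after the outcomes `L`. -/
theorem foldl_nextState (K : ℕ) (L : List (Option α)) :
    ((∀ d ∈ L, d = none) ∧ L.foldl (nextState K) (none, K) = (none, K - L.length)) ∨
    ∃ y, some y ∈ L ∧
      L.foldl (nextState K) (none, K) = (some y, K + 1 - L.count (some y)) := by
  induction L using List.reverseRecOn with
  | nil => simp
  | append_singleton L d ih =>
    simp only [List.foldl_append, List.foldl_cons, List.foldl_nil]
    rcases ih with ⟨h1, h2⟩ | ⟨y, h1, h2⟩
    · rw [h2]
      cases d with
      | none =>
        refine .inl ⟨by simpa [or_imp, forall_and] using h1, ?_⟩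
        simp [nextState]; omega
      | some y =>
        -- The draw that sets the budget to `K` is itself an occurrence of the reference, which
        -- explains `K + 1` minus the count.
        have : L.count (some y) = 0 := List.count_eq_zero.mpr fun h => by simpa using h1 _ h
        exact .inr ⟨y, by simp, by simp [nextState, this]⟩
    · rw [h2]
      refine .inr ⟨y, by simp [h1], ?_⟩
      cases d with
      | none => simp [nextState]
      | some z =>
        by_cases hz : z = y
        · subst hz; simp [nextState]; omega
        · have : (some z == some y) = false := by simpa using hz
          simp [nextState, hz, List.count_append]

/-- The four conditions that guarantee the success of the enumeration. -/
structure GoodDraws {B : ℕ} (D : Coins → Option α) (A : Finset α) (K : ℕ) (ω : Coins) :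
    Prop where
  some_found : ∃ d ∈ draws D B K ω, d ≠ none
  race : ∀ z ∈ A, ∀ y ∈ A, z ≠ y →
    (draws D B (8 * A.card * K) ω).foldl (raceUpd K z y) (false, 0) ≠ (false, K)
  count : ∀ y ∈ A, K < (draws D B (8 * A.card * K) ω).count (some y)
  distinct : ∀ k, 1 ≤ k → 2 * k ≤ A.card → k ≤ (found (draws D B (12 * k * K) ω)).card

variable {B : ℕ} {D : Coins → Option α} {A : Finset α}

/-- What the algorithm does with good outcomes of the draws. -/
structure Outcome (B : ℕ) (D : Coins → Option α) (A : Finset α) (K τ : ℕ) (ω : Coins) :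
    Prop where
  le : τ ≤ 8 * A.card * K
  exhausted : ((draws D B τ ω).foldl (nextState K) (none, K)).2 = 0
  go : ∀ t, t < τ → ((draws D B t ω).foldl (nextState K) (none, K)).2 ≠ 0
  all : ∀ y ∈ A, some y ∈ draws D B τ ω
  delay : ∀ k, 1 ≤ k → k ≤ A.card → ∃ t, t ≤ τ ∧ t ≤ 16 * k * K ∧
    k ≤ (found (draws D B t ω)).card

/-- The number of draws is the first time the budget is zero. A solution absent at that time would
have lost the race against the reference, excluded by `GoodDraws.race` for every possible reference.
-/
theorem UniformDraw.outcome (h : UniformDraw B D A) {K : ℕ} {ω : Coins}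
    (hg : GoodDraws (B := B) D A K ω) : ∃ τ, Outcome B D A K τ ω := by
  classical
  set q : ℕ → Option α × ℕ := fun t => (draws D B t ω).foldl (nextState K) (none, K) with hq
  -- After 8nK draws there is a reference, as something was found in the first `K` draws, and it has
  -- occurred more than `K` times.
  have hH : (q (8 * A.card * K)).2 = 0 := by
    obtain ⟨d, hd, hne⟩ := hg.some_found
    obtain ⟨z, rfl⟩ := Option.ne_none_iff_exists'.mp hne
    have hA : 1 ≤ A.card := Finset.card_pos.mpr ⟨z, h.mem_of_mem_draws hd⟩
    have hz : some z ∈ draws D B (8 * A.card * K) ω :=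
      (draws_prefix D B (Nat.le_mul_of_pos_left K (by omega)) ω).subset hd
    rcases foldl_nextState K (draws D B (8 * A.card * K) ω) with ⟨h1, -⟩ | ⟨y, h1, h2⟩
    · simpa using h1 _ hz
    · have := hg.count y (h.mem_of_mem_draws h1)
      simp only [hq, h2]
      omega
  have hex : ∃ t, (q t).2 = 0 := ⟨_, hH⟩
  have hle : Nat.find hex ≤ 8 * A.card * K := Nat.find_min' hex hH
  -- Stopping without a reference takes at least `K` failed draws, contrary to `some_found`;
  -- otherwise the reference has occurred at least `K + 1` times, which is enough for the race to be
  -- over.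
  have hall : ∀ y ∈ A, some y ∈ draws D B (Nat.find hex) ω := by
    have h0 := Nat.find_spec hex
    intro y hy
    rcases foldl_nextState K (draws D B (Nat.find hex) ω) with ⟨h1, h2⟩ | ⟨z, h1, h2⟩
    · exfalso
      simp only [hq, h2, length_draws] at h0
      obtain ⟨d, hd, hne⟩ := hg.some_found
      exact hne (h1 _ ((draws_prefix D B (by omega) ω).subset hd))
    · by_contra hny
      have hzy : z ≠ y := by rintro rfl; exact hny h1
      refine hg.race z (h.mem_of_mem_draws h1) y hy hzy ?_
      obtain ⟨L', hL'⟩ := draws_prefix D B hle ω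
      rw [← hL', List.foldl_append, foldl_raceUpd hny 0 _ (Nat.zero_le _),
        foldl_raceUpd_of_le (q := (false, K)) z y le_rfl]
      simp only [hq, h2] at h0
      omega
  refine ⟨Nat.find hex, hle, Nat.find_spec hex, fun t ht => Nat.find_min hex ht, hall,
    fun k hk hkn => ?_⟩
  -- If the run has stopped by then, everything has been found. If not, 16kK is less than 8nK, so `2
  -- * k ≤ n` and the `distinct` condition applies.
  by_cases hc : Nat.find hex ≤ 16 * k * K
  · refine ⟨_, le_rfl, hc, hkn.trans (Finset.card_le_card fun y hy => mem_found.mpr (hall y hy))⟩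
  · rw [not_le] at hc
    refine ⟨16 * k * K, hc.le, le_rfl, ?_⟩
    by_cases h2 : 2 * k ≤ A.card
    · refine (hg.distinct k hk h2).trans (Finset.card_le_card (found_mono ?_))
      exact draws_prefix D B (Nat.mul_le_mul_right K (by omega)) ω
    · have := Nat.mul_le_mul_right K (show 8 * A.card ≤ 16 * k by omega)
      omega

/-! ### Exponential tail bounds for the draws. -/

section

variable {ρ p₀ : ℝ}

/-- The potential `(1/2)^(K - j)`, with j the number of occurrences of z, set to zero once y has
been seen, is a martingale: z doubles it, y kills it, both with the same probability. It starts at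
2^(-K) and equals 1 when the race is lost. -/
theorem UniformDraw.prob_race (h : UniformDraw B D A)
    (hρ : ∀ y ∈ A, coinLaw.real {ω | D ω = some y} = ρ)
    (hp₀ : coinLaw.real {ω | D ω = none} = p₀) (hsum : A.card * ρ + p₀ = 1) (K t : ℕ) {z y : α}
    (hz : z ∈ A) (hy : y ∈ A) (hzy : z ≠ y) :
    coinLaw.real {ω | (draws D B t ω).foldl (raceUpd K z y) (false, 0) = (false, K)} ≤
      (1 / 2) ^ K := by
  have := h.prob_foldl_le hρ hp₀ (raceUpd K z y) (fun q => q = (false, K))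
    (fun q => if q.1 then 0 else (1 / 2) ^ (K - q.2)) (by intro b; split_ifs <;> positivity)
    (by rintro _ rfl; simp) (c := 1) zero_le_one ?_ t (false, 0)
  · simpa using this
  rintro ⟨b, j⟩
  by_cases hj : K ≤ j
  · simp only [raceUpd, if_pos hj, Finset.sum_const, nsmul_eq_mul]
    refine le_of_eq ?_
    linear_combination (if b then (0 : ℝ) else (1 / 2) ^ (K - j)) * hsum
  cases b
  swap
  · simp [raceUpd, hj]
  obtain ⟨e, rfl⟩ : ∃ e, K = j + 1 + e := ⟨K - (j + 1), by omega⟩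
  have e1 : j + 1 + e - j = e + 1 := by omega
  have e2 : j + 1 + e - (j + 1) = e := by omega
  -- Relative to an unchanged potential v, drawing z gains v and drawing y loses v; the two
  -- corrections cancel in the sum.
  have hval : ∀ w ∈ A, ρ * (if (raceUpd (j + 1 + e) z y (false, j) (some w)).1 then (0 : ℝ)
      else (1 / 2) ^ (j + 1 + e - (raceUpd (j + 1 + e) z y (false, j) (some w)).2)) =
      ρ * (1 / 2) ^ (e + 1) + ((if w = z then ρ * (1 / 2) ^ (e + 1) else 0) -
        if w = y then ρ * (1 / 2) ^ (e + 1) else 0) := by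
    intro w _
    simp only [raceUpd, if_neg hj, Option.some.injEq, Bool.false_or, decide_eq_true_eq]
    by_cases h1 : w = y
    · have h2 : w ≠ z := by rintro rfl; exact hzy h1
      simp [h1, hzy.symm]
    · by_cases h2 : w = z
      · simp only [h2, hzy, if_true, if_false, e2]
        ring
      · simp only [h1, h2, if_false, e1]
        ring
  rw [Finset.sum_congr rfl hval, Finset.sum_add_distrib, Finset.sum_sub_distrib,
    Finset.sum_ite_eq', Finset.sum_ite_eq', if_pos hz, if_pos hy]
  simp only [raceUpd, if_neg hj, e1, Finset.sum_const, nsmul_eq_mul]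
  simp only [reduceCtorEq, decide_false, Bool.or_false, Bool.false_eq_true, if_false, e1]
  refine le_of_eq ?_
  linear_combination (1 / 2 : ℝ) ^ (e + 1) * hsum

/-- Chernoff's method: with j the number of occurrences of y so far, the potential `2^K (1/2)^j` is
at least 1 as long as `j ≤ K`, and each draw multiplies its expectation by `1 - ρ/2`. -/
theorem UniformDraw.prob_count (h : UniformDraw B D A)
    (hρ : ∀ y ∈ A, coinLaw.real {ω | D ω = some y} = ρ)
    (hp₀ : coinLaw.real {ω | D ω = none} = p₀) (hle : p₀ ≤ 1 / 2)
    (hsum : A.card * ρ + p₀ = 1) (K : ℕ) {y : α} (hy : y ∈ A) :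
    coinLaw.real {ω | (draws D B (8 * A.card * K) ω).count (some y) ≤ K} ≤ (1 / 2) ^ K := by
  have hn : (1 : ℝ) ≤ A.card := by exact_mod_cast Finset.card_pos.mpr ⟨y, hy⟩
  have hnρ : 1 / 2 ≤ A.card * ρ := by linarith
  have hρ1 : ρ ≤ 1 := hρ y hy ▸ measureReal_le_one
  have := h.prob_foldl_le hρ hp₀ (fun (h : ℕ) d => if d = some y then h + 1 else h)
    (fun h => h ≤ K) (fun h => 2 ^ K * (1 / 2) ^ h) (fun _ => by positivity) (fun j hj => ?_)
    (c := 1 - ρ / 2) (by linarith) (fun j => ?_) (8 * A.card * K) 0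
  · simp only [foldl_count_eq, zero_add, pow_zero, mul_one] at this
    refine this.trans ?_
    -- The power is at most exp(-4nρ) ≤ exp(-2) ≤ 1/4 by nρ ≥ 1/2. A block of 8n draws thus gains
    -- 1/4, against the factor 2 per unit of `K` in the initial potential.
    have h1 : (1 - ρ / 2) ^ (8 * A.card) ≤ (1 / 4 : ℝ) := by
      have h2 : 1 - ρ / 2 ≤ Real.exp (-(ρ / 2)) := by
        linarith [Real.add_one_le_exp (-(ρ / 2))]
      refine (pow_le_pow_left₀ (by linarith) h2 _).trans ?_
      rw [← Real.exp_nat_mul]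
      have h3 : ((8 * A.card : ℕ) : ℝ) * -(ρ / 2) ≤ -1 + -1 := by
        push_cast; linarith
      refine (Real.exp_le_exp.mpr h3).trans ?_
      rw [Real.exp_add]
      have h4 : Real.exp (-1) ≤ 1 / 2 := by
        rw [Real.exp_neg, inv_le_comm₀ (Real.exp_pos _) (by norm_num)]
        linarith [Real.add_one_le_exp (1 : ℝ)]
      nlinarith [Real.exp_pos (-1)]
    rw [pow_mul]
    calc _ ≤ (1 / 4 : ℝ) ^ K * 2 ^ K := mul_le_mul_of_nonneg_right
            (pow_le_pow_left₀ (pow_nonneg (by linarith) _) h1 _) (by positivity)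
      _ = (1 / 2) ^ K := by rw [← mul_pow]; norm_num
  · rw [one_div, inv_pow, ← div_eq_mul_inv, one_le_div (by positivity)]
    exact pow_le_pow_right₀ (by norm_num) hj
  · have hval : ∀ w ∈ A, ρ * ((2 : ℝ) ^ K * (1 / 2) ^ (if some w = some y then j + 1 else j)) =
        ρ * (2 ^ K * (1 / 2) ^ j) - if w = y then ρ * (2 ^ K * (1 / 2) ^ (j + 1)) else 0 := by
      intro w _
      by_cases hw : w = y
      · simp [hw, pow_succ]; ring
      · simp [hw]
    rw [Finset.sum_congr rfl hval, Finset.sum_sub_distrib, Finset.sum_ite_eq', if_pos hy]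
    simp only [reduceCtorEq, if_false, Finset.sum_const, nsmul_eq_mul]
    refine le_of_eq ?_
    linear_combination (2 : ℝ) ^ K * (1 / 2) ^ j * hsum

/-- The potential is `2^(k - |S|)`, S being the set found, until k elements are known and 0 then. A
draw is new with probability at least (n/2)ρ ≥ 1/4 and then at least halves the potential, whence
the factor 1 - 1/8. -/
theorem UniformDraw.prob_distinct (h : UniformDraw B D A)
    (hρ : ∀ y ∈ A, coinLaw.real {ω | D ω = some y} = ρ)
    (hp₀ : coinLaw.real {ω | D ω = none} = p₀) (hle : p₀ ≤ 1 / 2)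
    (hsum : A.card * ρ + p₀ = 1) {K k : ℕ} (hK : 1 ≤ K) (hk : 1 ≤ k) (hkn : 2 * k ≤ A.card) :
    coinLaw.real {ω | (found (draws D B (12 * k * K) ω)).card < k} ≤ (1 / 2) ^ K := by
  have hn : (2 : ℝ) * k ≤ A.card := by exact_mod_cast hkn
  have hk' : (1 : ℝ) ≤ k := by exact_mod_cast hk
  have hnρ : 1 / 2 ≤ A.card * ρ := by linarith
  have hρ0 : 0 ≤ ρ := by
    by_contra hneg
    nlinarith
  have := h.prob_foldl_le hρ hp₀ (fun (S : Finset α) d => d.elim S (insert · S))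
    (fun S => S.card < k) (fun S => if S.card < k then 2 ^ (k - S.card) else 0)
    (fun S => by split_ifs <;> positivity)
    (fun S hS => by simpa [hS] using one_le_pow₀ (by norm_num))
    (c := 7 / 8) (by norm_num) (fun S => ?_) (12 * k * K) ∅
  · simp only [foldl_insert_eq, Finset.empty_union] at this
    rw [if_pos (show (∅ : Finset α).card < k from hk), Finset.card_empty, Nat.sub_zero] at this
    refine this.trans ?_
    calc (7 / 8 : ℝ) ^ (12 * k * K) * 2 ^ k
        ≤ (1 / 4) ^ (k * K) * 2 ^ (k * K) := by
          refine mul_le_mul ?_ (pow_le_pow_right₀ (by norm_num) (Nat.le_mul_of_pos_right k hK))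
            (by positivity) (by positivity)
          -- The constant 12 comes from (7/8)^12 ≤ 1/4.
          rw [mul_assoc, pow_mul]
          exact pow_le_pow_left₀ (by positivity) (by norm_num) _
      _ = (1 / 2) ^ (k * K) := by rw [← mul_pow]; norm_num
      _ ≤ (1 / 2) ^ K := pow_le_pow_of_le_one (by norm_num) (by norm_num)
          (Nat.le_mul_of_pos_left K hk)
  · by_cases hS : S.card < k
    swap
    · have : ∀ w, ¬ (insert w S).card < k := fun w hw =>
        hS ((Finset.card_le_card (Finset.subset_insert w S)).trans_lt hw)
      simp [hS, this]
    set v : ℝ := 2 ^ (k - S.card) with hv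
    have hv0 : 0 < v := by positivity
    -- Only an inequality, because the potential drops to zero, not to one half, when the k-th
    -- element arrives.
    have hval : ∀ w ∈ A, ρ * (if (insert w S).card < k then (2 : ℝ) ^ (k - (insert w S).card)
        else 0) ≤ ρ * v - if w ∉ S then ρ * v / 2 else 0 := by
      intro w _
      by_cases hw : w ∈ S
      · simp [hw, hS, hv]
      · rw [Finset.card_insert_of_notMem hw, if_pos hw]
        split_ifs with hlt
        · rw [show v = 2 * 2 ^ (k - (S.card + 1)) by
            rw [hv, ← pow_succ']; congr 1; omega]
          exact le_of_eq (by ring)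
        · rw [mul_zero]; nlinarith
    have hcard : (A.card : ℝ) / 2 ≤ (A.filter (· ∉ S)).card := by
      have h1 : A.card ≤ (A.filter (· ∉ S)).card + S.card := by
        rw [← Finset.sdiff_eq_filter]
        exact Nat.sub_le_iff_le_add.mp (Finset.le_card_sdiff S A)
      have h1' : (A.card : ℝ) ≤ (A.filter (· ∉ S)).card + S.card := by exact_mod_cast h1
      have h2 : (S.card : ℝ) ≤ k := by exact_mod_cast hS.le
      linarith
    simp only [Option.elim_none, Option.elim_some, if_pos hS, ← hv]
    refine (add_le_add le_rfl (Finset.sum_le_sum hval)).trans ?_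
    rw [Finset.sum_sub_distrib, ← Finset.sum_filter]
    simp only [Finset.sum_const, nsmul_eq_mul]
    have h3 : (A.card : ℝ) / 2 * (ρ * v / 2) ≤ (A.filter (· ∉ S)).card * (ρ * v / 2) :=
      mul_le_mul_of_nonneg_right hcard (by positivity)
    have h4 : 1 / 2 * v ≤ A.card * ρ * v := mul_le_mul_of_nonneg_right hnρ hv0.le
    have h5 : (A.card * ρ + p₀) * v = v := by rw [hsum, one_mul]
    linarith

end

/-- Union bound over the failures of the four conditions of `GoodDraws`. Since the reference is
random, the race must be controlled for all ordered pairs, which costs the factor n². -/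
theorem UniformDraw.prob_outcome (h : UniformDraw B D A) (hA : A.Nonempty) {K m : ℕ}
    (hK : 1 ≤ K) (hKm : 4 * A.card ^ 2 * 2 ^ m ≤ 2 ^ K) :
    1 - (1 / 2) ^ m ≤ coinLaw {ω | ∃ τ, Outcome B D A K τ ω} := by
  obtain ⟨ρ, p₀, hρ, hp₀, h0, hle, hsum⟩ := h.exists_prob hA
  set H := 8 * A.card * K with hH
  set E₀ := {ω | ¬ ∃ d ∈ draws D B K ω, d ≠ none} with hE₀
  set E₁ := ⋃ z ∈ A, ⋃ y ∈ A.erase z,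
    {ω | (draws D B H ω).foldl (raceUpd K z y) (false, 0) = (false, K)} with hE₁
  set E₂ := ⋃ y ∈ A, {ω | (draws D B H ω).count (some y) ≤ K} with hE₂
  set E₃ := ⋃ k ∈ Finset.Icc 1 (A.card / 2),
    {ω | (found (draws D B (12 * k * K) ω)).card < k} with hE₃
  set n := A.card with hn
  have hn1 : 1 ≤ n := Finset.card_pos.mpr hA
  have b1 : coinLaw.real E₁ ≤ n * n * (1 / 2) ^ K := by
    refine (measureReal_biUnion_finset_le _ _).trans ?_
    calc _ ≤ ∑ z ∈ A, (n : ℝ) * (1 / 2) ^ K := ?_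
      _ = _ := by rw [Finset.sum_const, nsmul_eq_mul, mul_assoc]
    refine Finset.sum_le_sum fun z hz => (measureReal_biUnion_finset_le _ _).trans ?_
    calc _ ≤ ∑ y ∈ A.erase z, ((1 : ℝ) / 2) ^ K := Finset.sum_le_sum fun y hy =>
          h.prob_race hρ hp₀ hsum K H hz (Finset.mem_of_mem_erase hy) (Finset.ne_of_mem_erase hy).symm
      _ ≤ ∑ y ∈ A, ((1 : ℝ) / 2) ^ K := Finset.sum_le_sum_of_subset_of_nonneg
          (Finset.erase_subset _ _) fun _ _ _ => by positivity
      _ = _ := by rw [Finset.sum_const, nsmul_eq_mul]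
  have b2 : coinLaw.real E₂ ≤ n * (1 / 2) ^ K := by
    refine (measureReal_biUnion_finset_le _ _).trans ?_
    calc _ ≤ ∑ y ∈ A, ((1 : ℝ) / 2) ^ K := Finset.sum_le_sum fun y hy =>
          h.prob_count hρ hp₀ hle hsum K hy
      _ = _ := by rw [Finset.sum_const, nsmul_eq_mul]
  have b3 : coinLaw.real E₃ ≤ n * (1 / 2) ^ K := by
    refine (measureReal_biUnion_finset_le _ _).trans ?_
    calc _ ≤ ∑ k ∈ Finset.Icc 1 (n / 2), ((1 : ℝ) / 2) ^ K := Finset.sum_le_sum fun k hk => by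
          rw [Finset.mem_Icc] at hk
          exact h.prob_distinct hρ hp₀ hle hsum hK hk.1 (by omega)
      _ = ((n / 2 : ℕ) : ℝ) * (1 / 2) ^ K := by rw [Finset.sum_const, nsmul_eq_mul]; simp
      _ ≤ _ := mul_le_mul_of_nonneg_right (by exact_mod_cast Nat.div_le_self n 2) (by positivity)
  have b0 : coinLaw.real E₀ ≤ (1 / 2) ^ K := h.prob_none_found hρ hp₀ hle K
  set E := E₀ ∪ E₁ ∪ E₂ ∪ E₃ with hE
  have hbad : coinLaw.real E ≤ (1 / 2) ^ m := by
    have hu : coinLaw.real E ≤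
        coinLaw.real E₀ + coinLaw.real E₁ + coinLaw.real E₂ + coinLaw.real E₃ :=
      (measureReal_union_le _ _).trans (add_le_add ((measureReal_union_le _ _).trans
        (add_le_add (measureReal_union_le _ _) le_rfl)) le_rfl)
    have hn1' : (1 : ℝ) ≤ n := by exact_mod_cast hn1
    have hKm' : 4 * (n : ℝ) ^ 2 * 2 ^ m ≤ 2 ^ K := by exact_mod_cast hKm
    have hp : (0 : ℝ) < (1 / 2) ^ K := by positivity
    -- One event for the first draws, at most n² races, n counts and at most n values of k; n ≥ 1
    -- bounds their number by 4n².
    calc _ ≤ (1 + n * n + n + n) * (1 / 2 : ℝ) ^ K := by linarith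
      _ ≤ 4 * n ^ 2 * (1 / 2 : ℝ) ^ K := mul_le_mul_of_nonneg_right (by nlinarith) hp.le
      _ ≤ (1 / 2) ^ m := by
        rw [one_div, inv_pow, inv_pow, ← div_eq_mul_inv, div_le_iff₀ (by positivity),
          ← div_eq_inv_mul, le_div_iff₀ (by positivity)]
        exact hKm'
  have hmeas : MeasurableSet E := by
    have hm : ∀ t (R : List (Option α) → Prop), MeasurableSet {ω | R (draws D B t ω)} :=
      fun t R => (h.dependsOnFirst t R).measurableSet
    refine ((((hm K fun L => ¬ ∃ d ∈ L, d ≠ none).union ?_).union ?_).union ?_)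
    · exact .biUnion A.countable_toSet fun z _ => .biUnion (A.erase z).countable_toSet fun y _ =>
        hm H fun L => L.foldl (raceUpd K z y) (false, 0) = (false, K)
    · exact .biUnion A.countable_toSet fun y _ => hm H fun L => L.count (some y) ≤ K
    · exact .biUnion (Finset.countable_toSet _) fun k _ =>
        hm (12 * k * K) fun L => (found L).card < k
  have hsub : Eᶜ ⊆ {ω | ∃ τ, Outcome B D A K τ ω} := by
    intro ω hω
    simp only [hE, Set.mem_compl_iff, Set.mem_union, not_or] at hω
    obtain ⟨⟨⟨g0, g1⟩, g2⟩, g3⟩ := hω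
    refine h.outcome ⟨not_not.mp g0, fun z hz y hy hne heq => g1 ?_, fun y hy => ?_,
      fun k hk hkn => ?_⟩
    · exact Set.mem_biUnion hz (Set.mem_biUnion
        (Finset.mem_coe.mpr (Finset.mem_erase.mpr ⟨hne.symm, hy⟩)) heq)
    · by_contra hlt
      exact g2 (Set.mem_biUnion hy (not_lt.mp hlt))
    · by_contra hlt
      exact g3 (Set.mem_biUnion (Finset.mem_coe.mpr (Finset.mem_Icc.mpr ⟨hk, by omega⟩))
        (not_le.mp hlt))
  refine le_trans ?_ (measure_mono hsub)
  rw [prob_compl_eq_one_sub hmeas]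
  refine tsub_le_tsub_left ?_ _
  rw [← ENNReal.ofReal_toReal (measure_ne_top coinLaw E)]
  refine (ENNReal.ofReal_le_ofReal hbad).trans (le_of_eq ?_)
  rw [ENNReal.ofReal_pow (by norm_num), ENNReal.ofReal_div_of_pos (by norm_num)]
  simp

end

/-! ## Time and space along a run -/

/-- The sum of two numbers of at most V bits has at most V + 1 bits. -/
theorem Good.cost_le {T V : ℕ} {c : Cfg} (h : Good T (2 ^ V) c) (I : Instr) :
    I.cost c.reg ≤ V + 1 := by
  have hadd : ∀ j k, bitLength (c.reg j + c.reg k) ≤ V + 1 := fun j k => by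
    have h1 := h.reg j
    have h2 := h.reg k
    exact bitLength_le (by rw [pow_succ]; omega) (by omega)
  cases I <;> first | exact hadd _ _ | simp [Instr.cost]

theorem time_run_le {P : Program} {ω : Coins} {inp : List ℕ} {T V t : ℕ}
    (h : ∀ j, j ≤ t → Good T (2 ^ V) (run P ω inp j)) :
    (run P ω inp t).time ≤ t * (V + 1) := by
  induction t with
  | zero => simp [run, init]
  | succ t ih =>
    have h1 := ih fun j hj => h j (by omega)
    rw [run_succ, step]
    cases P[(run P ω inp t).pc]? with
    | none => simp only; nlinarith
    | some I =>
      have := (h t (by omega)).cost_le I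
      simp only [Instr.exec]
      rw [Nat.succ_mul]
      omega

theorem Good.space_le {T V : ℕ} {c : Cfg} (h : Good T (2 ^ V) c) (hV : 1 ≤ V) :
    c.space ≤ T * V := by
  calc c.space ≤ ∑ i ∈ Finset.range c.top, V :=
        Finset.sum_le_sum fun i _ => bitLength_le (h.reg i) hV
    _ = c.top * V := by simp
    _ ≤ T * V := Nat.mul_le_mul_right _ h.top

theorem out_step_prefix (P : Program) (ω : Coins) (c : Cfg) : c.out <+: (step P ω c).out := by
  rw [step]
  cases P[c.pc]? with
  | none => exact List.prefix_rfl
  | some I => exact List.prefix_append _ _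

theorem out_run_prefix (P : Program) (ω : Coins) (inp : List ℕ) {t t' : ℕ} (h : t ≤ t') :
    (run P ω inp t).out <+: (run P ω inp t').out := by
  induction t', h using Nat.le_induction with
  | base => exact List.prefix_rfl
  | succ n _ ih => rw [run_succ]; exact ih.trans (out_step_prefix _ _ _)

theorem out_time_le (P : Program) (ω : Coins) (inp : List ℕ) (t : ℕ) :
    ∀ o ∈ (run P ω inp t).out, o.1 ≤ (run P ω inp t).time := by
  induction t with
  | zero => simp [run, init]
  | succ t ih =>
    rw [run_succ, step]
    cases P[(run P ω inp t).pc]? with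
    | none => exact ih
    | some I =>
      intro o ho
      simp only [Instr.exec, List.mem_append, List.mem_map] at ho ⊢
      rcases ho with ho | ⟨w, -, rfl⟩
      · exact (ih o ho).trans (Nat.le_add_right _ _)
      · exact le_rfl

/-- Words output within the first `t` steps remain in the later output, with time stamps at most the
time reached at step `t`. That time therefore belongs to the set whose infimum defines `incTime`. -/
theorem incTime_run_le (P : Program) (ω : Coins) (inp : List ℕ) {t t' k : ℕ} (h : t ≤ t')
    (hk : k ≤ (run P ω inp t).words.toFinset.card) :
    (run P ω inp t').incTime k ≤ (run P ω inp t).time := by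
  refine Nat.sInf_le (hk.trans (Finset.card_le_card fun w hw => ?_))
  rw [List.mem_toFinset, Cfg.words, List.mem_map] at hw
  obtain ⟨o, ho, rfl⟩ := hw
  rw [List.mem_toFinset, List.mem_map]
  refine ⟨o, List.mem_filter.mpr ⟨(out_run_prefix P ω inp h).subset ho, ?_⟩, rfl⟩
  simpa using out_time_le P ω inp t o ho

/-! ## The machine -/

/-- The program that enumerates the solutions. -/
def mainProg (s κ d : ℕ) (Pg Pt : Program) : Program :=
  (prologue s κ d ;; .loop 1 18 (bodyCmd Pg Pt)).code 0

section

variable {s : ℕ} {Pg Pt : Program} {xs : List ℕ} {Acc : List ℕ → Prop} {Xb Bd B Ts T W : ℕ}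
  {ω : Coins}

/-- The result of one draw. -/
noncomputable def mainDraw (s Bd : ℕ) (Pg : Program) (xs : List ℕ) (Acc : List ℕ → Prop)
    (ω : Coins) : Option (List ℕ) :=
  drawOf s Bd Acc (finalWords Pg ω (xs.length :: xs))

/-- The algorithm has done `i` iterations of its main loop, and is in the configuration `c`. -/
structure Head (s κ d : ℕ) (Pg : Program) (xs : List ℕ) (Acc : List ℕ → Prop) (Xb Bd T W : ℕ)
    (ω : Coins) (i : ℕ) (c : Cfg) (σ : St) : Prop where
  pc : c.pc = (prologue s κ d).len
  rep : Rep 40 c σ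
  good : Good T W c
  between : Between s Xb Bd xs
    ((draws (mainDraw s Bd Pg xs Acc) Bd i ω).foldl (nextState Bd) (none, Bd)) σ
  fl : σ.fl = i * Bd
  out : σ.out = (draws (mainDraw s Bd Pg xs Acc) Bd i ω).reduceOption

theorem codeAt_mainProg (s κ d : ℕ) (Pg Pt : Program) :
    CodeAt (mainProg s κ d Pg Pt) 0 ((prologue s κ d).code 0) ∧
    CodeAt (mainProg s κ d Pg Pt) (prologue s κ d).len
      ((Cmd.loop 1 18 (bodyCmd Pg Pt)).code (prologue s κ d).len) := by
  have := codeAt_self (mainProg s κ d Pg Pt)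
  nth_rewrite 2 [mainProg] at this
  rw [Cmd.code, codeAt_append, Cmd.length_code, Nat.zero_add] at this
  exact this

theorem length_mainProg (s κ d : ℕ) (Pg Pt : Program) : (mainProg s κ d Pg Pt).length =
    (prologue s κ d).len + (Cmd.loop 1 18 (bodyCmd Pg Pt)).len := by
  rw [mainProg, Cmd.length_code, Cmd.len]

theorem Head.next (S : Setting s Pg Pt xs Acc Xb Bd B Ts T W) {κ d i : ℕ} {c : Cfg} {σ : St}
    (h : Head s κ d Pg xs Acc Xb Bd T W ω i c σ)
    (hgo : ((draws (mainDraw s Bd Pg xs Acc) Bd i ω).foldl (nextState Bd) (none, Bd)).2 ≠ 0) :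
    ∃ k, 1 ≤ k ∧ k ≤ bodySteps Pg Pt T + 2 ∧
      (∀ j, j ≤ k → Good T W ((step (mainProg s κ d Pg Pt) ω)^[j] c)) ∧
      ∃ σ', Head s κ d Pg xs Acc Xb Bd T W ω (i + 1)
        ((step (mainProg s κ d Pg Pt) ω)^[k] c) σ' := by
  have hb := S.bds.low
  have hbud := h.between.budget
  have hv1 := h.between.env.v1
  have hbody := bodyCmd_spec (ω := ω) S h.between rfl
  rw [h.fl, ← mainDraw] at hbody
  obtain ⟨k, h1, hk, hg, hpc, σ', hr, hb', hfl, hout⟩ := hbody.loop_enter hb (by norm_num)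
    (by norm_num) (by omega) (P := mainProg s κ d Pg Pt) (c := c)
    (h.pc ▸ (codeAt_mainProg s κ d Pg Pt).2) h.rep h.good
  refine ⟨k, h1, hk, hg, σ', hpc.trans h.pc, hr, hg k le_rfl, ?_, ?_, ?_⟩
  · rw [draws_succ', List.foldl_append]
    exact hb'
  · rw [hfl, Nat.succ_mul]
  · rw [draws_succ', List.reduceOption_append, List.reduceOption_singleton, hout, h.out]

theorem Head.exhausted (S : Setting s Pg Pt xs Acc Xb Bd B Ts T W) {κ d i : ℕ} {c : Cfg} {σ : St}
    (h : Head s κ d Pg xs Acc Xb Bd T W ω i c σ)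
    (hgo : ((draws (mainDraw s Bd Pg xs Acc) Bd i ω).foldl (nextState Bd) (none, Bd)).2 = 0) :
    ∃ k, k ≤ 2 ∧ (∀ j, j ≤ k → Good T W ((step (mainProg s κ d Pg Pt) ω)^[j] c)) ∧
      (mainProg s κ d Pg Pt).length ≤ ((step (mainProg s κ d Pg Pt) ω)^[k] c).pc ∧
      ((step (mainProg s κ d Pg Pt) ω)^[k] c).words =
        (draws (mainDraw s Bd Pg xs Acc) Bd i ω).reduceOption := by
  have hb := S.bds.low
  have hbud := h.between.budget
  have hv1 := h.between.env.v1
  obtain ⟨k, hk, hg, hpc, σ', hr, rfl⟩ := (WP.loop_done (ω := ω) (W := W) (C := bodyCmd Pg Pt)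
    (Q := fun τ => τ = σ) (i := 1) (j := 18) hb (by norm_num) (by norm_num) (by omega) rfl)
    (mainProg s κ d Pg Pt) c (h.pc ▸ (codeAt_mainProg s κ d Pg Pt).2) h.rep h.good
  refine ⟨k, hk, hg, ?_, hr.out.trans h.out⟩
  rw [hpc, h.pc, length_mainProg]

/-- A bound on the number of steps of the machine until the end of the iteration number `i`. -/
def headSteps (d n : ℕ) (Pg Pt : Program) (T i : ℕ) : ℕ :=
  60 + n * 6 + (11 + d) + i * (bodySteps Pg Pt T + 2)

/-- Iteration of `Head.next` as long as the budget is positive. The inequality `i ≤ t` holds since a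
round takes at least one step, and is what makes the argument usable for runs that do not halt. -/
theorem exists_head (S : Setting s Pg Pt xs Acc Xb Bd B Ts T W) {κ d n m : ℕ}
    (hn : xs.length = n) (hXb : Xb = 8 * n + 13 * m + 40) (hBd : Bd = κ * (n + m + 1) ^ d)
    (hT : 9 * n + 13 * m + 50 + Bd ≤ T) (hs : s + 1 < W) (hκ : κ < W) (hm : m < W)
    (hxs : ∀ a ∈ xs, a < W) (i : ℕ)
    (hgo : ∀ j, j < i →
      ((draws (mainDraw s Bd Pg xs Acc) Bd j ω).foldl (nextState Bd) (none, Bd)).2 ≠ 0) :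
    ∃ t, i ≤ t ∧ t ≤ headSteps d n Pg Pt T i ∧
      (∀ j, j ≤ t → Good T W (run (mainProg s κ d Pg Pt) ω (n :: m :: xs) j)) ∧
      ∃ σ, Head s κ d Pg xs Acc Xb Bd T W ω i
        (run (mainProg s κ d Pg Pt) ω (n :: m :: xs) t) σ := by
  induction i with
  | zero =>
    have hlt := S.bds.lt
    have hrep : Rep 40 (init (n :: m :: xs))
        (St.ofReg (fun i => (n :: m :: xs).getD i 0) 0 []) :=
      ⟨fun _ _ => rfl, fun _ _ => rfl, rfl, rfl⟩
    have hgood : Good T W (init (n :: m :: xs)) := by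
      refine ⟨by simp [init]; omega, fun r => ?_⟩
      simp only [init]
      by_cases hr : r < (n :: m :: xs).length
      · rw [List.getD_eq_getElem _ _ hr]
        have := List.getElem_mem hr
        simp only [List.mem_cons] at this
        rcases this with h | h | h
        · omega
        · omega
        · exact hxs _ h
      · rw [List.getD_eq_default _ _ (by omega)]
        omega
    obtain ⟨t, ht, hg, hpc, σ, hr, hb, hfl, hout⟩ := prologue_spec (ω := ω) S.bds hn hBd hT hs hκ
      (mainProg s κ d Pg Pt) (init (n :: m :: xs)) (codeAt_mainProg s κ d Pg Pt).1 hrep hgood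
    subst hXb
    refine ⟨t, Nat.zero_le t, by rw [headSteps]; omega, hg, σ, ?_, hr, hg t le_rfl, hb, ?_, ?_⟩
    · rw [run, hpc]; simp [init]
    · simpa using hfl
    · simpa [draws] using hout
  | succ i ih =>
    obtain ⟨t, hit, ht, hg, σ, hh⟩ := ih fun j hj => hgo j (by omega)
    obtain ⟨k, h1, hk, hg', σ', hh'⟩ := hh.next S (hgo i (by omega))
    refine ⟨k + t, by omega, ?_, good_iterate_add hg hg', σ', ?_⟩
    · simp only [headSteps] at ht ⊢
      rw [Nat.succ_mul]
      omega
    · rwa [run, Function.iterate_add_apply]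

/-- Every run respects the bounds at every moment. -/
theorem good_run (S : Setting s Pg Pt xs Acc Xb Bd B Ts T W) {κ d n m : ℕ}
    (hn : xs.length = n) (hXb : Xb = 8 * n + 13 * m + 40) (hBd : Bd = κ * (n + m + 1) ^ d)
    (hT : 9 * n + 13 * m + 50 + Bd ≤ T) (hs : s + 1 < W) (hκ : κ < W) (hm : m < W)
    (hxs : ∀ a ∈ xs, a < W) (t : ℕ) :
    Good T W (run (mainProg s κ d Pg Pt) ω (n :: m :: xs) t) := by
  classical
  have hhead := exists_head (ω := ω) S hn hXb hBd hT hs hκ hm hxs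
  by_cases hex : ∃ i,
      ((draws (mainDraw s Bd Pg xs Acc) Bd i ω).foldl (nextState Bd) (none, Bd)).2 = 0
  · obtain ⟨t₁, -, -, hg, σ, hh⟩ := hhead (Nat.find hex) fun j hj => Nat.find_min hex hj
    obtain ⟨k, -, hg', hpc, -⟩ := hh.exhausted S (Nat.find_spec hex)
    have hgk := good_iterate_add hg hg'
    rw [run, ← Function.iterate_add_apply] at hpc
    rcases le_total t (k + t₁) with ht | ht
    · exact hgk t ht
    · rw [run_of_length_le hpc ht]
      exact hgk _ le_rfl
  -- If the budget never runs out, the beginning of round `t` comes after at least `t` steps, and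
  -- the bounds hold up to there.
  · obtain ⟨t₁, ht, -, hg, -⟩ := hhead t fun j _ hj => hex ⟨j, hj⟩
    exact hg t ht

/-- The run of the machine when the budget is exhausted after `τ` draws. -/
theorem exists_halt (S : Setting s Pg Pt xs Acc Xb Bd B Ts T W) {κ d n m τ : ℕ}
    (hn : xs.length = n) (hXb : Xb = 8 * n + 13 * m + 40) (hBd : Bd = κ * (n + m + 1) ^ d)
    (hT : 9 * n + 13 * m + 50 + Bd ≤ T) (hs : s + 1 < W) (hκ : κ < W) (hm : m < W)
    (hxs : ∀ a ∈ xs, a < W) {V : ℕ} (hV : W = 2 ^ V)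
    (hgo : ∀ j, j < τ →
      ((draws (mainDraw s Bd Pg xs Acc) Bd j ω).foldl (nextState Bd) (none, Bd)).2 ≠ 0)
    (h0 : ((draws (mainDraw s Bd Pg xs Acc) Bd τ ω).foldl (nextState Bd) (none, Bd)).2 = 0) :
    ∃ c, HaltsAt (mainProg s κ d Pg Pt) ω (n :: m :: xs) c ∧
      c.words = (draws (mainDraw s Bd Pg xs Acc) Bd τ ω).reduceOption ∧
      c.time ≤ (headSteps d n Pg Pt T τ + 2) * (V + 1) ∧
      ∀ i k, i ≤ τ → k ≤ (found (draws (mainDraw s Bd Pg xs Acc) Bd i ω)).card →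
        c.incTime k ≤ headSteps d n Pg Pt T i * (V + 1) := by
  have hhead := exists_head (ω := ω) S hn hXb hBd hT hs hκ hm hxs
  obtain ⟨t, -, ht, hg, σ, hh⟩ := hhead τ hgo
  obtain ⟨k, hk, hg', hpc, hw⟩ := hh.exhausted S h0
  have hgk := good_iterate_add hg hg'
  rw [run, ← Function.iterate_add_apply] at hpc hw
  subst hV
  refine ⟨_, ⟨⟨k + t, rfl⟩, hpc⟩, hw, (time_run_le hgk).trans (Nat.mul_le_mul_right _ (by omega)),
    fun i k' hi hk' => ?_⟩
  obtain ⟨u, -, hu, hgu, σ', hh'⟩ := hhead i fun j hj => hgo j (by omega)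
  have hw' : (run (mainProg s κ d Pg Pt) ω (n :: m :: xs) u).words.toFinset =
      found (draws (mainDraw s Bd Pg xs Acc) Bd i ω) := by
    rw [hh'.rep.out, hh'.out, found]
  rw [← hw'] at hk'
  have hfin : (run (mainProg s κ d Pg Pt) ω (n :: m :: xs) (k + t)).incTime k' ≤
      (run (mainProg s κ d Pg Pt) ω (n :: m :: xs) u).time := by
    -- The order of the two moments need not be known, since the run is stationary after halting.
    rcases le_total u (k + t) with hut | hut
    · exact incTime_run_le _ _ _ hut hk'
    · rw [← run_of_length_le hpc hut]
      exact incTime_run_le _ _ _ le_rfl hk'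
  exact hfin.trans ((time_run_le hgu).trans (Nat.mul_le_mul_right _ hu))

end

/-! ## Words -/

theorem letters_injective (s : ℕ) : Function.Injective (letters (s := s)) :=
  List.map_injective_iff.mpr Fin.val_injective

theorem lt_of_mem_letters {s : ℕ} (y : List (Fin s)) : ∀ a ∈ letters y, a < s := by
  intro a ha
  obtain ⟨i, -, rfl⟩ := List.mem_map.mp ha
  exact i.isLt

theorem exists_letters {s : ℕ} {w : List ℕ} (h : ∀ a ∈ w, a < s) :
    ∃ y : List (Fin s), letters y = w := by
  lift w to List (Fin s) using h
  exact ⟨w, rfl⟩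

theorem wordCode_lt {s : ℕ} {w : List ℕ} (h : ∀ a ∈ w, a < s) :
    wordCode s w < 2 * (s + 1) ^ w.length := by
  induction w using List.reverseRecOn with
  | nil => simp [wordCode]
  | append_singleton w a ih =>
    have h1 := ih fun b hb => h b (by simp [hb])
    have h2 := h a (by simp)
    have h3 := Nat.mul_le_mul_right (s + 1) (Nat.succ_le_of_lt h1)
    rw [wordCode_concat, List.length_append, List.length_singleton, pow_succ, ← mul_assoc]
    rw [Nat.succ_mul] at h3
    omega

/-- A set of words of bounded length is finite, of bounded cardinality. -/
theorem finite_and_ncard_le {s ℓ : ℕ} {E : Set (List (Fin s))} (h : ∀ y ∈ E, y.length ≤ ℓ) :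
    E.Finite ∧ E.ncard ≤ 2 * (s + 1) ^ ℓ := by
  have hinj : Function.Injective fun y : List (Fin s) => wordCode s (letters y) := fun y y' hy =>
    letters_injective s (wordCode_injOn (lt_of_mem_letters y) (lt_of_mem_letters y') hy)
  have hsub : (fun y : List (Fin s) => wordCode s (letters y)) '' E ⊆
      (Finset.range (2 * (s + 1) ^ ℓ) : Set ℕ) := by
    rintro _ ⟨y, hy, rfl⟩
    rw [Finset.mem_coe, Finset.mem_range]
    refine (wordCode_lt (lt_of_mem_letters y)).trans_le (Nat.mul_le_mul_left _
      (Nat.pow_le_pow_right (by omega) ?_))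
    simpa [letters] using h y hy
  refine ⟨((Finset.finite_toSet _).subset hsub).of_finite_image hinj.injOn, ?_⟩
  rw [← Set.ncard_image_of_injective E hinj]
  refine (Set.ncard_le_ncard hsub).trans (le_of_eq ?_)
  rw [Set.ncard_coe_finset, Finset.card_range]

/-! ## Polynomial bounds -/

/-- The function is given by a polynomial. -/
def PolyFun (f : ℕ → ℕ) : Prop := ∃ p : Polynomial ℕ, ∀ N, p.eval N = f N

theorem polyFun_const (a : ℕ) : PolyFun fun _ => a := ⟨Polynomial.C a, fun N => by simp⟩

theorem polyFun_id : PolyFun fun N => N := ⟨Polynomial.X, fun N => by simp⟩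

theorem PolyFun.add {f g : ℕ → ℕ} (hf : PolyFun f) (hg : PolyFun g) : PolyFun fun N => f N + g N := by
  obtain ⟨p, hp⟩ := hf
  obtain ⟨q, hq⟩ := hg
  exact ⟨p + q, fun N => by simp [hp, hq]⟩

theorem PolyFun.mul {f g : ℕ → ℕ} (hf : PolyFun f) (hg : PolyFun g) : PolyFun fun N => f N * g N := by
  obtain ⟨p, hp⟩ := hf
  obtain ⟨q, hq⟩ := hg
  exact ⟨p * q, fun N => by simp [hp, hq]⟩

theorem PolyFun.pow {f : ℕ → ℕ} (hf : PolyFun f) (k : ℕ) : PolyFun fun N => f N ^ k := by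
  obtain ⟨p, hp⟩ := hf
  exact ⟨p ^ k, fun N => by simp [hp]⟩

theorem PolyFun.eval {f : ℕ → ℕ} (hf : PolyFun f) (q : Polynomial ℕ) :
    PolyFun fun N => q.eval (f N) := by
  obtain ⟨p, hp⟩ := hf
  exact ⟨q.comp p, fun N => by simp [hp]⟩

theorem eval_mono (p : Polynomial ℕ) : Monotone fun N => p.eval N := by
  intro a b hab
  simp only [Polynomial.eval_eq_sum_range]
  exact Finset.sum_le_sum fun i _ => Nat.mul_le_mul_left _ (Nat.pow_le_pow_left hab i)

/-- Take the sum of the coefficients for `C` and the degree for `b`. -/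
theorem PolyFun.exists_le {f : ℕ → ℕ} (hf : PolyFun f) : ∃ C b, ∀ N, f N ≤ C * (N + 1) ^ b := by
  obtain ⟨p, hp⟩ := hf
  refine ⟨∑ i ∈ Finset.range (p.natDegree + 1), p.coeff i, p.natDegree, fun N => ?_⟩
  rw [← hp, Polynomial.eval_eq_sum_range, Finset.sum_mul]
  refine Finset.sum_le_sum fun i hi => Nat.mul_le_mul_left _ ?_
  rw [Finset.mem_range] at hi
  exact (Nat.pow_le_pow_left (Nat.le_succ N) i).trans (Nat.pow_le_pow_right (by omega) (by omega))

/-! ## The draws of the machine -/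

section

variable {s : ℕ} {A : List (Fin s) → Set (List (Fin s))} {x : List (Fin s)} {Bd : ℕ}
  {Pg : Program}

theorem mainDraw_eq_some_iff {ω : Coins} {c : Cfg} {y : List (Fin s)} (hy : y ∈ A x)
    (hlen : y.length ≤ Bd) (hc : HaltsAt Pg ω (x.length :: letters x) c) :
    mainDraw s Bd Pg (letters x) (· ∈ letters '' A x) ω = some (letters y) ↔
      c.words = [letters y] := by
  have hl : (letters x).length = x.length := by simp [letters]
  rw [mainDraw, hl, hc.finalWords]
  refine ⟨fun h => (drawOf_eq_some h).1, fun h => ?_⟩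
  rw [h, drawOf, if_pos ⟨by simpa [letters] using hlen, lt_of_mem_letters y, y, hy, rfl⟩]

/-- The filter in `drawOf` loses no solution: all are short enough, legal and accepted, so the law
is that of the generator. A run of at most `Bd` steps reads at most the first `Bd` coins. -/
theorem uniformDraw_mainDraw (hfin : (A x).Finite)
    (hlen : ∀ y ∈ A x, y.length ≤ Bd)
    (hhalt : ∀ ω : Coins, ∃ c, HaltsAt Pg ω (x.length :: letters x) c ∧ c.time ≤ Bd)
    (hout : ∀ ω c, HaltsAt Pg ω (x.length :: letters x) c →
      c.words = [] ∨ ∃ y ∈ A x, c.words = [letters y])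
    (hunif : ∀ y ∈ A x, ∀ y' ∈ A x,
      coinLaw {ω | ∃ c, HaltsAt Pg ω (x.length :: letters x) c ∧ c.words = [letters y]} =
      coinLaw {ω | ∃ c, HaltsAt Pg ω (x.length :: letters x) c ∧ c.words = [letters y']})
    (hfail : coinLaw {ω | ∃ c, HaltsAt Pg ω (x.length :: letters x) c ∧ c.words = []} ≤ 1 / 2) :
    UniformDraw Bd (mainDraw s Bd Pg (letters x) (· ∈ letters '' A x))
      (hfin.image letters).toFinset := by
  have hl : (letters x).length = x.length := by simp [letters]
  have heq : ∀ y ∈ A x, {ω | mainDraw s Bd Pg (letters x) (· ∈ letters '' A x) ω =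
      some (letters y)} =
      {ω | ∃ c, HaltsAt Pg ω (x.length :: letters x) c ∧ c.words = [letters y]} := by
    intro y hy
    ext ω
    obtain ⟨c, hc, -⟩ := hhalt ω
    simp only [Set.mem_ofPred_eq]
    rw [mainDraw_eq_some_iff hy (hlen y hy) hc]
    exact ⟨fun h => ⟨c, hc, h⟩, fun ⟨c', hc', h⟩ => hc.unique hc' ▸ h⟩
  constructor
  · intro ω ω' hω
    obtain ⟨c, hc, htime⟩ := hhalt ω
    obtain ⟨t, ht, rfl, hle⟩ := hc.exists_stopsAt
    have hrun := run_congr (P := Pg) (inp := x.length :: letters x) (t := t) fun i hi =>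
      hω i (by omega)
    have hc' : HaltsAt Pg ω' (x.length :: letters x) (run Pg ω (x.length :: letters x) t) :=
      ⟨⟨t, hrun.symm⟩, hc.2⟩
    rw [mainDraw, mainDraw, hl, hc.finalWords, hc'.finalWords]
  · intro ω w hw
    rw [Set.Finite.mem_toFinset]
    exact (drawOf_eq_some hw).2.2.2
  · intro w hw w' hw'
    rw [Set.Finite.mem_toFinset] at hw hw'
    obtain ⟨y, hy, rfl⟩ := hw
    obtain ⟨y', hy', rfl⟩ := hw'
    rw [heq y hy, heq y' hy']
    exact hunif y hy y' hy'
  · refine (measure_mono fun ω hω => ?_).trans hfail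
    obtain ⟨c, hc, -⟩ := hhalt ω
    refine ⟨c, hc, (hout ω c hc).resolve_right ?_⟩
    rintro ⟨y, hy, hw⟩
    rw [Set.mem_ofPred_eq, (mainDraw_eq_some_iff hy (hlen y hy) hc).mpr hw] at hω
    cases hω

end

/-! ## The choice of the parameters -/

/-- A bound on the constants of a program. -/
theorem exists_consts_le (P : Program) : ∃ S, ∀ I ∈ P, ∀ a ∈ I.consts, a ≤ S :=
  ⟨(P.flatMap Instr.consts).sum, fun I hI a ha =>
    List.single_le_sum (fun _ _ => Nat.zero_le _) a (List.mem_flatMap.mpr ⟨I, hI, ha⟩)⟩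

theorem exists_stopsAt_reg_lt {P : Program} {ω : Coins} {inp : List ℕ} {S τ : ℕ} (hS : 1 ≤ S)
    (hP : ∀ I ∈ P, ∀ a ∈ I.consts, a < 2 ^ S) (hinp : ∀ a ∈ inp, a < 2 ^ S) {c : Cfg}
    (h : HaltsAt P ω inp c) (hτ : c.time ≤ τ) :
    ∃ t, t ≤ τ ∧ StopsAt P ω inp t ∧ (∀ k, k ≤ t → ∀ a, (run P ω inp k).reg a < 2 ^ (S + τ)) ∧
      run P ω inp t = c := by
  obtain ⟨t, ht, rfl, hle⟩ := h.exists_stopsAt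
  refine ⟨t, hle.trans hτ, ht, fun k hk a => (reg_run_lt hS hP hinp k a).trans_le
    (Nat.pow_le_pow_right (by norm_num) ?_), rfl⟩
  have := time_run_mono P ω inp hk
  dsimp at this
  omega

/-- `T` has to cover the moved instance, the candidate and the longest log. In `V`, the part `S N +
(Bd N + Ts N)` bounds the bits of the simulated registers, `T N` with the final 1 makes room for
addresses added to them, and `s * Bd N + 1` makes room for codes of words. -/
theorem exists_params {s : ℕ} {A : List (Fin s) → Set (List (Fin s))} {Pg Pt : Program}
    {pg pt : Polynomial ℕ} (κ d : ℕ) (hflip : ∀ i, Instr.flip i ∉ Pt)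
    (htest : ∀ (x y : List (Fin s)) (ω : Coins), ∃ c,
      HaltsAt Pt ω (x.length :: y.length :: (letters x ++ letters y)) c ∧
      c.time ≤ pt.eval (x.length + y.length) ∧ (c.reg 0 = 1 ↔ y ∈ A x))
    (hgen : ∀ (x : List (Fin s)) (ω : Coins), ∃ c,
      HaltsAt Pg ω (x.length :: letters x) c ∧ c.time ≤ pg.eval x.length)
    (hBd : ∀ N, pg.eval N ≤ κ * (N + 1) ^ d) :
    ∃ T V : ℕ → ℕ, PolyFun T ∧ PolyFun V ∧ ∀ (x : List (Fin s)) (m : ℕ), ∃ B Ts,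
      Setting s Pg Pt (letters x) (· ∈ letters '' A x) (8 * x.length + 13 * m + 40)
        (κ * (x.length + m + 1) ^ d) B Ts (T (x.length + m)) (2 ^ V (x.length + m)) ∧
      9 * x.length + 13 * m + 50 + κ * (x.length + m + 1) ^ d ≤ T (x.length + m) ∧
      s + 1 < 2 ^ V (x.length + m) ∧ κ < 2 ^ V (x.length + m) ∧ m < 2 ^ V (x.length + m) ∧
      ∀ a ∈ letters x, a < 2 ^ V (x.length + m) := by
  obtain ⟨Sg, hSg⟩ := exists_consts_le Pg
  obtain ⟨St, hSt⟩ := exists_consts_le Pt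
  set S₀ := Sg + St + Pg.length + Pt.length + κ + s + 1 with hS₀
  set Bd : ℕ → ℕ := fun N => κ * (N + 1) ^ d with hBdef
  set Ts : ℕ → ℕ := fun N => pt.eval (N + Bd N) with hTs
  set T : ℕ → ℕ := fun N => 20 * N + 60 + 5 * Bd N + 2 * Ts N with hT
  set S : ℕ → ℕ := fun N => S₀ + N + Bd N with hS
  set V : ℕ → ℕ := fun N => S N + (Bd N + Ts N) + T N + s * Bd N + 1 with hV
  have pBd : PolyFun Bd := (polyFun_const κ).mul ((polyFun_id.add (polyFun_const 1)).pow d)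
  have pTs : PolyFun Ts := (polyFun_id.add pBd).eval pt
  have pT : PolyFun T := ((((polyFun_const 20).mul polyFun_id).add (polyFun_const 60)).add
    ((polyFun_const 5).mul pBd)).add ((polyFun_const 2).mul pTs)
  have pS : PolyFun S := ((polyFun_const S₀).add polyFun_id).add pBd
  have pV : PolyFun V := (((pS.add (pBd.add pTs)).add pT).add ((polyFun_const s).mul pBd)).add
    (polyFun_const 1)
  refine ⟨T, V, pT, pV, fun x m => ?_⟩
  have hl : (letters x).length = x.length := by simp [letters]
  set N := x.length + m with hN
  have hlt : ∀ {a b : ℕ}, a ≤ b → a < 2 ^ b := fun h => h.trans_lt Nat.lt_two_pow_self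
  have hpow : ∀ {a b : ℕ}, a ≤ b → 2 ^ a ≤ 2 ^ b := fun h => Nat.pow_le_pow_right (by norm_num) h
  rw [show κ * (N + 1) ^ d = Bd N from rfl]
  have eT : T N = 20 * N + 60 + 5 * Bd N + 2 * Ts N := rfl
  have eS : S N = S₀ + N + Bd N := rfl
  have eV : V N = S N + (Bd N + Ts N) + T N + s * Bd N + 1 := rfl
  refine ⟨2 ^ (S N + (Bd N + Ts N)), Ts N, ⟨⟨by omega, hlt (by omega)⟩, by omega, ?_, ?_,
    fun I hI a ha => hlt ?_, hlt (by omega), fun I hI a ha => hlt ?_, hlt (by omega), hflip, ?_,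
    fun ω => ?_, fun ω w hw hws => ?_⟩, ?_, hlt (by omega), hlt (by omega), hlt (by omega),
    fun a ha => hlt ?_⟩
  · have h1 : T N < 2 ^ T N := Nat.lt_two_pow_self
    have h2 : 2 ^ (S N + (Bd N + Ts N)) ≤ 2 ^ (S N + (Bd N + Ts N) + T N) := hpow (by omega)
    have h3 : 2 ^ T N ≤ 2 ^ (S N + (Bd N + Ts N) + T N) := hpow (by omega)
    have h4 : 2 ^ (S N + (Bd N + Ts N) + T N + 1) ≤ 2 ^ V N := hpow (by omega)
    rw [pow_succ] at h4
    omega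
  -- The inequality s + 1 ≤ 2^s turns the bound on the codes into a power of two.
  · have h1 : (s + 1) ^ Bd N ≤ (2 ^ s) ^ Bd N := Nat.pow_le_pow_left Nat.lt_two_pow_self _
    rw [← pow_mul] at h1
    have h2 : 2 ^ (s * Bd N + 1) ≤ 2 ^ V N := hpow (by omega)
    rw [pow_succ] at h2
    omega
  · have := hSg I hI a ha
    omega
  · have := hSt I hI a ha
    omega
  · rw [hl]; omega
  · obtain ⟨c, hc, htime⟩ := hgen x ω
    have hinp : ∀ a ∈ x.length :: letters x, a < 2 ^ S N := fun a ha => hlt <| by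
      rcases List.mem_cons.mp ha with rfl | ha
      · omega
      · have := lt_of_mem_letters x a ha
        omega
    obtain ⟨t, h1, h2, h3, -⟩ := exists_stopsAt_reg_lt (S := S N) (τ := Bd N) (by omega)
      (fun I hI a ha => hlt (by have := hSg I hI a ha; omega)) hinp hc
      (htime.trans ((hBd _).trans (Nat.mul_le_mul_left _ (Nat.pow_le_pow_left (by omega) d))))
    rw [hl]
    exact ⟨t, h1, h2, fun k hk a => (h3 k hk a).trans_le (hpow (by omega))⟩
  · obtain ⟨y, rfl⟩ := exists_letters hws
    have hly : (letters y).length = y.length := by simp [letters]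
    rw [hly] at hw
    obtain ⟨c, hc, htime, hacc⟩ := htest x y ω
    have hinp : ∀ a ∈ x.length :: y.length :: (letters x ++ letters y), a < 2 ^ S N :=
        fun a ha => hlt <| by
      rcases List.mem_cons.mp ha with rfl | ha
      · omega
      rcases List.mem_cons.mp ha with rfl | ha
      · omega
      rcases List.mem_append.mp ha with ha | ha
      · have := lt_of_mem_letters x a ha
        omega
      · have := lt_of_mem_letters y a ha
        omega
    obtain ⟨t, h1, h2, h3, rfl⟩ := exists_stopsAt_reg_lt (S := S N) (τ := Ts N) (by omega)
      (fun I hI a ha => hlt (by have := hSt I hI a ha; omega)) hinp hc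
      (htime.trans (eval_mono pt (by change _ ≤ N + Bd N; omega)))
    rw [hl, hly]
    refine ⟨t, h1, h2, fun k hk a => (h3 k hk a).trans_le (hpow (by omega)), hacc.trans ?_⟩
    rw [(letters_injective s).mem_set_image]
  · omega
  · have := lt_of_mem_letters x a ha
    omega

/-- The coefficient of the bounds on the times. -/
def timeUnit (d n : ℕ) (Pg Pt : Program) (T Bd V : ℕ) : ℕ :=
  (73 + 6 * n + d + 16 * Bd * (bodySteps Pg Pt T + 2)) * (V + 1)

/-- The cost before the loop is simply charged k times, so that a single unit serves all the time
bounds; 73 is 60 + 11 for the prologue plus 2 for leaving the loop. -/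
theorem headSteps_mul_le {d n N T Bd V i k : ℕ} {Pg Pt : Program} (hn : n ≤ N) (hk : 1 ≤ k)
    (hi : i ≤ 16 * k * Bd) :
    (headSteps d n Pg Pt T i + 2) * (V + 1) ≤ k * timeUnit d N Pg Pt T Bd V := by
  rw [timeUnit, ← mul_assoc]
  refine Nat.mul_le_mul_right _ ?_
  have h1 := Nat.mul_le_mul_right (bodySteps Pg Pt T + 2) hi
  have h2 : 73 + 6 * N + d ≤ k * (73 + 6 * N + d) := Nat.le_mul_of_pos_left _ hk
  rw [show k * (73 + 6 * N + d + 16 * Bd * (bodySteps Pg Pt T + 2)) =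
    k * (73 + 6 * N + d) + 16 * k * Bd * (bodySteps Pg Pt T + 2) by ring, headSteps]
  omega

theorem polyFun_timeUnit (d : ℕ) (Pg Pt : Program) {T Bd V : ℕ → ℕ} (hT : PolyFun T)
    (hBd : PolyFun Bd) (hV : PolyFun V) :
    PolyFun fun N => timeUnit d N Pg Pt (T N) (Bd N) (V N) := by
  have hc := polyFun_const
  have hgen : PolyFun fun N => genSteps Pg (T N) :=
    (((hc 16).mul hT).add (hc 30)).add (hT.mul ((((hc (3 * Pg.length)).add
      ((hc 40).mul hT)).add (hc 62)).add (hT.mul (((hc 10).mul hT).add (hc 15)))))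
  have htest : PolyFun fun N => testSteps Pt (T N) :=
    (((hc 30).mul hT).add (hc 60)).add (hT.mul (((hc (3 * Pt.length)).add
      ((hc 20).mul hT)).add (hc 40)))
  have hbody : PolyFun fun N => bodySteps Pg Pt (T N) := (hgen.add htest).add (hc 18)
  exact ((((hc 73).add ((hc 6).mul polyFun_id)).add (hc d)).add
    (((hc 16).mul hBd).mul (hbody.add (hc 2)))).mul (hV.add (hc 1))

end EnumRAM

/-! ### Assembly of the machine and of the bounds. -/

theorem mainTheorem7 {s : ℕ} (A : List (Fin s) → Set (List (Fin s)))
    (hA : EnumRAM.EnumP A) (hG : EnumRAM.HasPolyTimeUniformGenerator A) :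
    EnumRAM.SolvableWHPIncLinearPolySpaceWithRepetitions A := by
  open EnumRAM in
  classical
  obtain ⟨⟨pl, hpl⟩, Pt, pt, hflip, htest⟩ := hA
  obtain ⟨Pg, pg, hgen⟩ := hG
  -- The budget must exceed the time of the generator, the length ℓ of the solutions, and the
  -- exponent in 4n²2^m ≤ 2^(4 + 2sℓ + m), which follows from n ≤ 2(s+1)^ℓ ≤ 2^(1 + sℓ).
  have pQ : PolyFun fun N => 4 + 2 * (s * pl.eval N) + N + pg.eval N + pl.eval N :=
    ((((polyFun_const 4).add ((polyFun_const 2).mul ((polyFun_const s).mul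
      (polyFun_id.eval pl)))).add polyFun_id).add (polyFun_id.eval pg)).add (polyFun_id.eval pl)
  obtain ⟨κ, d, hκd⟩ := pQ.exists_le
  obtain ⟨T, V, pT, pV, hpar⟩ := exists_params κ d hflip htest (fun x => (hgen x).1)
    fun N => by have := hκd N; omega
  have pBd : PolyFun fun N => κ * (N + 1) ^ d :=
    (polyFun_const κ).mul ((polyFun_id.add (polyFun_const 1)).pow d)
  have pU := polyFun_timeUnit d Pg Pt pT pBd pV
  obtain ⟨C, b, hCb⟩ := pU.exists_le
  obtain ⟨p, hp⟩ := pU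
  obtain ⟨q, hq⟩ := pT.mul pV
  refine ⟨mainProg s κ d Pg Pt, p, q, C, b, fun x m => ?_⟩
  obtain ⟨B, Ts, S, hT, hs, hκ, hm, hx⟩ := hpar x m
  have hl : (letters x).length = x.length := by simp [letters]
  set N := x.length + m with hN
  set Bd := κ * (N + 1) ^ d with hBd
  set D := mainDraw s Bd Pg (letters x) (· ∈ letters '' A x) with hD
  have hQ := hκd N
  have hpln : pl.eval x.length ≤ pl.eval N := eval_mono pl (by omega)
  have hpgn : pg.eval x.length ≤ pg.eval N := eval_mono pg (by omega)
  refine ⟨fun ω t => ?_, ?_⟩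
  · rw [hq]
    refine (good_run S hl rfl hBd hT hs hκ hm hx t).space_le ?_
    by_contra h0
    rw [not_le, Nat.lt_one_iff] at h0
    rw [h0] at hs
    omega
  have hhalt := fun (ω : Coins) (τ : ℕ) =>
    exists_halt (ω := ω) (τ := τ) S hl rfl hBd hT hs hκ hm hx rfl
  have hU := hCb N
  have hpN : p.eval N = timeUnit d N Pg Pt (T N) Bd (V N) := hp N
  set U := timeUnit d N Pg Pt (T N) Bd (V N) with hUdef
  -- Without solutions the generator promises only to halt, but the test rejects all its outputs.
  -- The budget then decreases at every draw and the run stops correctly after `Bd` draws, for all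
  -- coins.
  rcases (A x).eq_empty_or_nonempty with hemp | hne
  · have hall : ∀ ω : Coins, SolvesInIncLinearTime A (mainProg s κ d Pg Pt) p C b x m ω := by
      intro ω
      have hnone : ∀ t, ∀ dd ∈ draws D Bd t ω, dd = none := by
        intro t dd hdd
        by_contra hdn
        obtain ⟨w, rfl⟩ := Option.ne_none_iff_exists'.mp hdn
        obtain ⟨i, -, hi⟩ := List.mem_map.mp hdd
        have := (drawOf_eq_some hi).2.2.2
        simp [hemp] at this
      have hst : ∀ t, (draws D Bd t ω).foldl (nextState Bd) (none, Bd) = (none, Bd - t) := by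
        intro t
        rcases foldl_nextState Bd (draws D Bd t ω) with ⟨-, h⟩ | ⟨y, h, -⟩
        · rw [h, length_draws]
        · cases hnone t _ h
      obtain ⟨c, hc, hw, htime, -⟩ := hhalt ω Bd (fun j hj => by rw [hst]; dsimp; omega)
        (by rw [hst]; simp)
      refine ⟨c, hc, ?_, fun h => absurd hemp h.ne_empty, fun k h1 h2 => ?_, ?_⟩
      · ext w
        rw [Set.mem_ofPred_eq, hw, List.reduceOption_mem_iff]
        refine ⟨fun h => (by cases hnone _ _ h), fun ⟨y, hy, _⟩ => ?_⟩
        rw [hemp] at hy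
        exact hy.elim
      · rw [hemp, Set.ncard_empty] at h2
        omega
      · rw [hpN]
        refine le_trans ?_ (Nat.le_add_right _ _)
        rw [← one_mul U]
        exact htime.trans (headSteps_mul_le (by omega) le_rfl (by omega))
    rw [show {ω | SolvesInIncLinearTime A (mainProg s κ d Pg Pt) p C b x m ω} = Set.univ from
      Set.eq_univ_of_forall hall, MeasureTheory.measure_univ]
    exact tsub_le_self
  obtain ⟨hfin, hcard⟩ := finite_and_ncard_le (hpl x)
  obtain ⟨hout, hunif, hfail⟩ := (hgen x).2 hne
  have hUD : UniformDraw Bd D (hfin.image letters).toFinset :=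
    uniformDraw_mainDraw hfin (fun y hy => (hpl x y hy).trans (by omega))
      (fun ω => by
        obtain ⟨c, hc, ht⟩ := (hgen x).1 ω
        exact ⟨c, hc, ht.trans (by omega)⟩) hout hunif hfail
  have hcardA : (hfin.image letters).toFinset.card = (A x).ncard := by
    rw [← Set.ncard_eq_toFinset_card _ (hfin.image letters), Set.ncard_image_of_injective _ (letters_injective s)]
  refine (hUD.prob_outcome (K := Bd) (m := m) ?_ (by omega) ?_).trans
    (MeasureTheory.measure_mono ?_)
  · rw [Set.Finite.toFinset_nonempty]
    exact hne.image _
  · rw [hcardA]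
    have h1 : (A x).ncard ≤ 2 ^ (1 + s * pl.eval x.length) := by
      refine hcard.trans ?_
      rw [pow_add, pow_one, pow_mul]
      exact Nat.mul_le_mul_left _ (Nat.pow_le_pow_left Nat.lt_two_pow_self _)
    calc 4 * (A x).ncard ^ 2 * 2 ^ m ≤ 2 ^ 2 * (2 ^ (1 + s * pl.eval x.length)) ^ 2 * 2 ^ m :=
          Nat.mul_le_mul_right _ (Nat.mul_le_mul_left _ (Nat.pow_le_pow_left h1 2))
      _ = 2 ^ (2 + (1 + s * pl.eval x.length) * 2 + m) := by rw [← pow_mul, ← pow_add, ← pow_add]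
      _ ≤ 2 ^ Bd := by
        have := Nat.mul_le_mul_left s hpln
        exact Nat.pow_le_pow_right (by norm_num) (by omega)
  · rintro ω ⟨τ, ho⟩
    obtain ⟨c, hc, hw, htime, hinc⟩ := hhalt ω τ ho.go ho.exhausted
    have hle := ho.le
    rw [hcardA] at hle
    -- This bounds T(k) itself and not only T(k) - T(1); the case k = 1 is the bound on the
    -- preprocessing.
    have hinc' : ∀ k, 1 ≤ k → k ≤ (A x).ncard → c.incTime k ≤ k * U := by
      intro k h1 h2
      obtain ⟨t, ht, htk, hk⟩ := ho.delay k h1 (by rwa [hcardA])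
      exact (hinc t k ht hk).trans ((Nat.mul_le_mul_right _ (Nat.le_add_right _ 2)).trans
        (headSteps_mul_le (by omega) h1 htk))
    have hpos : 1 ≤ (A x).ncard := (Set.ncard_pos hfin).mpr hne
    refine ⟨c, hc, ?_, fun _ => ?_, fun k h1 h2 => ?_, ?_⟩
    · ext w
      rw [Set.mem_ofPred_eq, hw, List.reduceOption_mem_iff]
      refine ⟨fun h => ?_, fun h => ho.all w (by simpa using h)⟩
      simpa using hUD.mem_of_mem_draws h
    · rw [hpN, ← one_mul U]
      exact hinc' 1 le_rfl hpos
    · refine (hinc' k h1 h2).trans (le_trans ?_ (Nat.le_add_left _ _))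
      rw [mul_comm C k, mul_assoc]
      exact Nat.mul_le_mul_left k hU
    -- The total time is the same estimate with k = n, because the number of draws is at most 8nK ≤
    -- 16nK.
    · refine htime.trans ((headSteps_mul_le (N := N) (Bd := Bd) (k := (A x).ncard) (by omega) hpos (hle.trans ?_)).trans
        (le_trans ?_ (Nat.le_add_left _ _)))
      · exact Nat.mul_le_mul_right Bd (by omega)
      · rw [mul_comm C, mul_assoc]
        exact Nat.mul_le_mul_left _ hU
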